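/- Consider real-valued solutions of the first Painlevé equation $y''=6y^2-x$. Each solution is considered on its interval of existence, i.e. the largest open interval of $\mathbb R$ to which it extends as a solution; two solutions are the same if they have the same interval of existence and coincide on it. For $x_0\le 0$ let $$X(x_0)=\inf_{y_0,y_1\in\mathbb R} a(x_0,y_0,y_1)\in[-\infty,\infty],$$ where $a(x_0,y_0,y_1)\in[-\infty,x_0)$ is the left end point of the interval of existence of the solution with $y(x_0)=y_0$, $y'(x_0)=y_1$. **Theorem.** Let $x_0\le 0$. Then $-\infty<X(x_0)<x_0$, and for every real $x_1<x_0$: 1. if $x_1<X(x_0)$, there is no solution with interval of existence $(x_1,x_0)$; 2. if $x_1=X(x_0)$, there is exactly one solution with interval of existence $(x_1,x_0)$; 3. if $X(x_0)<x_1<x_0$, there are exactly two solutions with interval of existence $(x_1,x_0)$. Moreover, a function $y$ is a solution with interval of existence $(x_1,x_0)$ if and only if it satisfies $y''=6y^2-x$ on $(x_1,x_0)$ and has infinite boundary values: $y(x)\to+\infty$ as $x\downarrow x_1$ and as $x\uparrow x_0$. Thus 1–3 count the solutions of the boundary value problem with infinite boundary data. -/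

import Mathlib

open Set Filter Topology

namespace PainleveOne

/-- On the open set `J`, the function `y` is twice differentiable and satisfies
the first Painlevé equation `y'' = 6 y ^ 2 - x`. Values of `y` off `J` do not matter. -/
def IsSolutionOn (y : ℝ → ℝ) (J : Set ℝ) : Prop :=
  ∀ x ∈ J, DifferentiableAt ℝ y x ∧ HasDerivAt (deriv y) (6 * y x ^ 2 - x) x

/-- `J` is the interval of existence of the real solution `y`: a nonempty open interval on
which `y` solves the equation, such that `y|J` has no extension to a solution on a
strictly larger open interval. -/
structure HasIntervalOfExistence (y : ℝ → ℝ) (J : Set ℝ) : Prop where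
  isOpen : IsOpen J
  isConnected : IsConnected J
  isSolutionOn : IsSolutionOn y J
  maximal : ∀ (z : ℝ → ℝ) (K : Set ℝ), IsOpen K → IsConnected K → J ⊆ K →
    IsSolutionOn z K → EqOn z y J → K = J

/-- The left end point of an interval, possibly `-∞`. -/
noncomputable def leftEnd (J : Set ℝ) : EReal :=
  sInf ((fun x : ℝ => (x : EReal)) '' J)

/-- `X(x₀)` is the infimum, over all initial data `y(x₀) = y₀`, `y'(x₀) = y₁`, of the left end
point `a(x₀, y₀, y₁)` of the interval of existence of the solution with these data.
A priori it is an extended real number. -/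
noncomputable def X (x₀ : ℝ) : EReal :=
  sInf {a : EReal | ∃ (y₀ y₁ : ℝ) (y : ℝ → ℝ) (J : Set ℝ),
    HasIntervalOfExistence y J ∧ x₀ ∈ J ∧ y x₀ = y₀ ∧ deriv y x₀ = y₁ ∧ a = leftEnd J}

/-- The set of solutions with interval of existence `(x₁, x₀)`, each regarded as a function
on that interval. -/
def solutionsWithInterval (x₁ x₀ : ℝ) : Set (Ioo x₁ x₀ → ℝ) :=
  (Ioo x₁ x₀).domRestrict '' {y : ℝ → ℝ | HasIntervalOfExistence y (Ioo x₁ x₀)}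

end PainleveOne

/-!
Under `t = -x` the equation on `x ≤ 0` becomes `U'' = 6 U ^ 2 + |t|`, whose forcing term is even.
A blow-up solution is convex, hence determined by the point `σ` and the value `m` of its minimum,
and its two blow-up times depend continuously on `(σ, m)`. Fix the left blow-up time `S = -x₀ ≥ 0`.
For every `m` exactly one `σ = τ m` gives this left time; let `T m` be the corresponding right
blow-up time. For three such solutions with nearby minimum values, the Wronskian of the two
successive differences is strictly monotone, and this excludes a weak local minimum of `T`. Since
`T m → S` as `|m| → ∞`, it follows that `T` increases strictly to a maximum and then decreases
strictly, which gives the counts `0`, `1`, `2`. That `-max T` is the infimum of *all* left end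
points follows by continuity: a solution regular on `[S, b]` with `b > max T` lies below the blow-up
solutions with large `m` and somewhere above those with very negative `m`, so it touches one of them
and coincides with it, although only one of the two is regular at `S`.
-/

namespace PainleveOne

open scoped NNReal

section ODE

variable {E : Type*} [NormedAddCommGroup E] [NormedSpace ℝ E] {v : ℝ → E → E} {K : ℝ≥0}
  {f h : ℝ → E} {a b : ℝ} {B : Set E}

lemma dist_le_mul_exp_of_hasDerivAt (hv : ∀ t ∈ Icc a b, LipschitzOnWith K (v t) B)
    (hf : ∀ t ∈ Icc a b, HasDerivAt f (v t (f t)) t) (hfB : MapsTo f (Icc a b) B)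
    (hh : ∀ t ∈ Icc a b, HasDerivAt h (v t (h t)) t) (hhB : MapsTo h (Icc a b) B)
    {t : ℝ} (ht : t ∈ Icc a b) :
    dist (f t) (h t) ≤ dist (f a) (h a) * Real.exp (K * (t - a)) :=
  dist_le_of_trajectories_ODE_of_mem (fun t ht => hv t (Ico_subset_Icc_self ht))
    (fun t ht => (hf t ht).continuousAt.continuousWithinAt)
    (fun t ht => (hf t (Ico_subset_Icc_self ht)).hasDerivWithinAt)
    (fun _ ht => hfB (Ico_subset_Icc_self ht))
    (fun t ht => (hh t ht).continuousAt.continuousWithinAt)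
    (fun t ht => (hh t (Ico_subset_Icc_self ht)).hasDerivWithinAt)
    (fun _ ht => hhB (Ico_subset_Icc_self ht)) le_rfl t ht

lemma hasDerivAt_comp_neg_of_hasDerivAt {t : ℝ} (hf : HasDerivAt f (v (-t) (f (-t))) (-t)) :
    HasDerivAt (fun t => f (-t)) (-v (-t) (f (-t))) t := by
  simpa [Function.comp_def] using hf.scomp t (hasDerivAt_neg t)

lemma dist_le_mul_exp_abs_of_hasDerivAt (hv : ∀ t ∈ Icc a b, LipschitzOnWith K (v t) B)
    (hf : ∀ t ∈ Icc a b, HasDerivAt f (v t (f t)) t) (hfB : MapsTo f (Icc a b) B)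
    (hh : ∀ t ∈ Icc a b, HasDerivAt h (v t (h t)) t) (hhB : MapsTo h (Icc a b) B)
    {τ t : ℝ} (hτ : τ ∈ Icc a b) (ht : t ∈ Icc a b) :
    dist (f t) (h t) ≤ dist (f τ) (h τ) * Real.exp (K * |t - τ|) := by
  rcases le_total τ t with hτt | htτ
  · have hsub : Icc τ b ⊆ Icc a b := Icc_subset_Icc_left hτ.1
    rw [abs_of_nonneg (sub_nonneg.2 hτt)]
    exact dist_le_mul_exp_of_hasDerivAt (fun t ht => hv t (hsub ht)) (fun t ht => hf t (hsub ht))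
      (hfB.mono_left hsub) (fun t ht => hh t (hsub ht)) (hhB.mono_left hsub) ⟨hτt, ht.2⟩
  · have hneg : ∀ t ∈ Icc (-τ) (-a), -t ∈ Icc a b := fun t ht =>
      ⟨le_neg_of_le_neg ht.2, (neg_le.1 ht.1).trans hτ.2⟩
    have key := dist_le_mul_exp_of_hasDerivAt (v := fun t p => -v (-t) p) (K := K) (B := B)
      (f := fun t => f (-t)) (h := fun t => h (-t)) (t := -t)
      (fun t ht => (hv (-t) (hneg t ht)).neg)
      (fun t ht => hasDerivAt_comp_neg_of_hasDerivAt (hf (-t) (hneg t ht)))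
      (fun t ht => hfB (hneg t ht))
      (fun t ht => hasDerivAt_comp_neg_of_hasDerivAt (hh (-t) (hneg t ht)))
      (fun t ht => hhB (hneg t ht)) ⟨neg_le_neg htτ, neg_le_neg ht.1⟩
    simp only [neg_neg] at key
    rwa [abs_of_nonpos (sub_nonpos.2 htτ), neg_sub, sub_eq_neg_add, add_comm, ← sub_eq_add_neg,
      show τ - t = -t - -τ by ring]

lemma exists_hasDerivAt_Ioo_of_lipschitzWith [CompleteSpace E] {L : ℝ≥0}
    (hv : ∀ t, LipschitzWith K (v t)) (hc : ∀ x, Continuous fun t => v t x)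
    (hL : ∀ t ∈ Icc a b, ∀ x, ‖v t x‖ ≤ L) {τ : ℝ} (hτ : τ ∈ Icc a b) (p : E) :
    ∃ γ : ℝ → E, γ τ = p ∧ ∀ t ∈ Ioo a b, HasDerivAt γ (v t (γ t)) t := by
  have hPL : IsPicardLindelof v (⟨τ, hτ⟩ : Icc a b) p (L * (b - a).toNNReal) 0 L K := by
    refine ⟨fun t _ => (hv t).lipschitzOnWith, fun x _ => (hc x).continuousOn,
      fun t ht x _ => hL t ht x, ?_⟩
    rw [NNReal.coe_mul, NNReal.coe_zero, sub_zero]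
    gcongr
    exact (max_le (by linarith [hτ.1]) (by linarith [hτ.2])).trans (Real.le_coe_toNNReal _)
  obtain ⟨γ, hγ, hγ'⟩ := hPL.exists_eq_forall_mem_Icc_hasDerivWithinAt₀
  exact ⟨γ, hγ, fun t ht => (hγ' t (Ioo_subset_Icc_self ht)).hasDerivAt (Icc_mem_nhds ht.1 ht.2)⟩

lemma exists_dist_lt_of_dist_initial_lt (hv : ∀ t, LipschitzWith K (v t))
    (hf : ∀ t ∈ Icc a b, HasDerivAt f (v t (f t)) t) {τ₀ ε : ℝ} (hτ₀ : τ₀ ∈ Icc a b)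
    (hε : 0 < ε) :
    ∃ δ > 0, ∀ τ ∈ Icc a b, dist τ τ₀ < δ → ∀ h : ℝ → E, dist (h τ) (f τ₀) < δ →
      (∀ t ∈ Icc a b, HasDerivAt h (v t (h t)) t) → ∀ t ∈ Icc a b, dist (h t) (f t) < ε := by
  set C := Real.exp (K * (b - a))
  have hC : 0 < C := Real.exp_pos _
  obtain ⟨δ, hδ, hfδ⟩ := Metric.continuousAt_iff.1 (hf τ₀ hτ₀).continuousAt (ε / C / 2)
    (by positivity)
  refine ⟨min δ (ε / C / 2), by positivity, fun τ hτ hττ₀ h hhτ hh t ht => ?_⟩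
  have hinit : dist (h τ) (f τ) < ε / C := calc
    dist (h τ) (f τ) ≤ dist (h τ) (f τ₀) + dist (f τ) (f τ₀) := dist_triangle_right _ _ _
    _ < ε / C / 2 + ε / C / 2 :=
      add_lt_add (hhτ.trans_le (min_le_right _ _)) (hfδ (hττ₀.trans_le (min_le_left _ _)))
    _ = ε / C := add_halves _
  have habs : |t - τ| ≤ b - a := abs_sub_le_of_le_of_le ht.1 ht.2 hτ.1 hτ.2
  calc dist (h t) (f t)
      ≤ dist (h τ) (f τ) * Real.exp (K * |t - τ|) :=
        dist_le_mul_exp_abs_of_hasDerivAt (fun t _ => (hv t).lipschitzOnWith) hh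
          (mapsTo_univ _ _) hf (mapsTo_univ _ _) hτ ht
    _ ≤ dist (h τ) (f τ) * C := mul_le_mul_of_nonneg_left
        (Real.exp_le_exp.2 (mul_le_mul_of_nonneg_left habs K.2)) dist_nonneg
    _ < ε / C * C := by gcongr
    _ = ε := div_mul_cancel₀ _ hC.ne'

lemma exists_Ioo_subset_of_Icc_subset {O : Set ℝ} (hO : IsOpen O) (hab : a ≤ b)
    (hsub : Icc a b ⊆ O) : ∃ η > 0, Ioo (a - η) (b + η) ⊆ O := by
  obtain ⟨l, hla, hl⟩ := exists_Ioc_subset_of_mem_nhds (hO.mem_nhds (hsub ⟨le_rfl, hab⟩))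
    (exists_lt a)
  obtain ⟨u, hbu, hu⟩ := exists_Ico_subset_of_mem_nhds (hO.mem_nhds (hsub ⟨hab, le_rfl⟩))
    (exists_gt b)
  refine ⟨min (a - l) (u - b), lt_min (sub_pos.2 hla) (sub_pos.2 hbu), fun t ht => ?_⟩
  have hlt : l < t := by linarith [ht.1, min_le_left (a - l) (u - b)]
  have htu : t < u := by linarith [ht.2, min_le_right (a - l) (u - b)]
  rcases le_total t a with hta | hat
  · exact hl ⟨hlt, hta⟩
  rcases le_total t b with htb | hbt
  · exact hsub ⟨hat, htb⟩
  · exact hu ⟨hbt, htu⟩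

end ODE

section System

variable {g U V U₁ V₁ U₂ V₂ : ℝ → ℝ} {s s' : Set ℝ} {a b τ : ℝ}

/-- The pair `(U, V)` solves `U' = V`, `V' = 6 U ^ 2 + g`, the phase-plane form of the first
Painlevé equation with forcing term `g`, at every point of `s`. The derivatives are two-sided even
at boundary points of `s`. -/
def SolvesSystem (g U V : ℝ → ℝ) (s : Set ℝ) : Prop :=
  ∀ t ∈ s, HasDerivAt U (V t) t ∧ HasDerivAt V (6 * U t ^ 2 + g t) t

lemma SolvesSystem.mono (h : SolvesSystem g U V s) (hs : s' ⊆ s) : SolvesSystem g U V s' :=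
  fun t ht => h t (hs ht)

lemma SolvesSystem.continuousOn_fst (h : SolvesSystem g U V s) : ContinuousOn U s :=
  fun t ht => (h t ht).1.continuousAt.continuousWithinAt

lemma SolvesSystem.continuousOn_snd (h : SolvesSystem g U V s) : ContinuousOn V s :=
  fun t ht => (h t ht).2.continuousAt.continuousWithinAt

/-- The time-dependent vector field on the phase plane whose integral curves are the solutions of
`SolvesSystem g`. -/
def phaseField (g : ℝ → ℝ) (t : ℝ) (p : ℝ × ℝ) : ℝ × ℝ := (p.2, 6 * p.1 ^ 2 + g t)

lemma solvesSystem_iff_hasDerivAt_phaseField :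
    SolvesSystem g U V s ↔
      ∀ t ∈ s, HasDerivAt (fun t => (U t, V t)) (phaseField g t (U t, V t)) t := by
  refine forall₂_congr fun t _ => ⟨fun h => h.1.prodMk h.2, fun h => ⟨?_, ?_⟩⟩
  · simpa using! hasFDerivAt_fst.comp_hasDerivAt t h
  · simpa using! hasFDerivAt_snd.comp_hasDerivAt t h

lemma continuous_phaseField (hg : Continuous g) (p : ℝ × ℝ) :
    Continuous fun t => phaseField g t p := by
  unfold phaseField
  fun_prop

lemma mem_closedBall_zero_prod {N : ℝ} {p : ℝ × ℝ} :
    p ∈ Metric.closedBall 0 N ↔ |p.1| ≤ N ∧ |p.2| ≤ N := by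
  simp [Prod.norm_def]

lemma lipschitzOnWith_phaseField (g : ℝ → ℝ) (N : ℝ≥0) (t : ℝ) :
    LipschitzOnWith (12 * N + 1) (phaseField g t) (Metric.closedBall 0 N) := by
  refine LipschitzOnWith.of_dist_le_mul fun p hp q hq => ?_
  have h₁ : |p.1 - q.1| ≤ dist p q := le_max_left _ _
  have h₂ : |p.2 - q.2| ≤ dist p q := le_max_right _ _
  have hsum : |p.1 + q.1| ≤ 2 * N := (abs_add_le _ _).trans <| by
    linarith [(mem_closedBall_zero_prod.1 hp).1, (mem_closedBall_zero_prod.1 hq).1]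
  have hsq : |6 * p.1 ^ 2 + g t - (6 * q.1 ^ 2 + g t)| ≤ 12 * N * dist p q := calc
    |6 * p.1 ^ 2 + g t - (6 * q.1 ^ 2 + g t)| = 6 * (|p.1 + q.1| * |p.1 - q.1|) := by
      rw [← abs_mul, ← abs_of_pos (show (0 : ℝ) < 6 by norm_num), ← abs_mul,
        abs_of_pos (show (0 : ℝ) < 6 by norm_num)]
      ring_nf
    _ ≤ 6 * (2 * N * dist p q) := by gcongr
    _ = 12 * N * dist p q := by ring
  have hN : 0 ≤ 12 * (N : ℝ) * dist p q := by positivity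
  push_cast
  refine max_le ?_ ?_ <;> simp only [phaseField, Real.dist_eq] <;>
    linarith [dist_nonneg (x := p) (y := q)]

lemma norm_phaseField_le {N G t : ℝ} (hG : |g t| ≤ G) {p : ℝ × ℝ}
    (hp : p ∈ Metric.closedBall 0 N) : ‖phaseField g t p‖ ≤ N + 6 * N ^ 2 + G := by
  obtain ⟨hp₁, hp₂⟩ := mem_closedBall_zero_prod.1 hp
  have hG₀ : 0 ≤ G := (abs_nonneg _).trans hG
  have hN : 0 ≤ N := (abs_nonneg _).trans hp₁
  have hsq : |p.1| ^ 2 ≤ N ^ 2 := by gcongr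
  refine max_le ?_ ((abs_add_le _ _).trans ?_)
  · simp only [phaseField, Real.norm_eq_abs]
    nlinarith
  · rw [abs_mul, abs_pow, abs_of_pos (show (0 : ℝ) < 6 by norm_num)]
    linarith

lemma SolvesSystem.exists_mapsTo_closedBall (h : SolvesSystem g U V (Icc a b)) :
    ∃ N : ℝ≥0, MapsTo (fun t => (U t, V t)) (Icc a b) (Metric.closedBall 0 N) := by
  obtain ⟨N, hN⟩ := isCompact_Icc.exists_bound_of_continuousOn
    (h.continuousOn_fst.prodMk h.continuousOn_snd)
  exact ⟨N.toNNReal, fun t ht => mem_closedBall_zero_iff.2 <|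
    (hN t ht).trans (Real.le_coe_toNNReal _)⟩

theorem SolvesSystem.eqOn [hs : s.OrdConnected] (h₁ : SolvesSystem g U₁ V₁ s)
    (h₂ : SolvesSystem g U₂ V₂ s) (hτ : τ ∈ s) (hU : U₁ τ = U₂ τ) (hV : V₁ τ = V₂ τ) {t : ℝ}
    (ht : t ∈ s) : U₁ t = U₂ t ∧ V₁ t = V₂ t := by
  have hsub : uIcc τ t ⊆ s := hs.uIcc_subset hτ ht
  replace h₁ := h₁.mono hsub
  replace h₂ := h₂.mono hsub
  obtain ⟨N₁, hN₁⟩ := h₁.exists_mapsTo_closedBall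
  obtain ⟨N₂, hN₂⟩ := h₂.exists_mapsTo_closedBall
  have key := dist_le_mul_exp_abs_of_hasDerivAt
    (fun t _ => lipschitzOnWith_phaseField g (max N₁ N₂) t)
    (solvesSystem_iff_hasDerivAt_phaseField.1 h₁)
    (hN₁.mono_right (Metric.closedBall_subset_closedBall (NNReal.coe_le_coe.2 (le_max_left _ _))))
    (solvesSystem_iff_hasDerivAt_phaseField.1 h₂)
    (hN₂.mono_right (Metric.closedBall_subset_closedBall (NNReal.coe_le_coe.2 (le_max_right _ _))))
    left_mem_uIcc right_mem_uIcc
  rw [hU, hV, dist_self, zero_mul, dist_le_zero] at key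
  exact Prod.mk_inj.1 key

/-- The Lipschitz retraction of the phase plane (with the sup norm) onto the closed ball of radius
`N`; composing `phaseField` with it gives a bounded, globally Lipschitz field. -/
noncomputable def truncate (N : ℝ≥0) (p : ℝ × ℝ) : ℝ × ℝ :=
  (projIcc (-N : ℝ) N (neg_le_self N.2) p.1, projIcc (-N : ℝ) N (neg_le_self N.2) p.2)

lemma lipschitzWith_truncate (N : ℝ≥0) : LipschitzWith 1 (truncate N) := by
  have h := LipschitzWith.subtype_val (Icc (-N : ℝ) N) |>.comp
    (LipschitzWith.projIcc (neg_le_self N.2))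
  simpa using! (h.comp LipschitzWith.prod_fst).prodMk (h.comp LipschitzWith.prod_snd)

lemma truncate_mem_closedBall (N : ℝ≥0) (p : ℝ × ℝ) : truncate N p ∈ Metric.closedBall 0 N :=
  mem_closedBall_zero_prod.2 ⟨abs_le.2 (projIcc (-N : ℝ) N (neg_le_self N.2) p.1).2,
    abs_le.2 (projIcc (-N : ℝ) N (neg_le_self N.2) p.2).2⟩

lemma truncate_of_mem_closedBall {N : ℝ≥0} {p : ℝ × ℝ} (hp : p ∈ Metric.closedBall 0 N) :
    truncate N p = p := by
  obtain ⟨hp₁, hp₂⟩ := mem_closedBall_zero_prod.1 hp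
  simp [truncate, projIcc_of_mem _ (abs_le.1 hp₁), projIcc_of_mem _ (abs_le.1 hp₂)]

lemma lipschitzWith_phaseField_truncate (g : ℝ → ℝ) (N : ℝ≥0) (t : ℝ) :
    LipschitzWith (12 * N + 1) fun p => phaseField g t (truncate N p) := by
  simpa [lipschitzOnWith_univ, Function.comp_def] using
    (lipschitzOnWith_phaseField g N t).comp ((lipschitzWith_truncate N).lipschitzOnWith (s := univ))
      fun p _ => truncate_mem_closedBall N p

lemma exists_hasDerivAt_truncated (hg : Continuous g) (N : ℝ≥0) (hτ : τ ∈ Icc a b)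
    (p : ℝ × ℝ) : ∃ γ : ℝ → ℝ × ℝ, γ τ = p ∧
      ∀ t ∈ Ioo a b, HasDerivAt γ (phaseField g t (truncate N (γ t))) t := by
  obtain ⟨G, hG⟩ := isCompact_Icc.exists_bound_of_continuousOn (s := Icc a b) hg.continuousOn
  exact exists_hasDerivAt_Ioo_of_lipschitzWith (L := (N + 6 * (N : ℝ) ^ 2 + G).toNNReal)
    (lipschitzWith_phaseField_truncate g N) (fun p => continuous_phaseField hg (truncate N p))
    (fun t ht p => (norm_phaseField_le (hG t ht) (truncate_mem_closedBall N p)).trans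
      (Real.le_coe_toNNReal _)) hτ p

theorem SolvesSystem.exists_nearby (hg : Continuous g) {τ₀ ε : ℝ}
    (h : SolvesSystem g U V (Icc a b)) (hτ₀ : τ₀ ∈ Icc a b) (hε : 0 < ε) :
    ∃ δ > 0, ∀ τ ∈ Icc a b, dist τ τ₀ < δ → ∀ p, dist p (U τ₀, V τ₀) < δ →
      ∃ U' V' : ℝ → ℝ, ∃ η > 0, SolvesSystem g U' V' (Ioo (a - η) (b + η)) ∧
        (U' τ, V' τ) = p ∧ ∀ t ∈ Icc a b, dist (U' t, V' t) (U t, V t) < ε := by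
  have hab : a ≤ b := hτ₀.1.trans hτ₀.2
  obtain ⟨N, hN⟩ := h.exists_mapsTo_closedBall
  have htrunc : ∀ t ∈ Icc a b, HasDerivAt (fun t => (U t, V t))
      (phaseField g t (truncate (N + 1) (U t, V t))) t := fun t ht => by
    rw [truncate_of_mem_closedBall (Metric.closedBall_subset_closedBall (by simp) (hN ht))]
    exact solvesSystem_iff_hasDerivAt_phaseField.1 h t ht
  obtain ⟨δ, hδ, hclose⟩ := exists_dist_lt_of_dist_initial_lt
    (lipschitzWith_phaseField_truncate g (N + 1)) htrunc hτ₀ (lt_min hε one_pos)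
  refine ⟨δ, hδ, fun τ hτ hττ₀ p hp => ?_⟩
  have hsub : Icc a b ⊆ Ioo (a - 1) (b + 1) := Icc_subset_Ioo (sub_one_lt a) (lt_add_one b)
  obtain ⟨γ, rfl, hγ⟩ := exists_hasDerivAt_truncated hg (N + 1)
    (Ioo_subset_Icc_self (hsub hτ)) p
  have hγε := hclose τ hτ hττ₀ γ hp fun t ht => hγ t (hsub ht)
  have hball : Icc a b ⊆ Ioo (a - 1) (b + 1) ∩ γ ⁻¹' Metric.ball 0 (N + 1) := fun t ht => by
    have hUV : dist (U t, V t) 0 ≤ N := hN ht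
    have hγ₁ : dist (γ t) (U t, V t) < 1 := (hγε t ht).trans_le (min_le_right _ _)
    have hγN : dist (γ t) 0 < N + 1 := by linarith [dist_triangle (γ t) (U t, V t) 0]
    exact ⟨hsub ht, hγN⟩
  have hopen : IsOpen (Ioo (a - 1) (b + 1) ∩ γ ⁻¹' Metric.ball 0 (N + 1)) :=
    ContinuousOn.isOpen_inter_preimage (fun t ht => (hγ t ht).continuousAt.continuousWithinAt)
      isOpen_Ioo Metric.isOpen_ball
  obtain ⟨η, hη, hηsub⟩ := exists_Ioo_subset_of_Icc_subset hopen hab hball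
  refine ⟨fun t => (γ t).1, fun t => (γ t).2, η, hη,
    solvesSystem_iff_hasDerivAt_phaseField.2 fun t ht => ?_, rfl,
    fun t ht => (hγε t ht).trans_le (min_le_left _ _)⟩
  obtain ⟨ht, hγt⟩ := hηsub ht
  simpa [truncate_of_mem_closedBall (N := N + 1)
    (by simpa using! Metric.ball_subset_closedBall hγt)] using hγ t ht

theorem exists_solvesSystem_of_bounded_initial (hg : Continuous g) (M R : ℝ) :
    ∃ δ > 0, ∀ τ p, |τ| ≤ R → p ∈ Metric.closedBall (0 : ℝ × ℝ) M →
      ∃ U V, SolvesSystem g U V (Ioo (τ - δ) (τ + δ)) ∧ (U τ, V τ) = p := by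
  obtain ⟨G, hG⟩ := isCompact_Icc.exists_bound_of_continuousOn (s := Icc (-R - 1) (R + 1))
    hg.continuousOn
  set N : ℝ≥0 := M.toNNReal + 1
  set L : ℝ≥0 := 1 + (N + 6 * (N : ℝ) ^ 2 + G).toNNReal
  have hδ : 0 < 1 / (L : ℝ) := by positivity
  have hδ₁ : 1 / (L : ℝ) ≤ 1 := by
    rw [div_le_one (by positivity)]
    exact_mod_cast le_self_add
  refine ⟨1 / L, hδ, fun τ p hτ hp => ?_⟩
  have hball : Metric.closedBall p ((1 : ℝ≥0) : ℝ) ⊆ Metric.closedBall 0 N := by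
    refine Metric.closedBall_subset_closedBall' ?_
    simp only [NNReal.coe_one, N, NNReal.coe_add]
    linarith [Metric.mem_closedBall.1 hp, Real.le_coe_toNNReal M]
  have hPL : IsPicardLindelof (phaseField g)
      (⟨τ, by linarith, by linarith⟩ : Icc (τ - 1 / (L : ℝ)) (τ + 1 / L)) p 1 0 L
      (12 * N + 1) := by
    refine ⟨fun t _ => (lipschitzOnWith_phaseField g N t).mono hball,
      fun p _ => (continuous_phaseField hg p).continuousOn, fun t ht q hq => ?_, ?_⟩
    · have htR : t ∈ Icc (-R - 1) (R + 1) :=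
        ⟨by linarith [(abs_le.1 hτ).1, ht.1], by linarith [(abs_le.1 hτ).2, ht.2]⟩
      refine (norm_phaseField_le (hG t htR) (hball hq)).trans ?_
      exact (Real.le_coe_toNNReal _).trans (NNReal.coe_le_coe.2 le_add_self)
    · simp [mul_inv_cancel₀ (show (L : ℝ) ≠ 0 by positivity)]
  obtain ⟨γ, rfl, hγ⟩ := hPL.exists_eq_forall_mem_Icc_hasDerivWithinAt₀
  exact ⟨fun t => (γ t).1, fun t => (γ t).2, solvesSystem_iff_hasDerivAt_phaseField.2 fun t ht =>
    (hγ t (Ioo_subset_Icc_self ht)).hasDerivAt (Icc_mem_nhds ht.1 ht.2), rfl⟩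

end System

section Monotonicity

variable {f f' : ℝ → ℝ} {s : Set ℝ} {a b : ℝ}

lemma monotoneOn_of_hasDerivAt_nonneg [hs : s.OrdConnected] (hf : ∀ t ∈ s, HasDerivAt f (f' t) t)
    (hf' : ∀ t ∈ s, 0 ≤ f' t) : MonotoneOn f s :=
  monotoneOn_of_hasDerivWithinAt_nonneg hs.convex
    (fun t ht => (hf t ht).continuousAt.continuousWithinAt)
    (fun t ht => (hf t (interior_subset ht)).hasDerivWithinAt)
    fun t ht => hf' t (interior_subset ht)

lemma strictMonoOn_of_hasDerivAt_pos [hs : s.OrdConnected] (hf : ∀ t ∈ s, HasDerivAt f (f' t) t)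
    (hf' : ∀ t ∈ interior s, 0 < f' t) : StrictMonoOn f s :=
  strictMonoOn_of_hasDerivWithinAt_pos hs.convex
    (fun t ht => (hf t ht).continuousAt.continuousWithinAt)
    (fun t ht => (hf t (interior_subset ht)).hasDerivWithinAt) hf'

lemma le_of_hasDerivAt_nonneg (hab : a ≤ b) (hf : ∀ t ∈ Icc a b, HasDerivAt f (f' t) t)
    (hf' : ∀ t ∈ Icc a b, 0 ≤ f' t) : f a ≤ f b :=
  monotoneOn_of_hasDerivAt_nonneg hf hf' ⟨le_rfl, hab⟩ ⟨hab, le_rfl⟩ hab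

lemma lt_of_hasDerivAt_pos (hab : a < b) (hf : ∀ t ∈ Icc a b, HasDerivAt f (f' t) t)
    (hf' : ∀ t ∈ Ioo a b, 0 < f' t) : f a < f b :=
  strictMonoOn_of_hasDerivAt_pos hf (by simpa using hf') ⟨le_rfl, hab.le⟩ ⟨hab.le, le_rfl⟩ hab

lemma abs_sub_le_mul_of_hasDerivAt {C c T t : ℝ}
    (hf : ∀ x ∈ Ico c T, HasDerivAt f (f' x) x) (hC : ∀ x ∈ Ico c T, |f' x| ≤ C)
    (ht : t ∈ Ico c T) : |f t - f c| ≤ C * (T - c) := by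
  have hc : c ∈ Ico c T := ⟨le_rfl, ht.1.trans_lt ht.2⟩
  have hC₀ : 0 ≤ C := (abs_nonneg _).trans (hC c hc)
  calc |f t - f c| ≤ C * ‖t - c‖ :=
        (convex_Ico c T).norm_image_sub_le_of_norm_hasDerivWithin_le
          (fun x hx => (hf x hx).hasDerivWithinAt) hC hc ht
    _ = C * (t - c) := by rw [Real.norm_of_nonneg (sub_nonneg.2 ht.1)]
    _ ≤ C * (T - c) := by gcongr; exact ht.2.le

theorem tendsto_atTop_or_exists_abs_le_of_convexOn {S T c : ℝ} (hf : ConvexOn ℝ (Ioo S T) f)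
    (hc : c ∈ Ioo S T) :
    Tendsto f (𝓝[<] T) atTop ∨ ∃ B, ∀ t ∈ Ico c T, |f t| ≤ B := by
  have hsub : Ico c T ⊆ Ioo S T := fun t ht => ⟨hc.1.trans_le ht.1, ht.2⟩
  by_cases hM : ∃ M, ∀ t ∈ Ico c T, f t ≤ M
  · obtain ⟨M, hM⟩ := hM
    obtain ⟨d, hd⟩ := exists_between hc.1
    set k := (f c - f d) / (c - d)
    refine Or.inr ⟨max |f c - (|k| * (T - c))| |M|, fun t ht => abs_le_max_abs_abs ?_ (hM t ht)⟩
    rcases ht.1.eq_or_lt with rfl | hct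
    · linarith [mul_nonneg (abs_nonneg k) (sub_nonneg.2 hc.2.le)]
    have hslope : k ≤ (f t - f c) / (t - c) :=
      hf.slope_mono_adjacent ⟨hd.1, hd.2.trans hc.2⟩ (hsub ht) hd.2 hct
    rw [le_div_iff₀ (sub_pos.2 hct)] at hslope
    have hk : -|k| * (t - c) ≤ k * (t - c) :=
      mul_le_mul_of_nonneg_right (neg_abs_le k) (sub_nonneg.2 hct.le)
    have hT : |k| * (t - c) ≤ |k| * (T - c) := by gcongr; exact ht.2.le
    linarith
  · push Not at hM
    refine Or.inl (tendsto_atTop.2 fun M => ?_)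
    obtain ⟨t, ht, hMt⟩ := hM (max M (f c))
    filter_upwards [Ioo_mem_nhdsLT ht.2] with x hx
    have hmax : f t ≤ max (f c) (f x) := hf.le_max_of_mem_Icc hc
      (hsub ⟨ht.1.trans hx.1.le, hx.2⟩) ⟨ht.1, hx.1.le⟩
    rcases le_max_iff.1 hmax with h | h
    · exact absurd h ((le_max_right _ _).trans_lt hMt).not_ge
    · exact ((le_max_left _ _).trans hMt.le).trans h

end Monotonicity

section Maximal

variable {g U V U₁ V₁ U₂ V₂ : ℝ → ℝ} {s : Set ℝ} {S T c τ : ℝ} {p : ℝ × ℝ}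

lemma SolvesSystem.reflect (h : SolvesSystem g U V s) :
    SolvesSystem (fun t => g (-t)) (fun t => U (-t)) (fun t => -V (-t)) (Neg.neg ⁻¹' s) := by
  intro t ht
  obtain ⟨hU, hV⟩ := h (-t) ht
  exact ⟨by simpa [Function.comp_def] using hU.scomp t (hasDerivAt_neg t),
    by simpa [Function.comp_def] using! (hV.scomp t (hasDerivAt_neg t)).neg⟩

lemma SolvesSystem.reflect_Ioo (h : SolvesSystem g U V (Ioo S T)) :
    SolvesSystem (fun t => g (-t)) (fun t => U (-t)) (fun t => -V (-t)) (Ioo (-T) (-S)) :=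
  h.reflect.mono fun _ ht => ⟨lt_neg.1 ht.2, neg_lt.1 ht.1⟩

lemma SolvesSystem.congr (hs : IsOpen s) (h : SolvesSystem g U₁ V₁ s) (hU : EqOn U₂ U₁ s)
    (hV : EqOn V₂ V₁ s) : SolvesSystem g U₂ V₂ s := by
  intro t ht
  rw [hU ht, hV ht]
  exact ⟨(h t ht).1.congr_of_eventuallyEq (hU.eventuallyEq_of_mem (hs.mem_nhds ht)),
    (h t ht).2.congr_of_eventuallyEq (hV.eventuallyEq_of_mem (hs.mem_nhds ht))⟩

lemma exists_solvesSystem_iUnion {ι : Type*} {J : ι → Set ℝ} {U V : ι → ℝ → ℝ}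
    (hJo : ∀ i, IsOpen (J i)) (hJ : ∀ i, (J i).OrdConnected) (hτ : ∀ i, τ ∈ J i)
    (h : ∀ i, SolvesSystem g (U i) (V i) (J i)) (hp : ∀ i, (U i τ, V i τ) = p) :
    ∃ U' V', SolvesSystem g U' V' (⋃ i, J i) ∧
      ∀ i, EqOn U' (U i) (J i) ∧ EqOn V' (V i) (J i) := by
  have hagree : ∀ t, ∃ q : ℝ × ℝ, ∀ i, t ∈ J i → q = (U i t, V i t) := fun t => by
    by_cases ht : ∃ i, t ∈ J i
    · obtain ⟨i, hi⟩ := ht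
      refine ⟨(U i t, V i t), fun j hj => Prod.mk_inj.2 ?_⟩
      have hij : (U i τ, V i τ) = (U j τ, V j τ) := (hp i).trans (hp j).symm
      have := (hJ i).inter (hJ j)
      exact SolvesSystem.eqOn (s := J i ∩ J j) ((h i).mono inter_subset_left)
        ((h j).mono inter_subset_right) ⟨hτ i, hτ j⟩ (Prod.mk_inj.1 hij).1 (Prod.mk_inj.1 hij).2
        ⟨hi, hj⟩
    · exact ⟨0, fun i hi => absurd ⟨i, hi⟩ ht⟩
  choose q hq using hagree
  have heq : ∀ i, EqOn (fun t => (q t).1) (U i) (J i) ∧ EqOn (fun t => (q t).2) (V i) (J i) :=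
    fun i => ⟨fun t ht => congrArg Prod.fst (hq t i ht), fun t ht => congrArg Prod.snd (hq t i ht)⟩
  refine ⟨fun t => (q t).1, fun t => (q t).2, fun t ht => ?_, heq⟩
  obtain ⟨i, hi⟩ := mem_iUnion.1 ht
  exact (h i).congr (hJo i) (heq i).1 (heq i).2 t hi

/-- The open intervals around `τ` that carry a solution of the system passing through `p` at time
`τ`. Their union is the interval of existence of that solution. -/
def solutionIntervals (g : ℝ → ℝ) (τ : ℝ) (p : ℝ × ℝ) : Set (Set ℝ) :=
  {J | IsOpen J ∧ J.OrdConnected ∧ τ ∈ J ∧ ∃ U V, SolvesSystem g U V J ∧ (U τ, V τ) = p}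

lemma SolvesSystem.Ioo_mem_solutionIntervals (h : SolvesSystem g U V (Ioo S T))
    (hτ : τ ∈ Ioo S T) : Ioo S T ∈ solutionIntervals g τ (U τ, V τ) :=
  ⟨isOpen_Ioo, ordConnected_Ioo, hτ, U, V, h, rfl⟩

lemma solutionIntervals_nonempty (hg : Continuous g) (τ : ℝ) (p : ℝ × ℝ) :
    (solutionIntervals g τ p).Nonempty := by
  obtain ⟨δ, hδ, hloc⟩ := exists_solvesSystem_of_bounded_initial hg ‖p‖ |τ|
  obtain ⟨U, V, h, rfl⟩ := hloc τ p le_rfl (by simp)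
  exact ⟨_, h.Ioo_mem_solutionIntervals ⟨sub_lt_self τ hδ, lt_add_of_pos_right τ hδ⟩⟩

theorem sUnion_mem_solutionIntervals (hg : Continuous g) (τ : ℝ) (p : ℝ × ℝ) :
    ⋃₀ solutionIntervals g τ p ∈ solutionIntervals g τ p := by
  obtain ⟨J₀, hJ₀⟩ := solutionIntervals_nonempty hg τ p
  choose U V hUV using fun J : solutionIntervals g τ p => J.2.2.2.2
  obtain ⟨U', V', h, heq⟩ := exists_solvesSystem_iUnion (fun J => J.2.1) (fun J => J.2.2.1)
    (fun J => J.2.2.2.1) (fun J => (hUV J).1) (fun J => (hUV J).2)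
  refine ⟨isOpen_sUnion fun J hJ => hJ.1, IsPreconnected.ordConnected ?_, ⟨J₀, hJ₀, hJ₀.2.2.1⟩,
    U', V', by rwa [sUnion_eq_iUnion], ?_⟩
  · exact isPreconnected_sUnion τ _ (fun J hJ => hJ.2.2.1) fun J hJ =>
      OrdConnected.isPreconnected hJ.2.1
  · rw [(heq ⟨J₀, hJ₀⟩).1 hJ₀.2.2.1, (heq ⟨J₀, hJ₀⟩).2 hJ₀.2.2.1, (hUV ⟨J₀, hJ₀⟩).2]

lemma SolvesSystem.exists_Ioo_mem_solutionIntervals_of_bounded (hg : Continuous g) {B : ℝ}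
    (h : SolvesSystem g U V (Ioo S T)) (hc : c ∈ Ioo S T)
    (hB : ∀ t ∈ Ico c T, |U t| ≤ B ∧ |V t| ≤ B) :
    ∃ η > 0, Ioo S (T + η) ∈ solutionIntervals g c (U c, V c) := by
  obtain ⟨δ, hδ, hloc⟩ := exists_solvesSystem_of_bounded_initial hg B (max |c| |T|)
  set r := max c (T - δ / 2)
  have hr : r ∈ Ico c T := ⟨le_max_left _ _, max_lt hc.2 (by linarith)⟩
  have hrS : r ∈ Ioo S T := ⟨hc.1.trans_le hr.1, hr.2⟩
  obtain ⟨U₁, V₁, h₁, hr₁⟩ := hloc r (U r, V r) (abs_le_max_abs_abs hr.1 hr.2.le)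
    (mem_closedBall_zero_prod.2 (hB r hr))
  obtain ⟨-, -, -, U', V', h', hr'⟩ := sUnion_mem_solutionIntervals hg r (U r, V r)
  have hsub : Ioo S T ⊆ ⋃₀ solutionIntervals g r (U r, V r) :=
    subset_sUnion_of_mem (h.Ioo_mem_solutionIntervals hrS)
  have hsub₁ : Ioo (r - δ) (r + δ) ⊆ ⋃₀ solutionIntervals g r (U r, V r) := by
    rw [← hr₁]
    exact subset_sUnion_of_mem
      (h₁.Ioo_mem_solutionIntervals ⟨sub_lt_self r hδ, lt_add_of_pos_right r hδ⟩)
  have hcU : U' c = U c ∧ V' c = V c := (h'.mono hsub).eqOn h hrS (Prod.mk_inj.1 hr').1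
    (Prod.mk_inj.1 hr').2 hc
  refine ⟨δ / 2, half_pos hδ, isOpen_Ioo, ordConnected_Ioo, ⟨hc.1, by linarith [hc.2]⟩, U', V',
    h'.mono fun t ht => ?_, by rw [hcU.1, hcU.2]⟩
  rcases le_or_gt T t with hTt | htT
  · exact hsub₁ ⟨by linarith [hr.2], by linarith [ht.2, le_max_right c (T - δ / 2)]⟩
  · exact hsub ⟨ht.1, htT⟩

lemma SolvesSystem.monotoneOn_snd [s.OrdConnected] (h : SolvesSystem g U V s)
    (hg : ∀ t ∈ s, 0 ≤ g t) : MonotoneOn V s :=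
  monotoneOn_of_hasDerivAt_nonneg (fun t ht => (h t ht).2)
    fun t ht => add_nonneg (by positivity) (hg t ht)

lemma SolvesSystem.convexOn_fst (h : SolvesSystem g U V (Ioo S T))
    (hg : ∀ t ∈ Ioo S T, 0 ≤ g t) : ConvexOn ℝ (Ioo S T) U := by
  refine MonotoneOn.convexOn_of_deriv (convex_Ioo S T) h.continuousOn_fst ?_ ?_ <;>
    rw [interior_Ioo]
  · exact fun t ht => (h t ht).1.differentiableAt.differentiableWithinAt
  · exact (h.monotoneOn_snd hg).congr fun t ht => (h t ht).1.deriv.symm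

lemma SolvesSystem.exists_abs_snd_le (hg : Continuous g) {B : ℝ}
    (h : SolvesSystem g U V (Ico c T)) (hB : ∀ t ∈ Ico c T, |U t| ≤ B) :
    ∃ B', ∀ t ∈ Ico c T, |V t| ≤ B' := by
  obtain ⟨G, hG⟩ := isCompact_Icc.exists_bound_of_continuousOn (s := Icc c T) hg.continuousOn
  refine ⟨(6 * B ^ 2 + G) * (T - c) + |V c|, fun t ht => ?_⟩
  have hV : |V t - V c| ≤ (6 * B ^ 2 + G) * (T - c) :=
    abs_sub_le_mul_of_hasDerivAt (fun x hx => (h x hx).2) (fun x hx => (abs_add_le _ _).trans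
      (add_le_add (by rw [abs_of_nonneg (by positivity), ← sq_abs]; gcongr; exact hB x hx)
        (hG x (Ico_subset_Icc_self hx)))) ht
  linarith [abs_sub_abs_le_abs_sub (V t) (V c)]

theorem SolvesSystem.tendsto_atTop_or_exists_extension (hg : Continuous g)
    (h : SolvesSystem g U V (Ioo S T)) (hg₀ : ∀ t ∈ Ioo S T, 0 ≤ g t) (hc : c ∈ Ioo S T) :
    Tendsto U (𝓝[<] T) atTop ∨ ∃ η > 0, Ioo S (T + η) ∈ solutionIntervals g c (U c, V c) := by
  refine (tendsto_atTop_or_exists_abs_le_of_convexOn (h.convexOn_fst hg₀) hc).imp_right ?_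
  rintro ⟨B, hB⟩
  obtain ⟨B', hB'⟩ := (h.mono fun t ht => ⟨hc.1.trans_le ht.1, ht.2⟩).exists_abs_snd_le hg hB
  exact h.exists_Ioo_mem_solutionIntervals_of_bounded hg hc fun t ht =>
    ⟨(hB t ht).trans (le_max_left B B'), (hB' t ht).trans (le_max_right B B')⟩

end Maximal

section Growth

variable {g U V : ℝ → ℝ} {a b c κ : ℝ}

lemma SolvesSystem.add_mul_le_snd (hab : a ≤ b) (h : SolvesSystem g U V (Icc a b))
    (hc : ∀ t ∈ Icc a b, c ≤ 6 * U t ^ 2 + g t) : V a + c * (b - a) ≤ V b := by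
  have hmono := le_of_hasDerivAt_nonneg (f := fun x => V x - c * x) hab
    (fun x hx => (h x hx).2.sub ((hasDerivAt_id x).const_mul c))
    (fun x hx => by linarith [hc x hx])
  linarith

lemma SolvesSystem.add_mul_add_sq_le_fst (hab : a ≤ b) (h : SolvesSystem g U V (Icc a b))
    (hc : ∀ t ∈ Icc a b, c ≤ 6 * U t ^ 2 + g t) :
    U a + V a * (b - a) + c / 2 * (b - a) ^ 2 ≤ U b := by
  have hderiv : ∀ x ∈ Icc a b, HasDerivAt (fun x => U x - V a * (x - a) - c / 2 * (x - a) ^ 2)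
      (V x - V a - c * (x - a)) x := fun x hx => by
    have hlin : HasDerivAt (fun x => x - a) 1 x := (hasDerivAt_id x).sub_const a
    refine (((h x hx).1.sub (hlin.const_mul (V a))).sub
      ((hlin.pow 2).const_mul (c / 2))).congr_deriv ?_
    norm_num
    ring
  have hmono := le_of_hasDerivAt_nonneg hab hderiv fun x hx => by
    linarith [(h.mono (Icc_subset_Icc_right hx.2)).add_mul_le_snd hx.1
      fun t ht => hc t ⟨ht.1, ht.2.trans hx.2⟩]
  simp only [sub_self, mul_zero, ne_eq, OfNat.ofNat_ne_zero, not_false_eq_true, zero_pow,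
    sub_zero] at hmono
  linarith

lemma SolvesSystem.snd_nonneg (h : SolvesSystem g U V (Icc a b)) (hg : ∀ t ∈ Icc a b, 0 ≤ g t)
    (hV : 0 ≤ V a) {t : ℝ} (ht : t ∈ Icc a b) : 0 ≤ V t :=
  hV.trans (h.monotoneOn_snd hg ⟨le_rfl, ht.1.trans ht.2⟩ ht ht.1)

lemma SolvesSystem.monotoneOn_fst (h : SolvesSystem g U V (Icc a b))
    (hg : ∀ t ∈ Icc a b, 0 ≤ g t) (hV : 0 ≤ V a) : MonotoneOn U (Icc a b) :=
  monotoneOn_of_hasDerivAt_nonneg (fun t ht => (h t ht).1) fun _ ht => h.snd_nonneg hg hV ht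

lemma SolvesSystem.energy_le (hab : a ≤ b) (h : SolvesSystem g U V (Icc a b))
    (hg : ∀ t ∈ Icc a b, 0 ≤ g t) (hV : 0 ≤ V a) :
    V a ^ 2 - 4 * U a ^ 3 ≤ V b ^ 2 - 4 * U b ^ 3 := by
  refine le_of_hasDerivAt_nonneg (f := fun x => V x ^ 2 - 4 * U x ^ 3)
    (f' := fun x => 2 * V x * g x) hab (fun x hx => ?_)
    fun x hx => mul_nonneg (mul_nonneg zero_le_two (h.snd_nonneg hg hV hx)) (hg x hx)
  refine (((h x hx).2.pow 2).sub (((h x hx).1.pow 3).const_mul 4)).congr_deriv ?_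
  norm_num
  ring

lemma sub_lt_two_div_sqrt_of_mul_sqrt_le_deriv {f f' : ℝ → ℝ} (hab : a ≤ b)
    (hf : ∀ t ∈ Icc a b, HasDerivAt f (f' t) t) (hpos : ∀ t ∈ Icc a b, 0 < f t)
    (hf' : ∀ t ∈ Icc a b, f t * √(f t) ≤ f' t) : b - a < 2 / √(f a) := by
  have hderiv : ∀ x ∈ Icc a b, HasDerivAt (fun x => -(√(f x))⁻¹ - x / 2)
      (f' x / (2 * (f x * √(f x))) - 1 / 2) x := fun x hx => by
    refine ((((hf x hx).sqrt (hpos x hx).ne').inv (Real.sqrt_pos.2 (hpos x hx)).ne').neg.sub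
      ((hasDerivAt_id x).div_const 2)).congr_deriv ?_
    rw [Real.sq_sqrt (hpos x hx).le, neg_div, neg_neg, div_div, mul_assoc, mul_comm (√(f x))]
  have hmono := le_of_hasDerivAt_nonneg hab hderiv fun x hx => by
    have hfx : 0 < f x * √(f x) := mul_pos (hpos x hx) (Real.sqrt_pos.2 (hpos x hx))
    rw [sub_nonneg, div_le_div_iff₀ two_pos (by positivity)]
    linarith [hf' x hx]
  have hb : 0 < (√(f b))⁻¹ := inv_pos.2 (Real.sqrt_pos.2 (hpos b ⟨hab, le_rfl⟩))
  rw [div_eq_mul_inv]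
  linarith

lemma SolvesSystem.mul_sqrt_le_snd (hab : a ≤ b) (h : SolvesSystem g U V (Icc a b))
    (hg : ∀ t ∈ Icc a b, 0 ≤ g t) (hV : 0 ≤ V a) (hU : 0 ≤ U a) (hUb : 4 * U a ≤ U b) :
    U b * √(U b) ≤ V b := by
  have henergy := h.energy_le hab hg hV
  refine (abs_le_of_sq_le_sq' ?_ (h.snd_nonneg hg hV ⟨hab, le_rfl⟩)).2
  rw [mul_pow, Real.sq_sqrt (by linarith)]
  have hcube : (4 * U a) ^ 3 ≤ U b ^ 3 := by gcongr
  nlinarith [sq_nonneg (V a), pow_nonneg hU 3]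

theorem SolvesSystem.sub_lt_two_div (hκ : 0 < κ) (h : SolvesSystem g U V (Icc a b))
    (hg : ∀ t ∈ Icc a b, 0 ≤ g t) (hU : κ ^ 2 ≤ U a) (hV : 0 ≤ V a) : b - a < 2 / κ := by
  by_contra! hlen
  have hκ' : 0 < 1 / κ := by positivity
  set c := a + 1 / κ
  have hab : 2 / κ = 1 / κ + 1 / κ := by ring
  have hac : a ≤ c := le_add_of_nonneg_right hκ'.le
  have hcb : c ≤ b := by linarith
  have hUmono := h.monotoneOn_fst hg hV
  have ha : a ∈ Icc a b := ⟨le_rfl, hac.trans hcb⟩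
  have hUa : 0 < U a := (by positivity : 0 < κ ^ 2).trans_le hU
  have hUc : 4 * U a ≤ U c := by
    have hquad := (h.mono (Icc_subset_Icc_right hcb)).add_mul_add_sq_le_fst (c := 6 * U a ^ 2) hac
      fun t ht => by
        have htb : t ∈ Icc a b := ⟨ht.1, ht.2.trans hcb⟩
        nlinarith [hUmono ha htb ht.1, hg t htb]
    rw [show c - a = 1 / κ by ring] at hquad
    have hVκ : 0 ≤ V a * (1 / κ) := by positivity
    have hUκ : U a * (κ ^ 2 * (1 / κ) ^ 2) ≤ U a * (U a * (1 / κ) ^ 2) := by gcongr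
    rw [← mul_pow, mul_one_div_cancel hκ.ne'] at hUκ
    linarith
  have hgrow : ∀ t ∈ Icc c b, 4 * U a ≤ U t := fun t ht =>
    hUc.trans (hUmono ⟨hac, hcb⟩ ⟨hac.trans ht.1, ht.2⟩ ht.1)
  have hlast : b - c < 2 / √(U c) := sub_lt_two_div_sqrt_of_mul_sqrt_le_deriv hcb
    (fun t ht => (h t ⟨hac.trans ht.1, ht.2⟩).1) (fun t ht => by linarith [hgrow t ht])
    fun t ht => (h.mono (Icc_subset_Icc_right ht.2)).mul_sqrt_le_snd (hac.trans ht.1)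
      (fun x hx => hg x ⟨hx.1, hx.2.trans ht.2⟩) hV hUa.le (hgrow t ht)
  have hsqrt : 2 * κ ≤ √(U c) := Real.le_sqrt_of_sq_le (by linarith)
  have hfinal : 2 / √(U c) ≤ 2 / (2 * κ) := by gcongr
  have hdiv : 2 / (2 * κ) = 1 / κ := by field_simp
  linarith

lemma SolvesSystem.neg_half_sq_le_fst (hκ : 0 < κ) (h : SolvesSystem g U V (Icc a (a + 2 / κ)))
    (hg : ∀ t ∈ Icc a (a + 2 / κ), 0 ≤ g t) (hU : U a = -κ ^ 2) (hV : V a = 0) :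
    -(κ ^ 2 / 2) ≤ U (a + 2 / κ) := by
  have hab : a ≤ a + 2 / κ := le_add_of_nonneg_right (by positivity)
  by_contra! hlt
  have hquad := h.add_mul_add_sq_le_fst (c := 3 / 2 * κ ^ 4) hab fun t ht => by
    have hUt : U t ≤ -(κ ^ 2 / 2) :=
      (h.monotoneOn_fst hg hV.ge ht ⟨hab, le_rfl⟩ ht.2).trans hlt.le
    nlinarith [hg t ht, sq_nonneg κ]
  have hval : 3 / 2 * κ ^ 4 / 2 * (2 / κ) ^ 2 = 3 * κ ^ 2 := by field_simp
  rw [add_sub_cancel_left, hval, hV, hU] at hquad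
  nlinarith [sq_nonneg κ]

theorem SolvesSystem.sub_lt_six_div (hκ : 0 < κ) (h : SolvesSystem g U V (Icc a b))
    (hg : ∀ t ∈ Icc a b, 0 ≤ g t) (hU : U a = -κ ^ 2) (hV : V a = 0) : b - a < 6 / κ := by
  by_contra! hlen
  have hκ' : 0 < 2 / κ := by positivity
  have hsix : 6 / κ = 2 / κ + 2 / κ + 2 / κ := by ring
  set c := a + 2 / κ
  set d := c + 2 / κ
  have hac : a ≤ c := le_add_of_nonneg_right hκ'.le
  have hcd : c ≤ d := le_add_of_nonneg_right hκ'.le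
  have hcb : Icc a c ⊆ Icc a b := Icc_subset_Icc_right (by linarith)
  have hUc : -(κ ^ 2 / 2) ≤ U c :=
    (h.mono hcb).neg_half_sq_le_fst hκ (fun t ht => hg t (hcb ht)) hU hV
  have hVc : κ ^ 3 ≤ V c := by
    have henergy := (h.mono hcb).energy_le hac (fun t ht => hg t (hcb ht)) hV.ge
    refine (abs_le_of_sq_le_sq' ?_ (h.snd_nonneg hg hV.ge (hcb ⟨hac, le_rfl⟩))).2
    have hcube : (-(κ ^ 2 / 2)) ^ 3 ≤ U c ^ 3 := (Odd.strictMono_pow (by decide)).monotone hUc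
    rw [hV, hU] at henergy
    nlinarith [pow_pos hκ 6]
  have hUd : κ ^ 2 ≤ U d := by
    have hsub : Icc c d ⊆ Icc a b := Icc_subset_Icc hac (by linarith)
    have hlin := (h.mono hsub).add_mul_add_sq_le_fst (c := 0) hcd
      fun t ht => add_nonneg (by positivity) (hg t (hsub ht))
    have hVκ : κ ^ 3 * (2 / κ) ≤ V c * (2 / κ) := by gcongr
    have hval : κ ^ 3 * (2 / κ) = 2 * κ ^ 2 := by field_simp
    rw [show d - c = 2 / κ by ring] at hlin
    nlinarith [sq_nonneg κ]
  have had : a ≤ d := hac.trans hcd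
  have hlast := (h.mono (Icc_subset_Icc_left had)).sub_lt_two_div hκ
    (fun t ht => hg t ⟨had.trans ht.1, ht.2⟩) hUd
    (h.snd_nonneg hg hV.ge ⟨had, by linarith⟩)
  linarith

theorem exists_forall_lt_of_solvesSystem {r : ℝ} (hg₀ : ∀ t, 0 ≤ g t) (hg₁ : ∀ t, r ≤ t → 1 ≤ g t)
    (τ : ℝ) (p : ℝ × ℝ) :
    ∃ T, ∀ U V b, SolvesSystem g U V (Icc τ b) → (U τ, V τ) = p → b < T := by
  set r' := max τ r
  have hτr : τ ≤ r' := le_max_left _ _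
  set w := 2 * (|p.2| + 1) + |p.1| + |p.2| * (r' - τ)
  have hpr : 0 ≤ |p.2| * (r' - τ) := mul_nonneg (abs_nonneg _) (sub_nonneg.2 hτr)
  have hw : 2 * (|p.2| + 1) ≤ w := by linarith [abs_nonneg p.1]
  have hw₀ : 0 < w := by linarith [abs_nonneg p.2]
  refine ⟨r' + w + 2 / 1, fun U V b h hp => ?_⟩
  by_contra! hlen
  have hU : U τ = p.1 := congrArg Prod.fst hp
  have hV : V τ = p.2 := congrArg Prod.snd hp
  have hr : SolvesSystem g U V (Icc τ r') := h.mono (Icc_subset_Icc_right (by linarith))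
  have hrw : SolvesSystem g U V (Icc r' (r' + w)) := h.mono (Icc_subset_Icc hτr (by linarith))
  have hg_r : ∀ t ∈ Icc τ r', 0 ≤ 6 * U t ^ 2 + g t := fun t _ => add_nonneg (by positivity) (hg₀ t)
  have hg_rw : ∀ t ∈ Icc r' (r' + w), 1 ≤ 6 * U t ^ 2 + g t := fun t ht =>
    le_add_of_nonneg_of_le (by positivity) (hg₁ t ((le_max_right _ _).trans ht.1))
  have hV_r := hr.add_mul_le_snd hτr hg_r
  have hU_r := hr.add_mul_add_sq_le_fst hτr hg_r
  have hV_rw := hrw.add_mul_le_snd (by linarith) hg_rw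
  have hU_rw := hrw.add_mul_add_sq_le_fst (by linarith) hg_rw
  rw [hU, hV] at hU_r
  rw [hV] at hV_r
  rw [add_sub_cancel_left] at hU_rw hV_rw
  have hp₂ : -|p.2| * (r' - τ) ≤ p.2 * (r' - τ) :=
    mul_le_mul_of_nonneg_right (neg_abs_le _) (sub_nonneg.2 hτr)
  have hVw : -|p.2| * w ≤ V r' * w :=
    mul_le_mul_of_nonneg_right (by linarith [neg_abs_le p.2]) hw₀.le
  have hww : w ≤ w * (w / 2 - |p.2|) := by nlinarith
  have hlast := (h.mono (Icc_subset_Icc_left (by linarith : τ ≤ r' + w))).sub_lt_two_div one_pos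
    (fun t _ => hg₀ t) (by nlinarith [abs_nonneg p.2, neg_abs_le p.1])
    (by linarith [abs_nonneg p.2, neg_abs_le p.2])
  linarith

end Growth

section BlowUp

variable {U V U₁ V₁ U₂ V₂ : ℝ → ℝ} {S T S₁ T₁ S₂ T₂ a b c τ κ : ℝ}

/-- `U` solves `U'' = 6 U ^ 2 + |t|` on `(S, T)`, with derivative `V`, and tends to infinity at both
end points: the form taken by a solution of the boundary value problem on `(-T, -S)`, `S ≥ 0`, under
the substitution `t = -x`. The forcing term is extended evenly, so that reflection in the origin
preserves the equation. -/
structure BlowUp (U V : ℝ → ℝ) (S T : ℝ) : Prop where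
  lt : S < T
  sol : SolvesSystem abs U V (Ioo S T)
  left : Tendsto U (𝓝[>] S) atTop
  right : Tendsto U (𝓝[<] T) atTop

lemma SolvesSystem.reflect_abs_Ioo (h : SolvesSystem abs U V (Ioo S T)) :
    SolvesSystem abs (fun t => U (-t)) (fun t => -V (-t)) (Ioo (-T) (-S)) := by
  simpa only [abs_neg] using! h.reflect_Ioo

lemma SolvesSystem.reflect_abs_Icc (h : SolvesSystem abs U V (Icc a b)) :
    SolvesSystem abs (fun t => U (-t)) (fun t => -V (-t)) (Icc (-b) (-a)) := by
  simpa only [abs_neg, Set.neg_preimage, Set.neg_Icc] using! h.reflect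

lemma BlowUp.reflect (h : BlowUp U V S T) :
    BlowUp (fun t => U (-t)) (fun t => -V (-t)) (-T) (-S) where
  lt := neg_lt_neg h.lt
  sol := h.sol.reflect_abs_Ioo
  left := h.right.comp (by simpa using tendsto_neg_nhdsGT_neg (a := T))
  right := h.left.comp (by simpa using tendsto_neg_nhdsLT_neg (a := S))

lemma neg_mem_Ioo_neg (hτ : τ ∈ Ioo S T) : -τ ∈ Ioo (-T) (-S) :=
  ⟨neg_lt_neg hτ.2, neg_lt_neg hτ.1⟩

lemma not_tendsto_atTop_of_continuousAt {f : ℝ → ℝ} {l : Filter ℝ} [l.NeBot]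
    (hl : l ≤ 𝓝 a) (hf : ContinuousAt f a) : ¬ Tendsto f l atTop :=
  fun h => not_tendsto_nhds_of_tendsto_atTop h _ (hf.tendsto.mono_left hl)

lemma BlowUp.lt_right (h : BlowUp U V S T) (hτ : τ ∈ Ioo S T)
    (h' : SolvesSystem abs U₂ V₂ (Icc τ b)) (hU : U τ = U₂ τ) (hV : V τ = V₂ τ) : b < T := by
  by_contra! hle
  have hcont : ContinuousAt U₂ T := (h' T ⟨hτ.2.le, hle⟩).1.continuousAt
  refine not_tendsto_atTop_of_continuousAt (l := 𝓝[<] T) nhdsWithin_le_nhds hcont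
    (h.right.congr' ?_)
  filter_upwards [Ioo_mem_nhdsLT hτ.2] with x hx
  exact ((h.sol.mono fun y hy => ⟨hτ.1.trans_le hy.1, hy.2⟩).eqOn
    (h'.mono fun y hy => ⟨hy.1, hy.2.le.trans hle⟩) (s := Ico τ T) ⟨le_rfl, hτ.2⟩ hU hV
    ⟨hx.1.le, hx.2⟩).1

lemma BlowUp.right_le_right (h₁ : BlowUp U₁ V₁ S₁ T₁) (h₂ : BlowUp U₂ V₂ S₂ T₂)
    (hτ₁ : τ ∈ Ioo S₁ T₁) (hτ₂ : τ ∈ Ioo S₂ T₂) (hU : U₁ τ = U₂ τ) (hV : V₁ τ = V₂ τ) :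
    T₁ ≤ T₂ := by
  refine le_of_forall_lt fun c hc => ?_
  exact h₂.lt_right hτ₂ (h₁.sol.mono fun y hy => ⟨hτ₁.1.trans_le hy.1, hy.2.trans_lt hc⟩)
    hU.symm hV.symm

lemma BlowUp.right_unique (h₁ : BlowUp U₁ V₁ S₁ T₁) (h₂ : BlowUp U₂ V₂ S₂ T₂)
    (hτ₁ : τ ∈ Ioo S₁ T₁) (hτ₂ : τ ∈ Ioo S₂ T₂) (hU : U₁ τ = U₂ τ) (hV : V₁ τ = V₂ τ) :
    T₁ = T₂ :=
  (h₁.right_le_right h₂ hτ₁ hτ₂ hU hV).antisymm (h₂.right_le_right h₁ hτ₂ hτ₁ hU.symm hV.symm)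

lemma BlowUp.left_unique (h₁ : BlowUp U₁ V₁ S₁ T₁) (h₂ : BlowUp U₂ V₂ S₂ T₂)
    (hτ₁ : τ ∈ Ioo S₁ T₁) (hτ₂ : τ ∈ Ioo S₂ T₂) (hU : U₁ τ = U₂ τ) (hV : V₁ τ = V₂ τ) :
    S₁ = S₂ :=
  neg_injective (h₁.reflect.right_unique h₂.reflect (neg_mem_Ioo_neg hτ₁) (neg_mem_Ioo_neg hτ₂)
    (by simpa using hU) (by simpa using hV))

lemma BlowUp.monotoneOn_snd (h : BlowUp U V S T) : MonotoneOn V (Ioo S T) :=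
  h.sol.monotoneOn_snd fun t _ => abs_nonneg t

lemma BlowUp.right_le (h : BlowUp U V S T) (ha : a ∈ Ioo S T) (hκ : 0 < κ)
    (hU : κ ^ 2 ≤ U a) (hV : 0 ≤ V a) : T ≤ a + 2 / κ := by
  by_contra! hlt
  have hlen := (h.sol.mono fun y hy => ⟨ha.1.trans_le hy.1, hy.2.trans_lt hlt⟩).sub_lt_two_div hκ
    (fun t _ => abs_nonneg t) hU hV
  linarith

lemma BlowUp.exists_snd_pos (h : BlowUp U V S T) (hc : c ∈ Ioo S T) : ∃ ξ ∈ Ioo c T, 0 < V ξ := by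
  obtain ⟨t, hUt, ht⟩ := ((h.right.eventually_gt_atTop (U c)).and (Ioo_mem_nhdsLT hc.2)).exists
  have hsub : Icc c t ⊆ Ioo S T := fun x hx => ⟨hc.1.trans_le hx.1, hx.2.trans_lt ht.2⟩
  obtain ⟨ξ, hξ, hVξ⟩ := exists_hasDerivAt_eq_slope U V ht.1 (h.sol.continuousOn_fst.mono hsub)
    fun x hx => (h.sol x (hsub (Ioo_subset_Icc_self hx))).1
  exact ⟨ξ, ⟨hξ.1, hξ.2.trans ht.2⟩, hVξ ▸ div_pos (sub_pos.2 hUt) (sub_pos.2 ht.1)⟩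

lemma BlowUp.exists_snd_neg (h : BlowUp U V S T) (hc : c ∈ Ioo S T) : ∃ ξ ∈ Ioo S c, V ξ < 0 := by
  obtain ⟨ξ, hξ, hV⟩ := h.reflect.exists_snd_pos (neg_mem_Ioo_neg hc)
  exact ⟨-ξ, ⟨lt_neg.1 hξ.2, neg_lt.1 hξ.1⟩, neg_pos.1 hV⟩

lemma BlowUp.exists_snd_eq_zero (h : BlowUp U V S T) : ∃ τ ∈ Ioo S T, V τ = 0 := by
  obtain ⟨c, hc⟩ := exists_between h.lt
  obtain ⟨ξ, hξ, hVξ⟩ := h.exists_snd_neg hc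
  obtain ⟨η, hη, hVη⟩ := h.exists_snd_pos hc
  have hsub : Icc ξ η ⊆ Ioo S T := fun x hx => ⟨hξ.1.trans_le hx.1, hx.2.trans_lt hη.2⟩
  obtain ⟨τ, hτ, hVτ⟩ := intermediate_value_Icc (hξ.2.trans hη.1).le
    (h.sol.continuousOn_snd.mono hsub) ⟨hVξ.le, hVη.le⟩
  exact ⟨τ, hsub hτ, hVτ⟩

lemma eq_Ioo_csInf_csSup {J : Set ℝ} (hJ : IsOpen J) (hJ' : J.OrdConnected) (hne : J.Nonempty)
    (hb : BddBelow J) (ha : BddAbove J) : J = Ioo (sInf J) (sSup J) := by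
  refine Subset.antisymm (fun t ht => ?_)
    (IsConnected.Ioo_csInf_csSup_subset ⟨hne, hJ'.isPreconnected⟩ hb ha)
  obtain ⟨ε, hε, hsub⟩ := Metric.isOpen_iff.1 hJ t ht
  rw [Real.ball_eq_Ioo] at hsub
  have hr : t + ε / 2 ∈ J := hsub ⟨by linarith, by linarith⟩
  have hl : t - ε / 2 ∈ J := hsub ⟨by linarith, by linarith⟩
  exact ⟨(csInf_le hb hl).trans_lt (by linarith), (le_csSup ha hr).trans_lt' (by linarith)⟩

lemma bddAbove_of_mem_solutionIntervals {J : Set ℝ} {p : ℝ × ℝ}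
    (hJ : J ∈ solutionIntervals abs τ p) : BddAbove J := by
  obtain ⟨-, hJ', hτ, U, V, h, hp⟩ := hJ
  obtain ⟨B, hB⟩ := exists_forall_lt_of_solvesSystem (r := 1) abs_nonneg
    (fun t ht => ht.trans (le_abs_self t)) τ p
  refine ⟨B, fun t ht => ?_⟩
  exact (hB U V t (h.mono (hJ'.out hτ ht)) hp).le

lemma neg_mem_solutionIntervals {g : ℝ → ℝ} {J : Set ℝ} {p : ℝ × ℝ}
    (hJ : J ∈ solutionIntervals g τ p) :
    -J ∈ solutionIntervals (fun t => g (-t)) (-τ) (p.1, -p.2) := by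
  obtain ⟨hJo, hJ', hτ, U, V, h, rfl⟩ := hJ
  exact ⟨hJo.neg, ⟨fun x hx y hy z hz => hJ'.out hy hx ⟨neg_le_neg hz.2, neg_le_neg hz.1⟩⟩,
    by simpa, fun t => U (-t), fun t => -V (-t), h.reflect, by simp⟩

lemma neg_mem_solutionIntervals_abs {J : Set ℝ} {p : ℝ × ℝ} (hJ : J ∈ solutionIntervals abs τ p) :
    -J ∈ solutionIntervals abs (-τ) (p.1, -p.2) := by
  simpa only [abs_neg] using! neg_mem_solutionIntervals hJ

theorem exists_blowUp (τ : ℝ) (p : ℝ × ℝ) : ∃ (U V : ℝ → ℝ) (S T : ℝ), BlowUp U V S T ∧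
    τ ∈ Ioo S T ∧ (U τ, V τ) = p := by
  have hJ := sUnion_mem_solutionIntervals continuous_abs τ p
  have hmax : ∀ J ∈ solutionIntervals abs τ p, J ⊆ ⋃₀ solutionIntervals abs τ p :=
    fun J => subset_sUnion_of_mem
  set J := ⋃₀ solutionIntervals abs τ p
  have hbelow : BddBelow J :=
    bddAbove_neg.1 (bddAbove_of_mem_solutionIntervals (neg_mem_solutionIntervals_abs hJ))
  have hIoo := eq_Ioo_csInf_csSup hJ.1 hJ.2.1 ⟨τ, hJ.2.2.1⟩ hbelow
    (bddAbove_of_mem_solutionIntervals hJ)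
  set S := sInf J
  set T := sSup J
  obtain ⟨-, -, hτ, U, V, h, hp⟩ := hJ
  rw [hIoo] at hτ h hmax
  have hST : S < T := hτ.1.trans hτ.2
  have hpos : ∀ (I : Set ℝ), ∀ t ∈ I, 0 ≤ |t| := fun _ t _ => abs_nonneg t
  refine ⟨U, V, S, T, ⟨hST, h, ?_, ?_⟩, hτ, hp⟩
  · rcases h.reflect_abs_Ioo.tendsto_atTop_or_exists_extension continuous_abs (hpos _)
      (neg_mem_Ioo_neg hτ) with hlim | ⟨η, hη, hext⟩
    · simpa [Function.comp_def] using! hlim.comp (tendsto_neg_nhdsGT (a := S))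
    · have hmem := neg_mem_solutionIntervals_abs hext
      simp only [neg_neg, hp] at hmem
      exact absurd (hmax _ hmem (show S ∈ -Ioo (-T) (-S + η) by simp [hST, hη])).1 (lt_irrefl S)
  · rcases h.tendsto_atTop_or_exists_extension continuous_abs (hpos _) hτ with
      hlim | ⟨η, hη, hext⟩
    · exact hlim
    · rw [hp] at hext
      exact absurd (hmax _ hext ⟨hST, lt_add_of_pos_right T hη⟩).2 (lt_irrefl T)

end BlowUp

section MinimumData

variable {U V : ℝ → ℝ} {S T τ m κ : ℝ} {p : ℝ × ℝ}

/-- The blow-up solution with minimum value `p.2`, attained at the point `p.1`. -/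
noncomputable def minU (p : ℝ × ℝ) : ℝ → ℝ := (exists_blowUp p.1 (p.2, 0)).choose

/-- The derivative of `minU p`. -/
noncomputable def minV (p : ℝ × ℝ) : ℝ → ℝ := (exists_blowUp p.1 (p.2, 0)).choose_spec.choose

/-- The left end point of the interval of existence of `minU p`. -/
noncomputable def leftTime (p : ℝ × ℝ) : ℝ :=
  (exists_blowUp p.1 (p.2, 0)).choose_spec.choose_spec.choose

/-- The right end point of the interval of existence of `minU p`. -/
noncomputable def rightTime (p : ℝ × ℝ) : ℝ :=
  (exists_blowUp p.1 (p.2, 0)).choose_spec.choose_spec.choose_spec.choose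

lemma blowUp_min (p : ℝ × ℝ) : BlowUp (minU p) (minV p) (leftTime p) (rightTime p) :=
  (exists_blowUp p.1 (p.2, 0)).choose_spec.choose_spec.choose_spec.choose_spec.1

lemma fst_mem_Ioo (p : ℝ × ℝ) : p.1 ∈ Ioo (leftTime p) (rightTime p) :=
  (exists_blowUp p.1 (p.2, 0)).choose_spec.choose_spec.choose_spec.choose_spec.2.1

lemma minU_fst (p : ℝ × ℝ) : minU p p.1 = p.2 :=
  congrArg Prod.fst (exists_blowUp p.1 (p.2, 0)).choose_spec.choose_spec.choose_spec.choose_spec.2.2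

lemma minV_fst (p : ℝ × ℝ) : minV p p.1 = 0 :=
  congrArg Prod.snd (exists_blowUp p.1 (p.2, 0)).choose_spec.choose_spec.choose_spec.choose_spec.2.2

lemma leftTime_eq (p : ℝ × ℝ) : leftTime p = -rightTime (-p.1, p.2) := by
  rw [← (blowUp_min p).reflect.right_unique (blowUp_min (-p.1, p.2))
    (neg_mem_Ioo_neg (fst_mem_Ioo p)) (fst_mem_Ioo (-p.1, p.2)) (by simp [minU_fst (-p.1, p.2),
      minU_fst p]) (by simp [minV_fst (-p.1, p.2), minV_fst p]), neg_neg]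

theorem exists_nearby_min (p₀ : ℝ × ℝ) {a b ε : ℝ} (ha : leftTime p₀ < a) (hb : b < rightTime p₀)
    (hp : p₀.1 ∈ Ioo a b) (hε : 0 < ε) :
    ∀ᶠ p in 𝓝 p₀, p.1 ∈ Ioo a b ∧ leftTime p < a ∧ b < rightTime p ∧ ∀ t ∈ Icc a b,
      dist (minU p t, minV p t) (minU p₀ t, minV p₀ t) < ε := by
  obtain ⟨δ, hδ, hnear⟩ := ((blowUp_min p₀).sol.mono (Icc_subset_Ioo ha hb)).exists_nearby
    continuous_abs (Ioo_subset_Icc_self hp) hε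
  have hfst : ∀ᶠ p : ℝ × ℝ in 𝓝 p₀, p.1 ∈ Ioo a b :=
    continuous_fst.continuousAt.eventually_mem (isOpen_Ioo.mem_nhds hp)
  filter_upwards [hfst, Metric.ball_mem_nhds p₀ hδ] with p hpI hpδ
  obtain ⟨hpδ₁, hpδ₂⟩ := max_lt_iff.1 (Prod.dist_eq.symm.trans_lt hpδ)
  obtain ⟨U', V', η, hη, h', hinit, hclose⟩ := hnear p.1 (Ioo_subset_Icc_self hpI) hpδ₁ (p.2, 0)
    (by simpa [Prod.dist_eq, minU_fst, minV_fst, hδ] using hpδ₂)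
  have h'ab : SolvesSystem abs U' V' (Icc a b) :=
    h'.mono (Icc_subset_Ioo (sub_lt_self a hη) (lt_add_of_pos_right b hη))
  obtain ⟨hU, hV⟩ := Prod.mk_inj.1 hinit
  have hU' : minU p p.1 = U' p.1 := (minU_fst p).trans hU.symm
  have hV' : minV p p.1 = V' p.1 := (minV_fst p).trans hV.symm
  have hright : b < rightTime p := (blowUp_min p).lt_right (fst_mem_Ioo p)
    (h'ab.mono (Icc_subset_Icc_left hpI.1.le)) hU' hV'
  have hleft : leftTime p < a := neg_lt_neg_iff.1 <| (blowUp_min p).reflect.lt_right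
    (neg_mem_Ioo_neg (fst_mem_Ioo p))
    (h'ab.mono (Icc_subset_Icc_right hpI.2.le)).reflect_abs_Icc (by simpa using hU')
    (by simpa using hV')
  refine ⟨hpI, hleft, hright, fun t ht => ?_⟩
  obtain ⟨hUt, hVt⟩ := ((blowUp_min p).sol.mono (Icc_subset_Ioo hleft hright)).eqOn h'ab
    (Ioo_subset_Icc_self hpI) hU' hV' ht
  rw [hUt, hVt]
  exact hclose t ht

lemma eventually_lt_rightTime (p₀ : ℝ × ℝ) {c : ℝ} (hc : c < rightTime p₀) :
    ∀ᶠ p in 𝓝 p₀, c < rightTime p := by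
  obtain ⟨hl, hr⟩ := fst_mem_Ioo p₀
  obtain ⟨a, ha, hap⟩ := exists_between hl
  obtain ⟨b, hb, hbr⟩ := exists_between (max_lt hc hr)
  filter_upwards [exists_nearby_min p₀ ha hbr ⟨hap, (le_max_right _ _).trans_lt hb⟩ one_pos]
    with p hp
  exact (le_max_left _ _).trans_lt (hb.trans hp.2.2.1)

lemma eventually_rightTime_lt (p₀ : ℝ × ℝ) {c : ℝ} (hc : rightTime p₀ < c) :
    ∀ᶠ p in 𝓝 p₀, rightTime p < c := by
  obtain ⟨hl, hr⟩ := fst_mem_Ioo p₀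
  obtain ⟨a, ha, hap⟩ := exists_between hl
  have hgap : 0 < c - rightTime p₀ := sub_pos.2 hc
  set κ := 2 / (c - rightTime p₀)
  have hκ : 0 < κ := by positivity
  have hκ' : 2 / κ = c - rightTime p₀ := by simp only [κ]; field_simp
  obtain ⟨b, hUb, hb⟩ := (((blowUp_min p₀).right.eventually_gt_atTop (κ ^ 2 + 1)).and
    (Ioo_mem_nhdsLT hr)).exists
  filter_upwards [exists_nearby_min p₀ ha hb.2 ⟨hap, hb.1⟩ one_pos] with p hpm
  obtain ⟨hpI, -, hbp, hclose⟩ := hpm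
  have hbI : b ∈ Ioo (leftTime p) (rightTime p) := ⟨(fst_mem_Ioo p).1.trans hpI.2, hbp⟩
  have hU : |minU p b - minU p₀ b| < 1 :=
    (le_max_left _ _).trans_lt (hclose b ⟨(hap.trans hb.1).le, le_rfl⟩)
  have hV : 0 ≤ minV p b :=
    minV_fst p ▸ (blowUp_min p).monotoneOn_snd (fst_mem_Ioo p) hbI hpI.2.le
  have hle := (blowUp_min p).right_le hbI hκ (by linarith [(abs_lt.1 hU).1]) hV
  linarith [hb.2]

theorem continuous_rightTime : Continuous rightTime :=
  continuous_iff_continuousAt.2 fun p₀ => tendsto_order.2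
    ⟨fun _ => eventually_lt_rightTime p₀, fun _ => eventually_rightTime_lt p₀⟩

theorem continuous_leftTime : Continuous leftTime := by
  rw [funext leftTime_eq]
  exact (continuous_rightTime.comp (by fun_prop)).neg

lemma rightTime_le (hκ : 0 < κ) (hm : |m| = κ ^ 2) : rightTime (τ, m) ≤ τ + 6 / κ := by
  have hp : τ ∈ Ioo (leftTime (τ, m)) (rightTime (τ, m)) := fst_mem_Ioo (τ, m)
  have hU : minU (τ, m) τ = m := minU_fst (τ, m)
  have hV : minV (τ, m) τ = 0 := minV_fst (τ, m)
  rcases le_total 0 m with hm₀ | hm₀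
  · rw [abs_of_nonneg hm₀] at hm
    have hle := (blowUp_min (τ, m)).right_le hp hκ (hU.trans hm).ge hV.ge
    have hmono : 2 / κ ≤ 6 / κ := by gcongr; norm_num
    linarith
  · rw [abs_of_nonpos hm₀] at hm
    by_contra! hlt
    have hlen := ((blowUp_min (τ, m)).sol.mono (Icc_subset_Ioo hp.1 hlt)).sub_lt_six_div hκ
      (fun t _ => abs_nonneg t) (by linarith) hV
    linarith

lemma le_leftTime (hκ : 0 < κ) (hm : |m| = κ ^ 2) : τ - 6 / κ ≤ leftTime (τ, m) := by
  rw [leftTime_eq, le_neg, neg_sub, sub_eq_neg_add]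
  exact rightTime_le hκ hm

lemma rightTime_le_half (hτ : τ < 0) (hm : 1 ≤ m + (-τ) ^ 3 / 16) :
    rightTime (τ, m) ≤ τ / 2 + 2 := by
  have hp : τ ∈ Ioo (leftTime (τ, m)) (rightTime (τ, m)) := fst_mem_Ioo (τ, m)
  have hV : minV (τ, m) τ = 0 := minV_fst (τ, m)
  by_contra! hlt
  have hhalf : τ / 2 ∈ Ioo (leftTime (τ, m)) (rightTime (τ, m)) :=
    ⟨by linarith [hp.1], by linarith⟩
  have hquad := ((blowUp_min (τ, m)).sol.mono
    (Icc_subset_Ioo hp.1 hhalf.2)).add_mul_add_sq_le_fst (c := -τ / 2) (by linarith) fun t ht => by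
      rw [abs_of_nonpos (by linarith [ht.2])]
      linarith [sq_nonneg (minU (τ, m) t), ht.2]
  have hU : 1 ≤ minU (τ, m) (τ / 2) := by
    rw [show minU (τ, m) τ = m from minU_fst (τ, m), hV] at hquad
    linarith
  have hle := (blowUp_min (τ, m)).right_le hhalf one_pos (by simpa using hU)
    (hV ▸ (blowUp_min (τ, m)).monotoneOn_snd hp hhalf (by linarith))
  linarith

lemma exists_lt_leftTime (t₀ m : ℝ) : ∃ τ > t₀, t₀ < leftTime (τ, m) := by
  set w := 16 + |m| + 2 * |t₀|
  have hm := abs_nonneg m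
  have ht₀ := abs_nonneg t₀
  have hcube : 256 * w ≤ w ^ 3 := by
    nlinarith [mul_self_nonneg (w - 16), (by linarith : 16 ≤ w)]
  have hle := rightTime_le_half (τ := -w) (m := m) (by linarith)
    (by rw [neg_neg]; linarith [neg_abs_le m])
  refine ⟨w, by linarith [le_abs_self t₀], ?_⟩
  rw [leftTime_eq]
  linarith [le_abs_self t₀]

end MinimumData

section Comparison

variable {f f' h h' : ℝ → ℝ} {a b c l : ℝ}

lemma le_of_hasDerivAt_le_of_tendsto (hf : ∀ t ∈ Ioo a c, HasDerivAt f (f' t) t)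
    (hh : ∀ t ∈ Ioo a c, HasDerivAt h (h' t) t) (hle : ∀ t ∈ Ioo a c, f' t ≤ h' t)
    (hfl : Tendsto f (𝓝[>] a) (𝓝 l)) (hhl : Tendsto h (𝓝[>] a) (𝓝 l)) {t : ℝ}
    (ht : t ∈ Ioo a c) : f t ≤ h t := by
  have hmono : MonotoneOn (fun x => h x - f x) (Ioo a c) := monotoneOn_of_hasDerivAt_nonneg
    (fun x hx => (hh x hx).sub (hf x hx)) fun x hx => sub_nonneg.2 (hle x hx)
  have hlim : Tendsto (fun x => h x - f x) (𝓝[>] a) (𝓝 0) := by simpa using hhl.sub hfl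
  refine sub_nonneg.1 (le_of_tendsto hlim ?_)
  filter_upwards [Ioo_mem_nhdsGT ht.1] with x hx using hmono ⟨hx.1, hx.2.trans ht.2⟩ ht hx.2.le

lemma tendsto_sub_pow_nhdsGT (a : ℝ) (n : ℕ) :
    Tendsto (fun t => (t - a) ^ (n + 1)) (𝓝[>] a) (𝓝 0) := by
  have hlim : Tendsto (fun t => (t - a) ^ (n + 1)) (𝓝 a) (𝓝 ((a - a) ^ (n + 1))) :=
    Continuous.tendsto (by fun_prop) a
  simpa using hlim.mono_left nhdsWithin_le_nhds

lemma abs_sub_le_mul_pow_of_hasDerivAt {K : ℝ} {n : ℕ}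
    (hf : ∀ t ∈ Ioo a c, HasDerivAt f (f' t) t) (hfl : Tendsto f (𝓝[>] a) (𝓝 0))
    (hK : ∀ t ∈ Ioo a c, |f' t - 1| ≤ K * (t - a) ^ n) {t : ℝ} (ht : t ∈ Ioo a c) :
    |f t - (t - a)| ≤ K * (t - a) ^ (n + 1) := by
  have hlin : ∀ x, HasDerivAt (fun x => x - a) 1 x := fun x => (hasDerivAt_id x).sub_const a
  have hdiff : ∀ x ∈ Ioo a c, HasDerivAt (fun x => f x - (x - a)) (f' x - 1) x :=
    fun x hx => (hf x hx).sub (hlin x)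
  have hpow : ∀ x ∈ Ioo a c, HasDerivAt (fun x => K * (x - a) ^ (n + 1))
      (K * ((n + 1) * (x - a) ^ n)) x := fun x _ => by
    simpa using! ((hlin x).pow (n + 1)).const_mul K
  have hgap : ∀ x ∈ Ioo a c, |f' x - 1| ≤ K * ((n + 1) * (x - a) ^ n) := fun x hx => by
    nlinarith [hK x hx, abs_nonneg (f' x - 1), n.cast_nonneg (α := ℝ)]
  have hdiff_lim : Tendsto (fun x => f x - (x - a)) (𝓝[>] a) (𝓝 0) := by
    simpa using hfl.sub (tendsto_sub_pow_nhdsGT a 0)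
  have hpow_lim : Tendsto (fun x => K * (x - a) ^ (n + 1)) (𝓝[>] a) (𝓝 0) := by
    simpa using (tendsto_sub_pow_nhdsGT a n).const_mul K
  refine abs_le'.2 ⟨?_, ?_⟩
  · exact le_of_hasDerivAt_le_of_tendsto hdiff hpow
      (fun x hx => (le_abs_self _).trans (hgap x hx)) hdiff_lim hpow_lim ht
  · exact le_of_hasDerivAt_le_of_tendsto (fun x hx => (hdiff x hx).neg) hpow
      (fun x hx => (neg_le_abs _).trans (hgap x hx)) (neg_zero (G := ℝ) ▸ hdiff_lim.neg)
      hpow_lim ht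

lemma nonpos_of_hasDerivAt_of_pos_left {f' : ℝ} (hab : a < b) (hf : HasDerivAt f f' b)
    (hpos : ∀ t ∈ Ioo a b, 0 < f t) (hb : f b = 0) : f' ≤ 0 := by
  have hslope : Tendsto (slope f b) (𝓝[<] b) (𝓝 f') :=
    (hasDerivAt_iff_tendsto_slope.1 hf).mono_left (nhdsWithin_mono b fun x hx => ne_of_lt hx)
  refine le_of_tendsto hslope ?_
  filter_upwards [Ioo_mem_nhdsLT hab] with x hx
  rw [slope_def_field, hb, sub_zero]
  exact div_nonpos_of_nonneg_of_nonpos (hpos x hx).le (sub_nonpos.2 hx.2.le)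

lemma exists_first_zero (hab : a ≤ b) (hf : ContinuousOn f (Icc a b))
    (ha : 0 < f a) (hb : f b ≤ 0) : ∃ z ∈ Ioc a b, f z = 0 ∧ ∀ t ∈ Ico a z, 0 < f t := by
  have hzero : ∀ c ∈ Icc a b, f c ≤ 0 → ∃ y ∈ Icc a c, f y = 0 := fun c hc hfc =>
    intermediate_value_Icc' hc.1 (hf.mono (Icc_subset_Icc_right hc.2)) ⟨hfc, ha.le⟩
  have hcompact : IsCompact (Icc a b ∩ f ⁻¹' {0}) := isCompact_Icc.of_isClosed_subset
    (hf.preimage_isClosed_of_isClosed isClosed_Icc isClosed_singleton) inter_subset_left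
  obtain ⟨z, ⟨hz, hfz⟩, hmin⟩ := hcompact.exists_isLeast (hzero b ⟨hab, le_rfl⟩ hb)
  refine ⟨z, ⟨hz.1.lt_of_ne fun haz => ha.ne' (haz ▸ hfz), hz.2⟩, hfz, fun t ht => ?_⟩
  by_contra! hle
  obtain ⟨y, hy, hfy⟩ := hzero t ⟨ht.1, ht.2.le.trans hz.2⟩ hle
  exact (hmin ⟨⟨hy.1, (hy.2.trans ht.2.le).trans hz.2⟩, hfy⟩).not_gt (hy.2.trans_lt ht.2)

lemma exists_first_crossing (hf : ContinuousOn f (Ioo a b))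
    (hh : ContinuousOn h (Ioo a b)) (hlt : ∀ᶠ x in 𝓝[>] a, f x < h x) :
    (∀ x ∈ Ioo a b, f x < h x) ∨ ∃ z ∈ Ioo a b, f z = h z ∧ ∀ x ∈ Ioo a z, f x < h x := by
  by_cases! hall : ∀ x ∈ Ioo a b, f x < h x
  · exact Or.inl hall
  obtain ⟨x, hx, hle⟩ := hall
  obtain ⟨y, hay, hy⟩ := mem_nhdsGT_iff_exists_Ioc_subset.1 (hlt.and (Ioo_mem_nhdsGT hx.1))
  have hyx : y < x := (hy ⟨hay, le_rfl⟩).2.2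
  obtain ⟨z, hz, hfz, hpos⟩ := exists_first_zero (f := fun t => h t - f t) hyx.le
    ((hh.sub hf).mono fun t ht => ⟨hay.trans_le ht.1, ht.2.trans_lt hx.2⟩)
    (sub_pos.2 (hy ⟨hay, le_rfl⟩).1) (sub_nonpos.2 hle)
  refine Or.inr ⟨z, ⟨hay.trans hz.1, hz.2.trans_lt hx.2⟩, (sub_eq_zero.1 hfz).symm,
    fun t ht => ?_⟩
  rcases le_or_gt t y with hty | hyt
  · exact (hy ⟨ht.1, hty⟩).1
  · exact sub_pos.1 (hpos t ⟨hyt.le, ht.2⟩)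

end Comparison

section Asymptotics

variable {g U V U₁ V₁ U₂ V₂ : ℝ → ℝ} {S S₁ S₂ T T₁ T₂ a b A : ℝ}

lemma SolvesSystem.abs_energy_sub_le (hab : a ≤ b) (h : SolvesSystem g U V (Icc a b))
    (hg : ∀ t ∈ Icc a b, 0 ≤ g t ∧ g t ≤ A) (hV : ∀ t ∈ Icc a b, V t ≤ 0) :
    |V a ^ 2 - 4 * U a ^ 3 - (V b ^ 2 - 4 * U b ^ 3)| ≤ 2 * A * (U a - U b) := by
  have hderiv : ∀ x ∈ Icc a b, HasDerivAt (fun x => V x ^ 2 - 4 * U x ^ 3) (2 * V x * g x) x :=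
    fun x hx => by
      refine (((h x hx).2.pow 2).sub (((h x hx).1.pow 3).const_mul 4)).congr_deriv ?_
      norm_num
      ring
  have hanti := le_of_hasDerivAt_nonneg (f := fun x => -(V x ^ 2 - 4 * U x ^ 3)) hab
    (fun x hx => (hderiv x hx).neg) fun x hx => by nlinarith [hV x hx, hg x hx]
  have hmono := le_of_hasDerivAt_nonneg
    (f := fun x => V x ^ 2 - 4 * U x ^ 3 - 2 * A * U x) hab
    (fun x hx => (hderiv x hx).sub ((h x hx).1.const_mul (2 * A))) fun x hx => by
      nlinarith [hV x hx, hg x hx]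
  rw [abs_of_nonneg (by linarith)]
  linarith

lemma BlowUp.exists_snd_neg_one_le_fst (h : BlowUp U V S T) :
    ∃ c ∈ Ioo S T, ∀ t ∈ Ioc S c, V t < 0 ∧ 1 ≤ U t := by
  obtain ⟨b, hb⟩ := exists_between h.lt
  obtain ⟨d, hd, hVd⟩ := h.exists_snd_neg hb
  have hdT : d < T := hd.2.trans hb.2
  obtain ⟨c, hSc, hc⟩ := mem_nhdsGT_iff_exists_Ioc_subset.1
    ((h.left.eventually_ge_atTop 1).and (Ioo_mem_nhdsGT hd.1))
  refine ⟨c, ⟨hSc, (hc ⟨hSc, le_rfl⟩).2.2.trans hdT⟩, fun t ht => ⟨?_, (hc ht).1⟩⟩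
  have htd := (hc ht).2
  exact (h.monotoneOn_snd ⟨htd.1, htd.2.trans hdT⟩ ⟨hd.1, hdT⟩ htd.2.le).trans_lt hVd

lemma BlowUp.exists_energy_bound (h : BlowUp U V S T) : ∃ c ∈ Ioo S T, ∃ C ≥ 0,
    ∀ t ∈ Ioo S c, V t < 0 ∧ 1 ≤ U t ∧ |V t ^ 2 - 4 * U t ^ 3| ≤ C * U t := by
  obtain ⟨c, hc, hUV⟩ := h.exists_snd_neg_one_le_fst
  have hUc : 1 ≤ U c := (hUV c ⟨hc.1, le_rfl⟩).2
  set A := max |S| |T|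
  have : 0 ≤ A := (abs_nonneg S).trans (le_max_left _ _)
  set Q := V c ^ 2 - 4 * U c ^ 3
  refine ⟨c, hc, 2 * A + |Q|, by positivity, fun t ht => ?_⟩
  obtain ⟨hVt, hUt⟩ := hUV t ⟨ht.1, ht.2.le⟩
  refine ⟨hVt, hUt, ?_⟩
  have hsub : Icc t c ⊆ Ioo S T := Icc_subset_Ioo ht.1 hc.2
  have henergy := (h.sol.mono hsub).abs_energy_sub_le ht.2.le (A := A)
    (fun x hx => ⟨abs_nonneg x, abs_le_max_abs_abs (hsub hx).1.le (hsub hx).2.le⟩)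
    fun x hx => (hUV x ⟨(hsub hx).1, hx.2⟩).1.le
  calc |V t ^ 2 - 4 * U t ^ 3| ≤ |V t ^ 2 - 4 * U t ^ 3 - Q| + |Q| := by
        linarith [abs_sub_abs_le_abs_sub (V t ^ 2 - 4 * U t ^ 3) Q]
    _ ≤ 2 * A * (U t - U c) + |Q| := by gcongr
    _ ≤ 2 * A * U t + |Q| * U t := by
        gcongr
        · linarith
        · exact le_mul_of_one_le_right (abs_nonneg Q) hUt
    _ = (2 * A + |Q|) * U t := by ring

lemma abs_neg_div_sub_one_le {s v C : ℝ} (hs : 0 < s) (hv : v < 0)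
    (h : |v ^ 2 - 4 * (s ^ 2) ^ 3| ≤ C * s ^ 2) :
    |-v / (2 * s ^ 3) - 1| ≤ C * s⁻¹ ^ 4 := by
  have hs₃ : 0 < 2 * s ^ 3 := by positivity
  have hprod : |-v - 2 * s ^ 3| * (2 * s ^ 3) ≤ C * s ^ 2 := by
    calc |-v - 2 * s ^ 3| * (2 * s ^ 3) ≤ |-v - 2 * s ^ 3| * (-v + 2 * s ^ 3) := by
          gcongr
          linarith
      _ = |v ^ 2 - 4 * (s ^ 2) ^ 3| := by
          rw [← abs_of_pos (by linarith : 0 < -v + 2 * s ^ 3), ← abs_mul]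
          ring_nf
      _ ≤ C * s ^ 2 := h
  have hC : 0 ≤ C * s⁻¹ ^ 4 := by
    have hCs : 0 ≤ C * s ^ 2 := (abs_nonneg _).trans h
    have hC : 0 ≤ C := nonneg_of_mul_nonneg_left hCs (by positivity)
    positivity
  calc |-v / (2 * s ^ 3) - 1| = |-v - 2 * s ^ 3| * (2 * s ^ 3) / (2 * s ^ 3) ^ 2 := by
        rw [div_sub_one hs₃.ne', abs_div, abs_of_pos hs₃]
        field_simp
    _ ≤ C * s ^ 2 / (2 * s ^ 3) ^ 2 := by gcongr
    _ = C * s⁻¹ ^ 4 / 4 := by field_simp; norm_num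
    _ ≤ C * s⁻¹ ^ 4 := div_le_self hC (by norm_num)

lemma abs_inv_sq_sub_inv_sq_le {x ρ K : ℝ} (hx : 0 < x) (hρ : |ρ - x| ≤ 1 / 2 * x)
    (hK : |ρ - x| ≤ K * x ^ 5) : |(ρ ^ 2)⁻¹ - (x ^ 2)⁻¹| ≤ 12 * K * x ^ 2 := by
  obtain ⟨hlower, hupper⟩ := abs_le.1 hρ
  have hρ₀ : 0 < ρ := by linarith
  have hfrac : (ρ + x) / (ρ ^ 2 * x ^ 2) ≤ 12 / x ^ 3 := by
    rw [div_le_div_iff₀ (by positivity) (by positivity)]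
    calc (ρ + x) * x ^ 3 ≤ 3 * x * x ^ 3 := by gcongr; linarith
      _ = 12 * ((x / 2) ^ 2 * x ^ 2) := by ring
      _ ≤ 12 * (ρ ^ 2 * x ^ 2) := by gcongr; linarith
  calc |(ρ ^ 2)⁻¹ - (x ^ 2)⁻¹| = |ρ - x| * ((ρ + x) / (ρ ^ 2 * x ^ 2)) := by
        rw [← abs_of_pos (by positivity : 0 < (ρ + x) / (ρ ^ 2 * x ^ 2)), ← abs_mul,
          abs_sub_comm]
        congr 1
        field_simp
        ring
    _ ≤ K * x ^ 5 * (12 / x ^ 3) := by gcongr; exact (abs_nonneg _).trans hK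
    _ = 12 * K * x ^ 2 := by field_simp

lemma BlowUp.exists_inv_sqrt_deriv_bound (h : BlowUp U V S T) : ∃ c > S, ∃ C ≥ 0, ∃ q : ℝ → ℝ,
    ∀ t ∈ Ioo S c, 0 < U t ∧ HasDerivAt (fun t => (√(U t))⁻¹) (q t) t ∧
      |q t - 1| ≤ C * (√(U t))⁻¹ ^ 4 := by
  obtain ⟨c, hc, C, hC, hbound⟩ := h.exists_energy_bound
  refine ⟨c, hc.1, C, hC, fun t => -V t / (2 * √(U t) ^ 3), fun t ht => ?_⟩
  obtain ⟨hV, hU, hQ⟩ := hbound t ht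
  have hU₀ : 0 < U t := by linarith
  have hsqrt : 0 < √(U t) := Real.sqrt_pos.2 hU₀
  refine ⟨hU₀, ?_, abs_neg_div_sub_one_le hsqrt hV (by rwa [Real.sq_sqrt hU₀.le])⟩
  refine (((h.sol t ⟨ht.1, ht.2.trans hc.2⟩).1.sqrt hU₀.ne').inv hsqrt.ne').congr_deriv ?_
  field_simp

theorem BlowUp.tendsto_sub_left (h : BlowUp U V S T) :
    Tendsto (fun t => U t - ((t - S) ^ 2)⁻¹) (𝓝[>] S) (𝓝 0) := by
  obtain ⟨c₀, hc₀, C, hC, q, hq⟩ := h.exists_inv_sqrt_deriv_bound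
  set ρ : ℝ → ℝ := fun t => (√(U t))⁻¹
  have hρ : Tendsto ρ (𝓝[>] S) (𝓝 0) :=
    tendsto_inv_atTop_zero.comp (Real.tendsto_sqrt_atTop.comp h.left)
  have hρ₄ : Tendsto (fun t => C * ρ t ^ 4) (𝓝[>] S) (𝓝 0) := by
    simpa using (hρ.pow 4).const_mul C
  obtain ⟨c, hSc, hc⟩ := mem_nhdsGT_iff_exists_Ioo_subset.1
    ((hρ₄.eventually_le_const one_half_pos).and (Ioo_mem_nhdsGT hc₀))
  have hderiv : ∀ t ∈ Ioo S c, HasDerivAt ρ (q t) t := fun t ht => (hq t (hc ht).2).2.1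
  have hlin : ∀ t ∈ Ioo S c, |ρ t - (t - S)| ≤ 1 / 2 * (t - S) := fun t ht => by
    simpa using abs_sub_le_mul_pow_of_hasDerivAt (K := 1 / 2) (n := 0) hderiv hρ
      (fun x hx => by simpa using (hq x (hc hx).2).2.2.trans (hc hx).1) ht
  have hq₄ : ∀ t ∈ Ioo S c, |q t - 1| ≤ 16 * C * (t - S) ^ 4 := fun t ht => by
    have hρt : 0 ≤ ρ t := inv_nonneg.2 (Real.sqrt_nonneg _)
    calc |q t - 1| ≤ C * ρ t ^ 4 := (hq t (hc ht).2).2.2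
      _ ≤ C * (2 * (t - S)) ^ 4 := by
        gcongr
        linarith [(abs_le.1 (hlin t ht)).2, ht.1]
      _ = 16 * C * (t - S) ^ 4 := by ring
  have hclose : ∀ t ∈ Ioo S c, |U t - ((t - S) ^ 2)⁻¹| ≤ 12 * (16 * C) * (t - S) ^ 2 :=
    fun t ht => by
      have hU : U t = (ρ t ^ 2)⁻¹ := by
        rw [inv_pow, inv_inv, Real.sq_sqrt (hq t (hc ht).2).1.le]
      rw [hU]
      exact abs_inv_sq_sub_inv_sq_le (sub_pos.2 ht.1) (hlin t ht)
        (abs_sub_le_mul_pow_of_hasDerivAt hderiv hρ hq₄ ht)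
  refine squeeze_zero_norm' (a := fun t => 12 * (16 * C) * (t - S) ^ 2) ?_ ?_
  · filter_upwards [Ioo_mem_nhdsGT hSc] with t ht using hclose t ht
  · simpa using (tendsto_sub_pow_nhdsGT S 1).const_mul (12 * (16 * C))

lemma BlowUp.tendsto_diff_left (h₁ : BlowUp U₁ V₁ S T₁) (h₂ : BlowUp U₂ V₂ S T₂) :
    Tendsto (fun t => U₂ t - U₁ t) (𝓝[>] S) (𝓝 0) := by
  simpa using h₂.tendsto_sub_left.sub h₁.tendsto_sub_left

lemma BlowUp.tendsto_diff_right (h₁ : BlowUp U₁ V₁ S₁ T) (h₂ : BlowUp U₂ V₂ S₂ T) :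
    Tendsto (fun t => U₂ t - U₁ t) (𝓝[<] T) (𝓝 0) := by
  simpa [Function.comp_def] using
    (h₁.reflect.tendsto_diff_left h₂.reflect).comp (tendsto_neg_nhdsLT (a := T))

end Asymptotics

section Ordering

variable {g U V U₁ V₁ U₂ V₂ : ℝ → ℝ} {s : Set ℝ} {S S₁ S₂ T T₁ T₂ b c k t τ τ₁ τ₂ : ℝ}

lemma BlowUp.strictMonoOn_snd (h : BlowUp U V S T) (hS : 0 ≤ S) : StrictMonoOn V (Ioo S T) :=
  strictMonoOn_of_hasDerivAt_pos (fun t ht => (h.sol t ht).2) fun t ht => by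
    have : 0 < |t| := abs_pos_of_pos (hS.trans_lt (interior_subset ht).1)
    positivity

lemma BlowUp.fst_lt_of_lt (h : BlowUp U V S T) (hS : 0 ≤ S) (hτ : τ ∈ Ioo S T) (hV : V τ = 0)
    (hτt : τ < t) (ht : t < T) : U τ < U t :=
  have hsub : Icc τ t ⊆ Ioo S T := Icc_subset_Ioo hτ.1 ht
  lt_of_hasDerivAt_pos hτt (fun x hx => (h.sol x (hsub hx)).1) fun _ hx =>
    hV ▸ h.strictMonoOn_snd hS hτ (hsub (Ioo_subset_Icc_self hx)) hx.1

lemma BlowUp.monotoneOn_fst (h : BlowUp U V S T) (hτ : τ ∈ Ioo S T) (hV : V τ = 0) :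
    MonotoneOn U (Ico τ T) := fun _ ha _ hb hab =>
  (h.sol.mono (Icc_subset_Ioo hτ.1 hb.2)).monotoneOn_fst (fun _ _ => abs_nonneg _) hV.ge
    ⟨ha.1, hab⟩ ⟨hb.1, le_rfl⟩ hab

lemma BlowUp.antitoneOn_fst (h : BlowUp U V S T) (hτ : τ ∈ Ioo S T) (hV : V τ = 0) :
    AntitoneOn U (Ioc S τ) := fun a ha b hb hab => by
  simpa using h.reflect.monotoneOn_fst (neg_mem_Ioo_neg hτ) (by simpa)
    (a := -b) (b := -a) ⟨neg_le_neg hb.2, neg_lt_neg hb.1⟩ ⟨neg_le_neg ha.2, neg_lt_neg ha.1⟩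
    (neg_le_neg hab)

lemma BlowUp.min_le (h : BlowUp U V S T) (hτ : τ ∈ Ioo S T) (hV : V τ = 0) (ht : t ∈ Ioo S T) :
    U τ ≤ U t := by
  rcases le_total τ t with hle | hle
  · exact h.monotoneOn_fst hτ hV ⟨le_rfl, hτ.2⟩ ⟨hle, ht.2⟩ hle
  · exact h.antitoneOn_fst hτ hV ⟨ht.1, hle⟩ ⟨hτ.1, le_rfl⟩ hle

/-- Twice the energy of a solution of `U'' = 6 U ^ 2 + k`. It is used along solutions of
`U'' = 6 U ^ 2 + t`, both for a fixed `k` and for `k = t`. -/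
def energy (k : ℝ) (U V : ℝ → ℝ) (t : ℝ) : ℝ := V t ^ 2 - 4 * U t ^ 3 - 2 * k * U t

lemma SolvesSystem.hasDerivAt_energy (h : SolvesSystem abs U V s) (ht : t ∈ s) (ht₀ : 0 ≤ t) :
    HasDerivAt (energy k U V) (2 * ((t - k) * V t)) t := by
  obtain ⟨hU, hV⟩ := h t ht
  refine (((hV.pow 2).sub ((hU.pow 3).const_mul 4)).sub (hU.const_mul (2 * k))).congr_deriv ?_
  rw [abs_of_nonneg ht₀]
  norm_num
  ring

lemma SolvesSystem.hasDerivAt_energy_self (h : SolvesSystem abs U V s) (ht : t ∈ s)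
    (ht₀ : 0 ≤ t) : HasDerivAt (fun x => energy x U V x) (-(2 * U t)) t := by
  obtain ⟨hU, hV⟩ := h t ht
  refine (((hV.pow 2).sub ((hU.pow 3).const_mul 4)).sub
    (((hasDerivAt_id t).const_mul 2).mul hU)).congr_deriv ?_
  rw [abs_of_nonneg ht₀]
  norm_num
  ring

lemma energy_le_energy (hk : 0 ≤ k) (hU : U₁ t ≤ U₂ t) (hV : V₁ t ≤ V₂ t)
    (hV₀ : V₁ t + V₂ t ≤ 0) : energy k U₂ V₂ t ≤ energy k U₁ V₁ t := by
  have hdiff : energy k U₁ V₁ t - energy k U₂ V₂ t = -(V₁ t + V₂ t) * (V₂ t - V₁ t) +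
      (4 * (U₁ t ^ 2 + U₁ t * U₂ t + U₂ t ^ 2) + 2 * k) * (U₂ t - U₁ t) := by
    simp only [energy]
    ring
  have hquad : 0 ≤ U₁ t ^ 2 + U₁ t * U₂ t + U₂ t ^ 2 := by
    nlinarith [sq_nonneg (U₁ t + U₂ t), sq_nonneg (U₁ t), sq_nonneg (U₂ t)]
  have hV_term := mul_nonneg (neg_nonneg.2 hV₀) (sub_nonneg.2 hV)
  have hU_term : 0 ≤ (4 * (U₁ t ^ 2 + U₁ t * U₂ t + U₂ t ^ 2) + 2 * k) * (U₂ t - U₁ t) :=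
    mul_nonneg (by positivity) (sub_nonneg.2 hU)
  linarith

lemma BlowUp.exists_snd_lt_snd (h₁ : BlowUp U₁ V₁ S T₁) (h₂ : BlowUp U₂ V₂ S T₂) (hc : S < c)
    (hc₁ : c < T₁) (hc₂ : c < T₂) (hlt : U₁ c < U₂ c) : ∃ ξ ∈ Ioo S c, V₁ ξ < V₂ ξ := by
  obtain ⟨x, hx, hxI⟩ := (((h₁.tendsto_diff_left h₂).eventually_lt_const
    (sub_pos.2 hlt)).and (Ioo_mem_nhdsGT hc)).exists
  have hderiv : ∀ y ∈ Icc x c, HasDerivAt (fun y => U₂ y - U₁ y) (V₂ y - V₁ y) y := fun y hy =>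
    (h₂.sol y (Icc_subset_Ioo hxI.1 hc₂ hy)).1.sub (h₁.sol y (Icc_subset_Ioo hxI.1 hc₁ hy)).1
  obtain ⟨ξ, hξ, hslope⟩ := exists_hasDerivAt_eq_slope (fun y => U₂ y - U₁ y)
    (fun y => V₂ y - V₁ y) hxI.2 (fun y hy => (hderiv y hy).continuousAt.continuousWithinAt)
    fun y hy => hderiv y (Ioo_subset_Icc_self hy)
  exact ⟨ξ, ⟨hxI.1.trans hξ.1, hξ.2⟩,
    sub_pos.1 (hslope ▸ div_pos (sub_pos.2 hx) (sub_pos.2 hxI.2))⟩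

theorem BlowUp.energy_lt_energy (hS : 0 ≤ S) (h₁ : BlowUp U₁ V₁ S T₁) (h₂ : BlowUp U₂ V₂ S T₂)
    (hb : S < b) (hb₁ : b < T₁) (hb₂ : b < T₂) (hlt : ∀ x ∈ Ioo S b, U₁ x < U₂ x) :
    energy b U₂ V₂ b < energy b U₁ V₁ b := by
  obtain ⟨c₁, hc₁, hneg₁⟩ := h₁.exists_snd_neg_one_le_fst
  obtain ⟨c₂, hc₂, hneg₂⟩ := h₂.exists_snd_neg_one_le_fst
  obtain ⟨c, hSc, hc⟩ := exists_between (lt_min (lt_min hc₁.1 hc₂.1) hb)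
  obtain ⟨⟨hcc₁, hcc₂⟩, hcb⟩ := (lt_min_iff.1 hc).imp_left lt_min_iff.1
  obtain ⟨ξ, hξ, hVξ⟩ := h₁.exists_snd_lt_snd h₂ hSc (hcb.trans hb₁) (hcb.trans hb₂)
    (hlt c ⟨hSc, hcb⟩)
  have hξb : ξ < b := hξ.2.trans hcb
  have hstart : energy ξ U₂ V₂ ξ ≤ energy ξ U₁ V₁ ξ := by
    refine energy_le_energy (hS.trans hξ.1.le) (hlt ξ ⟨hξ.1, hξb⟩).le hVξ.le ?_
    linarith [(hneg₁ ξ ⟨hξ.1, (hξ.2.trans hcc₁).le⟩).1, (hneg₂ ξ ⟨hξ.1, (hξ.2.trans hcc₂).le⟩).1]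
  have hgrow := lt_of_hasDerivAt_pos (f := fun t => energy t U₁ V₁ t - energy t U₂ V₂ t) hξb
    (fun t ht => (h₁.sol.hasDerivAt_energy_self (Icc_subset_Ioo hξ.1 hb₁ ht)
      (hS.trans (hξ.1.le.trans ht.1))).sub (h₂.sol.hasDerivAt_energy_self
      (Icc_subset_Ioo hξ.1 hb₂ ht) (hS.trans (hξ.1.le.trans ht.1)))) fun t ht => by
    linarith [hlt t ⟨hξ.1.trans ht.1, ht.2⟩]
  linarith

lemma BlowUp.abs_snd_lt_of_crossing (hS : 0 ≤ S) (h₁ : BlowUp U₁ V₁ S T₁)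
    (h₂ : BlowUp U₂ V₂ S T₂) (hb : S < b) (hb₁ : b < T₁) (hb₂ : b < T₂)
    (hlt : ∀ x ∈ Ioo S b, U₁ x < U₂ x) (heq : U₁ b = U₂ b) : |V₂ b| < V₁ b := by
  have henergy := h₁.energy_lt_energy hS h₂ hb hb₁ hb₂ hlt
  have hslope := nonpos_of_hasDerivAt_of_pos_left hb (f := fun y => U₂ y - U₁ y)
    ((h₂.sol b ⟨hb, hb₂⟩).1.sub (h₁.sol b ⟨hb, hb₁⟩).1) (fun x hx => sub_pos.2 (hlt x hx))
    (sub_eq_zero.2 heq.symm)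
  have hsq : V₂ b ^ 2 < V₁ b ^ 2 := by
    simp only [energy, heq] at henergy
    linarith
  rw [sq_lt_sq] at hsq
  rcases abs_cases (V₁ b) with h | h <;> linarith [neg_abs_le (V₂ b), le_abs_self (V₂ b)]

lemma BlowUp.right_le_of_le (h₁ : BlowUp U₁ V₁ S₁ T₁) (h₂ : BlowUp U₂ V₂ S₂ T₂)
    (hc₁ : c ∈ Ioo S₁ T₁) (hc₂ : c ∈ Ioo S₂ T₂)
    (hle : ∀ x ∈ Ioo c (min T₁ T₂), U₁ x ≤ U₂ x) : T₂ ≤ T₁ := by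
  by_contra! hT
  rw [min_eq_left hT.le] at hle
  refine not_tendsto_atTop_of_continuousAt (l := 𝓝[<] T₁) nhdsWithin_le_nhds
    (h₂.sol T₁ ⟨hc₂.1.trans hc₁.2, hT⟩).1.continuousAt (tendsto_atTop_mono' _ ?_ h₁.right)
  filter_upwards [Ioo_mem_nhdsLT hc₁.2] with x hx using hle x hx

lemma SolvesSystem.monotoneOn_sub_mul_sub [s.OrdConnected] (h₁ : SolvesSystem g U₁ V₁ s)
    (h₂ : SolvesSystem g U₂ V₂ s) (hU : ∀ t ∈ s, 0 ≤ U₁ t + U₂ t) :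
    MonotoneOn (fun t => (U₂ t - U₁ t) * (V₂ t - V₁ t)) s := by
  refine monotoneOn_of_hasDerivAt_nonneg (fun t ht =>
    ((h₂ t ht).1.sub (h₁ t ht).1).mul ((h₂ t ht).2.sub (h₁ t ht).2)) fun t ht => ?_
  have := hU t ht
  calc 0 ≤ (V₂ t - V₁ t) ^ 2 + 6 * (U₁ t + U₂ t) * (U₂ t - U₁ t) ^ 2 := by positivity
    _ = _ := by simp only [Pi.sub_apply]; ring

lemma BlowUp.eq_of_eq_right (h₁ : BlowUp U₁ V₁ S T₁) (h₂ : BlowUp U₂ V₂ S T₂) (hb : S < b)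
    (hb₁ : b < T₁) (hb₂ : b < T₂) (hU : ∀ t ∈ Ioc S b, 0 ≤ U₁ t + U₂ t) (heq : U₁ b = U₂ b)
    (ht : t ∈ Ioo S b) : U₁ t = U₂ t := by
  have hsol₁ := h₁.sol.mono (Ioc_subset_Ioo_right hb₁)
  have hsol₂ := h₂.sol.mono (Ioc_subset_Ioo_right hb₂)
  have hprod : ∀ x ∈ Ioc S b, (U₂ x - U₁ x) * (V₂ x - V₁ x) ≤ 0 := fun x hx => by
    simpa [heq] using hsol₁.monotoneOn_sub_mul_sub hsol₂ hU hx ⟨hb, le_rfl⟩ hx.2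
  have hmono : MonotoneOn (fun x => -(U₂ x - U₁ x) ^ 2) (Ioc S b) := by
    refine monotoneOn_of_hasDerivAt_nonneg
      (f' := fun x => -(2 * ((U₂ x - U₁ x) * (V₂ x - V₁ x))))
      (fun x hx => (((hsol₂ x hx).1.sub (hsol₁ x hx).1).pow 2).neg.congr_deriv ?_)
      fun x hx => by linarith [hprod x hx]
    norm_num
    ring
  have hlim : Tendsto (fun x => -(U₂ x - U₁ x) ^ 2) (𝓝[>] S) (𝓝 0) := by
    simpa using ((h₁.tendsto_diff_left h₂).pow 2).neg
  have hzero : 0 ≤ -(U₂ t - U₁ t) ^ 2 := by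
    refine le_of_tendsto hlim ?_
    filter_upwards [Ioo_mem_nhdsGT ht.1] with x hx
    exact hmono ⟨hx.1, (hx.2.trans ht.2).le⟩ ⟨ht.1, ht.2.le⟩ hx.2.le
  exact (sub_eq_zero.1 (pow_eq_zero_iff two_ne_zero |>.1
    (le_antisymm (neg_nonneg.1 hzero) (sq_nonneg _)))).symm

lemma BlowUp.eqOn_of_eq (h₁ : BlowUp U₁ V₁ S T₁) (h₂ : BlowUp U₂ V₂ S T₂) (hb : S < b)
    (hb₁ : b < T₁) (hb₂ : b < T₂) (hU : ∀ t ∈ Ioc S b, 0 ≤ U₁ t + U₂ t) (heq : U₁ b = U₂ b) :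
    T₁ = T₂ ∧ ∀ t ∈ Ioo S T₁, U₁ t = U₂ t ∧ V₁ t = V₂ t := by
  obtain ⟨y, hy⟩ := exists_between hb
  have hy₁ : y ∈ Ioo S T₁ := ⟨hy.1, hy.2.trans hb₁⟩
  have hy₂ : y ∈ Ioo S T₂ := ⟨hy.1, hy.2.trans hb₂⟩
  have hUeq : U₁ =ᶠ[𝓝 y] U₂ := by
    filter_upwards [isOpen_Ioo.mem_nhds hy] with x hx
    exact h₁.eq_of_eq_right h₂ hb hb₁ hb₂ hU heq hx
  have hVeq : V₁ y = V₂ y := (h₁.sol y hy₁).1.unique ((h₂.sol y hy₂).1.congr_of_eventuallyEq hUeq)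
  have hT := h₁.right_unique h₂ hy₁ hy₂ hUeq.eq_of_nhds hVeq
  subst hT
  exact ⟨rfl, fun t ht => h₁.sol.eqOn h₂.sol hy₁ hUeq.eq_of_nhds hVeq ht⟩

theorem BlowUp.trichotomy (h₁ : BlowUp U₁ V₁ S T₁) (h₂ : BlowUp U₂ V₂ S T₂) :
    (∀ᶠ t in 𝓝[>] S, U₁ t < U₂ t) ∨ (∀ᶠ t in 𝓝[>] S, U₂ t < U₁ t) ∨
      T₁ = T₂ ∧ ∀ t ∈ Ioo S T₁, U₁ t = U₂ t ∧ V₁ t = V₂ t := by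
  obtain ⟨c₁, hc₁, hpos₁⟩ := h₁.exists_snd_neg_one_le_fst
  obtain ⟨c₂, hc₂, hpos₂⟩ := h₂.exists_snd_neg_one_le_fst
  set c := min c₁ c₂
  have hSc : S < c := lt_min hc₁.1 hc₂.1
  have hcT₁ : c < T₁ := (min_le_left _ _).trans_lt hc₁.2
  have hcT₂ : c < T₂ := (min_le_right _ _).trans_lt hc₂.2
  by_cases! hzero : ∃ z ∈ Ioo S c, U₁ z = U₂ z
  · obtain ⟨z, hz, heq⟩ := hzero
    refine Or.inr (Or.inr (h₁.eqOn_of_eq h₂ hz.1 (hz.2.trans hcT₁) (hz.2.trans hcT₂)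
      (fun t ht => ?_) heq))
    have htc : t ≤ c := ht.2.trans hz.2.le
    linarith [(hpos₁ t ⟨ht.1, htc.trans (min_le_left _ _)⟩).2,
      (hpos₂ t ⟨ht.1, htc.trans (min_le_right _ _)⟩).2]
  have hcont : ContinuousOn (fun t => U₂ t - U₁ t) (Ioo S c) :=
    (h₂.sol.mono (Ioo_subset_Ioo_right hcT₂.le)).continuousOn_fst.sub
      (h₁.sol.mono (Ioo_subset_Ioo_right hcT₁.le)).continuousOn_fst
  by_cases! hlt : ∀ t ∈ Ioo S c, U₁ t < U₂ t
  · exact Or.inl (mem_of_superset (Ioo_mem_nhdsGT hSc) hlt)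
  refine Or.inr (Or.inl (mem_of_superset (Ioo_mem_nhdsGT hSc) fun y hy => ?_))
  obtain ⟨x, hx, hxle⟩ := hlt
  by_contra hyle
  obtain ⟨w, hw, hw₀⟩ := isPreconnected_Ioo.intermediate_value hx hy hcont
    (show (0 : ℝ) ∈ Icc _ _ from ⟨sub_nonpos.2 hxle, sub_nonneg.2 (not_lt.1 hyle)⟩)
  exact hzero w hw (sub_eq_zero.1 hw₀).symm

lemma BlowUp.antitoneOn_energy (h : BlowUp U V S T) (hS : 0 ≤ S) (hτ : τ ∈ Ioo S T)
    (hV : V τ = 0) (hk : k ∈ Ioo S T) : AntitoneOn (energy k U V) (uIcc τ k) := by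
  have hsub : uIcc τ k ⊆ Ioo S T := ordConnected_Ioo.uIcc_subset hτ hk
  refine fun x hx y hy hxy => neg_le_neg_iff.1 (monotoneOn_of_hasDerivAt_nonneg
    (f := fun t => -energy k U V t) (fun t ht => (h.sol.hasDerivAt_energy (hsub ht)
      (hS.trans (hsub ht).1.le)).neg) (fun t ht => ?_) hx hy hxy)
  rcases mem_uIcc.1 ht with ⟨hτt, htk⟩ | ⟨hkt, htτ⟩
  · nlinarith [hV ▸ h.monotoneOn_snd hτ (hsub ht) hτt]
  · nlinarith [hV ▸ h.monotoneOn_snd (hsub ht) hτ htτ]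

lemma BlowUp.monotoneOn_energy (h : BlowUp U V S T) (hS : 0 ≤ S) (hτ : τ ∈ Ioo S T)
    (hV : V τ = 0) : MonotoneOn (energy τ U V) (Ioo S T) := by
  refine monotoneOn_of_hasDerivAt_nonneg
    (fun t ht => h.sol.hasDerivAt_energy ht (hS.trans ht.1.le)) fun t ht => ?_
  rcases le_total τ t with hτt | htτ
  · nlinarith [hV ▸ h.monotoneOn_snd hτ ht hτt]
  · nlinarith [hV ▸ h.monotoneOn_snd ht hτ htτ]

lemma BlowUp.energy_min_lt (h : BlowUp U V S T) (hS : 0 ≤ S) (hτ : τ ∈ Ioo S T)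
    (hV : V τ = 0) (hτt : τ < t) (ht : t < T) : energy τ U V τ < energy τ U V t := by
  have hsub : Icc τ t ⊆ Ioo S T := Icc_subset_Ioo hτ.1 ht
  refine lt_of_hasDerivAt_pos hτt
    (fun x hx => h.sol.hasDerivAt_energy (hsub hx) (hS.trans (hsub hx).1.le)) fun x hx => ?_
  have hVx := h.strictMonoOn_snd hS hτ (hsub (Ioo_subset_Icc_self hx)) hx.1
  rw [hV] at hVx
  have := mul_pos (sub_pos.2 hx.1) hVx
  positivity

lemma BlowUp.min_lt_min_of_crossing (hS : 0 ≤ S) (h₁ : BlowUp U₁ V₁ S T₁)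
    (h₂ : BlowUp U₂ V₂ S T₂) (hτ₁ : τ₁ ∈ Ioo S T₁) (hτ₂ : τ₂ ∈ Ioo S T₂) (hV₁ : V₁ τ₁ = 0)
    (hV₂ : V₂ τ₂ = 0) (hb₁ : b ∈ Ioo S T₁) (hbτ : b < τ₂) (heq : U₁ b = U₂ b)
    (hV : |V₂ b| < V₁ b) : U₁ τ₁ < U₂ τ₂ := by
  have hb₂ : b ∈ Ioo S T₂ := ⟨hb₁.1, hbτ.trans hτ₂.2⟩
  have hτb : τ₁ < b := ((h₁.strictMonoOn_snd hS).lt_iff_lt hτ₁ hb₁).1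
    (hV₁ ▸ (abs_nonneg _).trans_lt hV)
  have henergy₁ := h₁.antitoneOn_energy hS hτ₁ hV₁ hb₁ left_mem_uIcc right_mem_uIcc hτb.le
  have henergy₂ := h₂.antitoneOn_energy hS hτ₂ hV₂ hb₂ right_mem_uIcc left_mem_uIcc hbτ.le
  simp only [energy, hV₁, hV₂, heq] at henergy₁ henergy₂
  have hsq : V₂ b ^ 2 < V₁ b ^ 2 := sq_lt_sq.2 (hV.trans_le (le_abs_self _))
  by_contra! hle
  have hcube : U₂ τ₂ ^ 3 ≤ U₁ τ₁ ^ 3 := (Odd.strictMono_pow (by decide)).monotone hle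
  have hlinear : b * U₂ τ₂ ≤ b * U₁ τ₁ := mul_le_mul_of_nonneg_left hle (hS.trans hb₁.1.le)
  linarith

theorem BlowUp.min_lt_min (hS : 0 ≤ S) (h₁ : BlowUp U₁ V₁ S T₁) (h₂ : BlowUp U₂ V₂ S T₂)
    (hτ₁ : τ₁ ∈ Ioo S T₁) (hτ₂ : τ₂ ∈ Ioo S T₂) (hV₁ : V₁ τ₁ = 0) (hV₂ : V₂ τ₂ = 0)
    (hlt : ∀ᶠ t in 𝓝[>] S, U₁ t < U₂ t) : U₁ τ₁ < U₂ τ₂ := by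
  rcases exists_first_crossing
    (h₁.sol.continuousOn_fst.mono (Ioo_subset_Ioo_right (min_le_left T₁ T₂)))
    (h₂.sol.continuousOn_fst.mono (Ioo_subset_Ioo_right (min_le_right T₁ T₂))) hlt
    with hall | ⟨b, hb, heq, hlt'⟩
  · obtain ⟨c, hSc, hc⟩ := exists_between (lt_min h₁.lt h₂.lt)
    have hT : T₂ ≤ T₁ := h₁.right_le_of_le h₂ ⟨hSc, (lt_min_iff.1 hc).1⟩
      ⟨hSc, (lt_min_iff.1 hc).2⟩ fun x hx => (hall x ⟨hSc.trans hx.1, hx.2⟩).le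
    rw [min_eq_right hT] at hall
    exact (h₁.min_le hτ₁ hV₁ ⟨hτ₂.1, hτ₂.2.trans_le hT⟩).trans_lt (hall τ₂ hτ₂)
  obtain ⟨hb₁, hb₂⟩ := lt_min_iff.1 hb.2
  have hVb := h₁.abs_snd_lt_of_crossing hS h₂ hb.1 hb₁ hb₂ hlt' heq
  rcases lt_trichotomy τ₂ b with hτb | rfl | hbτ
  · exact (h₁.min_le hτ₁ hV₁ ⟨hτ₂.1, hτb.trans hb₁⟩).trans_lt (hlt' τ₂ ⟨hτ₂.1, hτb⟩)
  · rw [← heq]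
    exact h₁.fst_lt_of_lt hS hτ₁ hV₁ (((h₁.strictMonoOn_snd hS).lt_iff_lt hτ₁ ⟨hb.1, hb₁⟩).1
      (hV₁ ▸ (abs_nonneg _).trans_lt hVb)) hb₁
  · exact h₁.min_lt_min_of_crossing hS h₂ hτ₁ hτ₂ hV₁ hV₂ ⟨hb.1, hb₁⟩ hbτ heq hVb

lemma BlowUp.reflected_lt (h : BlowUp U V S T) (hS : 0 ≤ S) (hτ : τ ∈ Ioo S T) (hV : V τ = 0)
    {δ : ℝ} (hδ : 0 < δ) (ht : t ∈ Ico (τ + δ) (2 * τ + δ - S)) (htT : t < T) :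
    U (2 * τ + δ - t) < U t := by
  have hmem : ∀ x ∈ Icc (τ + δ) t, x ∈ Ioo S T ∧ 2 * τ + δ - x ∈ Ioo S T := fun x hx =>
    ⟨⟨by linarith [hx.1, hτ.1], hx.2.trans_lt htT⟩,
      ⟨by linarith [hx.2, ht.2], by linarith [hx.1, hτ.2]⟩⟩
  have hderiv : ∀ x ∈ Icc (τ + δ) t, HasDerivAt (fun x => U x - U (2 * τ + δ - x))
      (V x - -V (2 * τ + δ - x)) x := fun x hx =>
    (h.sol x (hmem x hx).1).1.sub ((h.sol _ (hmem x hx).2).1.comp_const_sub _ x)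
  have hstart : 0 < U (τ + δ) - U (2 * τ + δ - (τ + δ)) := by
    rw [show 2 * τ + δ - (τ + δ) = τ by ring, sub_pos]
    exact h.fst_lt_of_lt hS hτ hV (lt_add_of_pos_right τ hδ) (ht.1.trans_lt htT)
  by_contra! hle
  obtain ⟨z, hz, hzero, hpos⟩ := exists_first_zero (f := fun x => U x - U (2 * τ + δ - x)) ht.1
    (fun x hx => (hderiv x hx).continuousAt.continuousWithinAt) hstart (sub_nonpos.2 hle)
  obtain ⟨hzI, hσI⟩ := hmem z (Ioc_subset_Icc_self hz)
  have hslope := nonpos_of_hasDerivAt_of_pos_left hz.1 (hderiv z (Ioc_subset_Icc_self hz))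
    (fun x hx => hpos x (Ioo_subset_Ico_self hx)) hzero
  have hτz : τ < z := by linarith [hz.1]
  have hVz := h.strictMonoOn_snd hS hτ hzI hτz
  have henergy := (h.monotoneOn_energy hS hτ hV hσI hτ (by linarith [hz.1])).trans_lt
    (h.energy_min_lt hS hτ hV hτz hzI.2)
  simp only [energy, ← sub_eq_zero.1 hzero] at henergy
  nlinarith

theorem BlowUp.right_sub_min_le (h : BlowUp U V S T) (hS : 0 ≤ S) (hτ : τ ∈ Ioo S T)
    (hV : V τ = 0) : T - τ ≤ τ - S := by
  by_contra! hlt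
  obtain ⟨δ, hδ, hδT⟩ := exists_between (sub_pos.2 hlt)
  set b := 2 * τ + δ - S with hb
  have hbI : b ∈ Ioo S T := ⟨by linarith [hτ.1], by linarith⟩
  refine not_tendsto_atTop_of_continuousAt (l := 𝓝[<] b) nhdsWithin_le_nhds
    (h.sol b hbI).1.continuousAt ?_
  have hlim : Tendsto (fun x => 2 * τ + δ - x) (𝓝[<] b) (𝓝[>] S) := by
    refine tendsto_nhdsWithin_iff.2 ⟨?_, ?_⟩
    · have : Tendsto (fun x => 2 * τ + δ - x) (𝓝 b) (𝓝 (2 * τ + δ - b)) :=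
        Continuous.tendsto (by fun_prop) _
      rw [hb, sub_sub_cancel] at this
      exact this.mono_left nhdsWithin_le_nhds
    · filter_upwards [self_mem_nhdsWithin] with x hx
      exact mem_Ioi.2 (lt_sub_comm.1 (mem_Iio.1 hx))
  refine tendsto_atTop_mono' _ ?_ (h.left.comp hlim)
  filter_upwards [Ioo_mem_nhdsLT (show τ + δ < b by linarith [hτ.1])] with x hx
  exact (h.reflected_lt hS hτ hV hδ ⟨hx.1.le, hx.2⟩ (hx.2.trans hbI.2)).le

end Ordering

section Sturm

variable {D D' D'' φ φ' φ'' : ℝ → ℝ} {a b t x T : ℝ}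

/-- The Wronskian `φ D' - φ' D`, where `φ'` and `D'` stand for the derivatives of `φ` and `D`. -/
def wronskian (φ φ' D D' : ℝ → ℝ) (t : ℝ) : ℝ := φ t * D' t - φ' t * D t

lemma hasDerivAt_wronskian (hφ : HasDerivAt φ (φ' t) t) (hφ' : HasDerivAt φ' (φ'' t) t)
    (hD : HasDerivAt D (D' t) t) (hD' : HasDerivAt D' (D'' t) t) :
    HasDerivAt (wronskian φ φ' D D') (φ t * D'' t - φ'' t * D t) t :=
  ((hφ.mul hD').sub (hφ'.mul hD)).congr_deriv (by ring)

lemma hasDerivAt_div_wronskian (hφ : HasDerivAt φ (φ' t) t) (hD : HasDerivAt D (D' t) t)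
    (hne : φ t ≠ 0) :
    HasDerivAt (fun x => D x / φ x) (wronskian φ φ' D D' t / φ t ^ 2) t :=
  (hD.div hφ hne).congr_deriv (by rw [wronskian]; ring)

lemma nonneg_of_wronskian_nonneg (hab : a ≤ b) (hφ : ∀ t ∈ Icc a b, HasDerivAt φ (φ' t) t)
    (hD : ∀ t ∈ Icc a b, HasDerivAt D (D' t) t) (hpos : ∀ t ∈ Icc a b, 0 < φ t)
    (hW : ∀ t ∈ Icc a b, 0 ≤ wronskian φ φ' D D' t) (ha : 0 ≤ D a) : 0 ≤ D b := by
  have hquot := le_of_hasDerivAt_nonneg hab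
    (fun t ht => hasDerivAt_div_wronskian (hφ t ht) (hD t ht) (hpos t ht).ne')
    fun t ht => div_nonneg (hW t ht) (sq_nonneg _)
  have hquot_b := (div_nonneg ha (hpos a ⟨le_rfl, hab⟩).le).trans hquot
  simpa [(hpos b ⟨hab, le_rfl⟩).ne'] using mul_nonneg hquot_b (hpos b ⟨hab, le_rfl⟩).le

theorem wronskian_pos_of_mul_le (hφ : ∀ t ∈ Ico b T, HasDerivAt φ (φ' t) t)
    (hφ' : ∀ t ∈ Ico b T, HasDerivAt φ' (φ'' t) t) (hD : ∀ t ∈ Ico b T, HasDerivAt D (D' t) t)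
    (hD' : ∀ t ∈ Ico b T, HasDerivAt D' (D'' t) t) (hpos : ∀ t ∈ Ico b T, 0 < φ t)
    (hle : ∀ t ∈ Ico b T, 0 ≤ D t → φ'' t * D t ≤ φ t * D'' t) (hDb : D b = 0) (hD'b : 0 < D' b)
    (ht : t ∈ Ico b T) : 0 < wronskian φ φ' D D' t := by
  have hsub : Icc b t ⊆ Ico b T := Icc_subset_Ico_right ht.2
  have hW : ∀ x ∈ Ico b T, HasDerivAt (wronskian φ φ' D D') (φ x * D'' x - φ'' x * D x) x :=
    fun x hx => hasDerivAt_wronskian (hφ x hx) (hφ' x hx) (hD x hx) (hD' x hx)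
  have hWb : 0 < wronskian φ φ' D D' b := by
    simpa [wronskian, hDb] using mul_pos (hpos b (hsub ⟨le_rfl, ht.1⟩)) hD'b
  by_contra! hWt
  obtain ⟨z, hz, hWz, hWpos⟩ := exists_first_zero ht.1
    (fun y hy => (hW y (hsub hy)).continuousAt.continuousWithinAt) hWb hWt
  have hzsub : Icc b z ⊆ Ico b T := (Icc_subset_Icc_right hz.2).trans hsub
  have hWnonneg : ∀ y ∈ Icc b z, 0 ≤ wronskian φ φ' D D' y := fun y hy => by
    rcases hy.2.lt_or_eq with hyz | rfl
    exacts [(hWpos y ⟨hy.1, hyz⟩).le, hWz.ge]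
  have hDnonneg : ∀ y ∈ Icc b z, 0 ≤ D y := fun y hy => by
    have hysub : Icc b y ⊆ Icc b z := Icc_subset_Icc_right hy.2
    exact nonneg_of_wronskian_nonneg hy.1 (fun x hx => hφ x (hzsub (hysub hx)))
      (fun x hx => hD x (hzsub (hysub hx))) (fun x hx => hpos x (hzsub (hysub hx)))
      (fun x hx => hWnonneg x (hysub hx)) hDb.ge
  have hWmono := le_of_hasDerivAt_nonneg hz.1.le (fun y hy => hW y (hzsub hy))
    fun y hy => sub_nonneg.2 (hle y (hzsub hy) (hDnonneg y hy))
  linarith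

theorem exists_pos_mul_le_of_mul_le (hφ : ∀ t ∈ Ico b T, HasDerivAt φ (φ' t) t)
    (hφ' : ∀ t ∈ Ico b T, HasDerivAt φ' (φ'' t) t) (hD : ∀ t ∈ Ico b T, HasDerivAt D (D' t) t)
    (hD' : ∀ t ∈ Ico b T, HasDerivAt D' (D'' t) t) (hpos : ∀ t ∈ Ico b T, 0 < φ t)
    (hle : ∀ t ∈ Ico b T, 0 ≤ D t → φ'' t * D t ≤ φ t * D'' t) (hDb : D b = 0) (hD'b : 0 < D' b)
    (hx : x ∈ Ioo b T) : ∃ r > 0, ∀ t ∈ Ico x T, r * φ t ≤ D t := by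
  have hmono : StrictMonoOn (fun t => D t / φ t) (Ico b T) :=
    strictMonoOn_of_hasDerivAt_pos
      (fun t ht => hasDerivAt_div_wronskian (hφ t ht) (hD t ht) (hpos t ht).ne') fun t ht =>
      div_pos (wronskian_pos_of_mul_le hφ hφ' hD hD' hpos hle hDb hD'b (interior_subset ht))
        (pow_pos (hpos t (interior_subset ht)) 2)
  have hxI : x ∈ Ico b T := Ioo_subset_Ico_self hx
  refine ⟨D x / φ x, ?_, fun t ht => ?_⟩
  · simpa [hDb] using hmono ⟨le_rfl, hx.1.trans hx.2⟩ hxI hx.1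
  · have htI : t ∈ Ico b T := ⟨hx.1.le.trans ht.1, ht.2⟩
    rw [← le_div_iff₀ (hpos t htI)]
    exact hmono.monotoneOn hxI htI ht.1

lemma nonneg_deriv_deriv_of_isLocalMin (hφ : ∀ᶠ t in 𝓝 a, HasDerivAt φ (φ' t) t)
    (hφ' : HasDerivAt φ' x a) (hmin : IsLocalMin φ a) : 0 ≤ x := by
  by_contra! hx
  have hderiv : deriv φ =ᶠ[𝓝 a] φ' := hφ.mono fun t ht => ht.deriv
  have hmax : IsLocalMax φ a := isLocalMax_of_deriv_deriv_neg
    (by rwa [hderiv.deriv_eq, hφ'.deriv]) hmin.deriv_eq_zero hφ.self_of_nhds.continuousAt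
  have hconst : φ =ᶠ[𝓝 a] fun _ => φ a := by
    filter_upwards [hmin, hmax] with t h₁ h₂ using le_antisymm h₂ h₁
  have hzero : deriv φ =ᶠ[𝓝 a] fun _ => 0 := by
    simpa using hconst.deriv
  have : x = 0 := by rw [← hφ'.deriv, ← hderiv.deriv_eq, hzero.deriv_eq, deriv_const]
  exact hx.ne this

end Sturm

section Crossing

variable {U V U₁ V₁ U₂ V₂ : ℝ → ℝ} {S T T₁ T₂ a b t τ τ₁ τ₂ B : ℝ}

/-- For `U'' = 6 U ^ 2 + t`, a combination of the scaling field and the translation field. It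
satisfies the linearized equation `ψ'' = 12 U ψ` up to the term `-5 (t - b)`, so it is a
supersolution of it to the right of `b`. -/
def scalingField (U V : ℝ → ℝ) (b t : ℝ) : ℝ := (5 * b - t) * V t - 2 * U t

/-- The derivative of `scalingField U V b` along solutions of `U'' = 6 U ^ 2 + t`. -/
def scalingFieldDeriv (U V : ℝ → ℝ) (b t : ℝ) : ℝ := (5 * b - t) * (6 * U t ^ 2 + t) - 3 * V t

lemma BlowUp.hasDerivAt_scalingField (h : BlowUp U V S T) (hS : 0 ≤ S) (ht : t ∈ Ioo S T) :
    HasDerivAt (scalingField U V b) (scalingFieldDeriv U V b t) t := by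
  obtain ⟨hU, hV⟩ := h.sol t ht
  rw [abs_of_nonneg (hS.trans ht.1.le)] at hV
  exact ((((hasDerivAt_id t).const_sub (5 * b)).mul hV).sub (hU.const_mul 2)).congr_deriv
    (by simp only [scalingFieldDeriv, id]; ring)

lemma BlowUp.hasDerivAt_scalingFieldDeriv (h : BlowUp U V S T) (hS : 0 ≤ S)
    (ht : t ∈ Ioo S T) : HasDerivAt (scalingFieldDeriv U V b)
      (12 * U t * scalingField U V b t - 5 * (t - b)) t := by
  obtain ⟨hU, hV⟩ := h.sol t ht
  rw [abs_of_nonneg (hS.trans ht.1.le)] at hV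
  refine ((((hasDerivAt_id t).const_sub (5 * b)).mul (((hU.pow 2).const_mul 6).add
    (hasDerivAt_id t))).sub (hV.const_mul 3)).congr_deriv ?_
  simp [scalingField]
  ring

lemma BlowUp.right_le_two_mul (h : BlowUp U V S T) (hS : 0 ≤ S) (hb : b ∈ Ioo S T)
    (hV : 0 ≤ V b) : T ≤ 2 * b := by
  obtain ⟨τ, hτ, hVτ⟩ := h.exists_snd_eq_zero
  have hτb : τ ≤ b := ((h.strictMonoOn_snd hS).le_iff_le hτ hb).1 (hVτ ▸ hV)
  linarith [h.right_sub_min_le hS hτ hVτ]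

lemma BlowUp.snd_nonneg_of_le (h : BlowUp U V S T) (hb : b ∈ Ioo S T) (hV : 0 ≤ V b)
    (ht : t ∈ Ico b T) : 0 ≤ V t :=
  hV.trans (h.monotoneOn_snd hb ⟨hb.1.trans_le ht.1, ht.2⟩ ht.1)

lemma BlowUp.fst_le_mul_snd (h : BlowUp U V S T) (hS : 0 ≤ S) (hb : b ∈ Ioo S T) (hV : 0 ≤ V b)
    (hU : U b ≤ 0) (ht : t ∈ Ico b T) (hUt : 1 / b ^ 2 ≤ U t) : U t ≤ b * V t := by
  have hb₀ : 0 < b := hS.trans_lt hb.1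
  have hUt₀ : 0 ≤ U t := le_trans (by positivity) hUt
  have henergy := (h.sol.mono (Icc_subset_Ioo hb.1 ht.2)).energy_le ht.1
    (fun _ _ => abs_nonneg _) hV
  have hUb : U b ^ 3 ≤ 0 := (Odd.pow_nonpos_iff (by decide)).2 hU
  have hVt : 4 * U t ^ 3 ≤ V t ^ 2 := by linarith [sq_nonneg (V b)]
  have hUb_sq : 1 ≤ b ^ 2 * U t := by rwa [div_le_iff₀' (by positivity)] at hUt
  refine abs_le_of_sq_le_sq' ?_ (mul_nonneg hb₀.le (h.snd_nonneg_of_le hb hV ht)) |>.2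
  calc U t ^ 2 ≤ U t ^ 2 * (b ^ 2 * U t) := le_mul_of_one_le_right (sq_nonneg _) hUb_sq
    _ = b ^ 2 * U t ^ 3 := by ring
    _ ≤ b ^ 2 * V t ^ 2 :=
      mul_le_mul_of_nonneg_left (by linarith [pow_nonneg hUt₀ 3]) (sq_nonneg b)
    _ = (b * V t) ^ 2 := by ring

lemma BlowUp.eventually_one_le_scalingField (h : BlowUp U V S T) (hS : 0 ≤ S)
    (hb : b ∈ Ioo S T) (hV : 0 ≤ V b) (hU : U b ≤ 0) :
    ∀ᶠ t in 𝓝[<] T, 1 ≤ scalingField U V b t := by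
  have hT := h.right_le_two_mul hS hb hV
  filter_upwards [h.right.eventually_ge_atTop 1, h.right.eventually_ge_atTop (1 / b ^ 2),
    Ioo_mem_nhdsLT hb.2] with t hUt hUt' ht
  have htI : t ∈ Ico b T := Ioo_subset_Ico_self ht
  have hUV := h.fst_le_mul_snd hS hb hV hU htI hUt'
  have hcoeff : 3 * b * V t ≤ (5 * b - t) * V t :=
    mul_le_mul_of_nonneg_right (by linarith [ht.2]) (h.snd_nonneg_of_le hb hV htI)
  rw [scalingField]
  linarith

lemma BlowUp.scalingField_pos_of_neg (h : BlowUp U V S T) (hS : 0 ≤ S) (hb : b ∈ Ioo S T)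
    (hV : 0 ≤ V b) (ht : t ∈ Ico b T) (hU : U t < 0) : 0 < scalingField U V b t := by
  have hcoeff : 0 ≤ 5 * b - t := by
    linarith [h.right_le_two_mul hS hb hV, ht.2, hS.trans hb.1.le]
  have := mul_nonneg hcoeff (h.snd_nonneg_of_le hb hV ht)
  rw [scalingField]
  linarith

theorem BlowUp.scalingField_pos (h : BlowUp U V S T) (hS : 0 ≤ S) (hb : b ∈ Ioo S T)
    (hV : 0 ≤ V b) (hU : U b < 0) (ht : t ∈ Ico b T) : 0 < scalingField U V b t := by
  have hmem : Ico b T ⊆ Ioo S T := Ico_subset_Ioo_left hb.1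
  by_contra! hle
  obtain ⟨c, hc, htc, hcT⟩ := ((h.eventually_one_le_scalingField hS hb hV hU.le).and
    (Ioo_mem_nhdsLT ht.2)).exists
  have hsub : Icc b c ⊆ Ico b T := Icc_subset_Ico_right hcT
  obtain ⟨x, hx, hmin⟩ := isCompact_Icc.exists_isMinOn (nonempty_Icc.2 (ht.1.trans htc.le))
    fun y hy => (h.hasDerivAt_scalingField (b := b) hS
      (hmem (hsub hy))).continuousAt.continuousWithinAt
  have hxle : scalingField U V b x ≤ 0 := (hmin ⟨ht.1, htc.le⟩).trans hle
  have hxb : b < x := hx.1.lt_of_ne' <| by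
    rintro rfl
    exact hxle.not_gt (h.scalingField_pos_of_neg hS hb hV ⟨le_rfl, hb.2⟩ hU)
  have hxc : x < c := hx.2.lt_of_ne <| by
    rintro rfl
    linarith
  have hUx : 0 ≤ U x := not_lt.1 fun hUx =>
    hxle.not_gt (h.scalingField_pos_of_neg hS hb hV (hsub hx) hUx)
  have hsecond := nonneg_deriv_deriv_of_isLocalMin
    (eventually_of_mem (isOpen_Ioo.mem_nhds (hmem (hsub hx)))
      fun y hy => h.hasDerivAt_scalingField hS hy)
    (h.hasDerivAt_scalingFieldDeriv hS (hmem (hsub hx)))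
    (hmin.isLocalMin (Icc_mem_nhds hxb hxc))
  nlinarith [mul_nonneg hUx (neg_nonneg.2 hxle)]

lemma BlowUp.exists_supersolution (h : BlowUp U V S T) (hS : 0 ≤ S) (hb : b ∈ Ioo S T)
    (hV : 0 ≤ V b) : ∃ φ φ' φ'' : ℝ → ℝ, (∀ᶠ t in 𝓝[<] T, 1 ≤ φ t) ∧ ∀ t ∈ Ico b T,
      HasDerivAt φ (φ' t) t ∧ HasDerivAt φ' (φ'' t) t ∧ 0 < φ t ∧ φ'' t ≤ 12 * U t * φ t := by
  have hmem : Ico b T ⊆ Ioo S T := Ico_subset_Ioo_left hb.1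
  rcases lt_or_ge (U b) 0 with hneg | hnonneg
  · exact ⟨scalingField U V b, scalingFieldDeriv U V b,
      fun t => 12 * U t * scalingField U V b t - 5 * (t - b),
      h.eventually_one_le_scalingField hS hb hV hneg.le, fun t ht =>
      ⟨h.hasDerivAt_scalingField hS (hmem ht), h.hasDerivAt_scalingFieldDeriv hS (hmem ht),
        h.scalingField_pos hS hb hV hneg ht, by linarith [ht.1]⟩⟩
  · refine ⟨fun _ => 1, fun _ => 0, fun _ => 0, Eventually.of_forall fun _ => le_rfl,
      fun t ht => ⟨hasDerivAt_const t 1, hasDerivAt_const t 0, one_pos, ?_⟩⟩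
    have hUt : U b ≤ U t := (h.sol.mono (Icc_subset_Ioo hb.1 ht.2)).monotoneOn_fst
      (fun _ _ => abs_nonneg _) hV ⟨le_rfl, ht.1⟩ ⟨ht.1, le_rfl⟩ ht.1
    linarith

/-- Sturm comparison: `U₁ - U₂` stays above a multiple of a supersolution of the linearization at
`U₂` that does not vanish at the blow-up point, whereas `U₁ - U₂` would tend to `0` if the
blow-up points agreed. -/
theorem BlowUp.right_lt_of_crossing (hS : 0 ≤ S) (h₁ : BlowUp U₁ V₁ S T₁)
    (h₂ : BlowUp U₂ V₂ S T₂) (hb₁ : b ∈ Ioo S T₁) (hb₂ : b ∈ Ioo S T₂) (heq : U₁ b = U₂ b)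
    (hV₂ : 0 ≤ V₂ b) (hV : V₂ b < V₁ b) : T₁ < T₂ := by
  by_contra! hT
  have hsol₁ := h₁.sol.mono ((Ico_subset_Ico_right hT).trans (Ico_subset_Ioo_left hb₁.1))
  have hsol₂ := h₂.sol.mono (Ico_subset_Ioo_left hb₂.1)
  obtain ⟨φ, φ', φ'', hφ_end, hφ⟩ := h₂.exists_supersolution hS hb₂ hV₂
  obtain ⟨x, hx⟩ := exists_between hb₂.2
  obtain ⟨r, hr, hle⟩ := exists_pos_mul_le_of_mul_le (D := fun t => U₁ t - U₂ t)
    (D' := fun t => V₁ t - V₂ t) (D'' := fun t => 6 * U₁ t ^ 2 + |t| - (6 * U₂ t ^ 2 + |t|))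
    (fun t ht => (hφ t ht).1) (fun t ht => (hφ t ht).2.1)
    (fun t ht => (hsol₁ t ht).1.sub (hsol₂ t ht).1)
    (fun t ht => (hsol₁ t ht).2.sub (hsol₂ t ht).2) (fun t ht => (hφ t ht).2.2.1)
    (fun t ht hD => by
      have hlin := mul_le_mul_of_nonneg_right (hφ t ht).2.2.2 hD
      have hquad := mul_nonneg (hφ t ht).2.2.1.le (sq_nonneg (U₁ t - U₂ t))
      linarith)
    (sub_eq_zero.2 heq) (sub_pos.2 hV) hx
  have hlt : ∀ t ∈ Ico x T₂, U₂ t < U₁ t := fun t ht => sub_pos.1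
    ((mul_pos hr (hφ t ⟨hx.1.le.trans ht.1, ht.2⟩).2.2.1).trans_le (hle t ht))
  have hT' : T₁ ≤ T₂ := h₂.right_le_of_le h₁ ⟨hb₂.1.trans hx.1, hx.2⟩
    ⟨hb₁.1.trans hx.1, hx.2.trans_le hT⟩
    fun y hy => (hlt y ⟨hy.1.le, hy.2.trans_le (min_le_left _ _)⟩).le
  obtain rfl : T₁ = T₂ := le_antisymm hT' hT
  refine hr.not_ge (ge_of_tendsto (h₂.tendsto_diff_right h₁) ?_)
  filter_upwards [hφ_end, Ico_mem_nhdsLT hx.2] with t hφt ht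
  exact (le_mul_of_one_le_right hr.le hφt).trans (hle t ht)

lemma SolvesSystem.snd_sub_le (h : SolvesSystem abs U V (Icc a b)) (ha : 0 ≤ a) (hab : a ≤ b)
    (hU : ∀ t ∈ Icc a b, |U t| ≤ B) : V b - V a ≤ (6 * B ^ 2 + b) * (b - a) := by
  have := le_of_hasDerivAt_nonneg (f := fun t => (6 * B ^ 2 + b) * t - V t) hab
    (fun t ht => ((hasDerivAt_id t).const_mul _).sub (h t ht).2) fun t ht => by
      have hsq := sq_le_sq' (abs_le.1 (hU t ht)).1 (abs_le.1 (hU t ht)).2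
      rw [abs_of_nonneg (ha.trans ht.1)]
      linarith [ht.2]
  linarith

lemma SolvesSystem.energy_sub_le_of_crossing (h₁ : SolvesSystem abs U₁ V₁ (Icc a b))
    (h₂ : SolvesSystem abs U₂ V₂ (Icc a b)) (ha : 0 ≤ a) (hab : a ≤ b) (hB : 0 ≤ B)
    (hBU : ∀ t ∈ Icc a b, -B ≤ U₁ t) (hle : ∀ t ∈ Icc a b, U₁ t ≤ U₂ t) (heq : U₁ b = U₂ b) :
    (6 * B * (b - a) ^ 2 + 1) * (energy a U₁ V₁ a - energy a U₂ V₂ a) ≤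
      (V₂ b - V₁ b) * (b - a) ^ 2 +
        (6 * B * (b - a) ^ 2 + 1) * (energy b U₁ V₁ b - energy b U₂ V₂ b) := by
  set C := 6 * B * (b - a) ^ 2 + 1 with hC
  have hsq : ∀ t, HasDerivAt (fun x => (x - a) ^ 2) (2 * (t - a)) t := fun t => by
    simpa using! ((hasDerivAt_id t).sub_const a).pow 2
  have hlin : ∀ t, HasDerivAt (fun x => 2 * (x - a)) 2 t := fun t => by
    simpa using! ((hasDerivAt_id t).sub_const a).const_mul 2
  have hW : ∀ t ∈ Icc a b, HasDerivAt (wronskian (fun x => (x - a) ^ 2) (fun x => 2 * (x - a))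
      (fun x => U₂ x - U₁ x) (fun x => V₂ x - V₁ x))
      ((t - a) ^ 2 * (6 * U₂ t ^ 2 + |t| - (6 * U₁ t ^ 2 + |t|)) - 2 * (U₂ t - U₁ t)) t :=
    fun t ht => hasDerivAt_wronskian (φ'' := fun _ => 2)
      (D'' := fun x => 6 * U₂ x ^ 2 + |x| - (6 * U₁ x ^ 2 + |x|)) (hsq t) (hlin t)
      ((h₂ t ht).1.sub (h₁ t ht).1) ((h₂ t ht).2.sub (h₁ t ht).2)
  have hmono := le_of_hasDerivAt_nonneg hab
    (fun t ht => (hW t ht).add (((h₁.hasDerivAt_energy_self ht (ha.trans ht.1)).sub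
      (h₂.hasDerivAt_energy_self ht (ha.trans ht.1))).const_mul C)) fun t ht => by
      have hsum : -(2 * B) ≤ U₁ t + U₂ t := by linarith [hBU t ht, hle t ht]
      have hta : (t - a) ^ 2 ≤ (b - a) ^ 2 :=
        pow_le_pow_left₀ (sub_nonneg.2 ht.1) (sub_le_sub_right ht.2 a) 2
      have hcoeff : 0 ≤ 6 * (U₁ t + U₂ t) * (t - a) ^ 2 - 2 + 2 * C := by
        nlinarith [mul_le_mul_of_nonneg_right hsum (sq_nonneg (t - a)),
          mul_le_mul_of_nonneg_left hta hB, hC]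
      calc 0 ≤ (U₂ t - U₁ t) * (6 * (U₁ t + U₂ t) * (t - a) ^ 2 - 2 + 2 * C) :=
            mul_nonneg (sub_nonneg.2 (hle t ht)) hcoeff
        _ = _ := by ring
  simp only [Pi.add_apply, Pi.sub_apply, wronskian, heq, sub_self, mul_zero, zero_mul, sub_zero,
    ne_eq, OfNat.ofNat_ne_zero, not_false_eq_true, zero_pow, zero_add] at hmono
  linarith

lemma BlowUp.snd_nonneg_of_crossing (hS : 0 ≤ S) (h₁ : BlowUp U₁ V₁ S T₁)
    (h₂ : BlowUp U₂ V₂ S T₂) (ha : S < a) (hab : a ≤ b) (hb₁ : b < T₁) (hb₂ : b < T₂)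
    (hB : 0 ≤ B) (hBU : ∀ t ∈ Icc a b, -B ≤ U₁ t) (hlt : ∀ t ∈ Ioo S b, U₁ t < U₂ t)
    (heq : U₁ b = U₂ b)
    (hV : (6 * B * (b - a) ^ 2 + 1) * (V₁ b - V₂ b) ≤ (b - a) ^ 2) : 0 ≤ V₂ b := by
  have hle : ∀ t ∈ Icc a b, U₁ t ≤ U₂ t := fun t ht => by
    rcases ht.2.lt_or_eq with htb | rfl
    exacts [(hlt t ⟨ha.trans_le ht.1, htb⟩).le, heq.le]
  have hSb : S < b := ha.trans_le hab
  have hδ : 0 < V₁ b - V₂ b := by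
    linarith [h₁.abs_snd_lt_of_crossing hS h₂ hSb hb₁ hb₂ hlt heq, le_abs_self (V₂ b)]
  have hmono := (h₁.sol.mono (Icc_subset_Ioo ha hb₁)).energy_sub_le_of_crossing
    (h₂.sol.mono (Icc_subset_Ioo ha hb₂)) (hS.trans ha.le) hab hB hBU hle heq
  have henergy_a := h₁.energy_lt_energy hS h₂ ha (hab.trans_lt hb₁) (hab.trans_lt hb₂)
    fun t ht => hlt t ⟨ht.1, ht.2.trans_le hab⟩
  have henergy_b : energy b U₁ V₁ b - energy b U₂ V₂ b = (V₁ b - V₂ b) * (V₁ b + V₂ b) := by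
    simp only [energy, heq]
    ring
  have hC : 0 < 6 * B * (b - a) ^ 2 + 1 := by positivity
  have hpos := mul_pos hC (sub_pos.2 henergy_a)
  rw [henergy_b] at hmono
  by_contra! hneg
  nlinarith [mul_le_mul_of_nonneg_left hV hδ.le, mul_pos hC (mul_pos hδ (neg_pos.2 hneg))]

lemma BlowUp.snd_crossing_sub_le (hS : 0 ≤ S) (h₁ : BlowUp U₁ V₁ S T₁)
    (h₂ : BlowUp U₂ V₂ S T₂) (hτ₁ : τ₁ ∈ Ioo S T₁) (hτ₂ : τ₂ ∈ Ioo S T₂) (hV₁ : V₁ τ₁ = 0)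
    (hV₂ : V₂ τ₂ = 0) (hτ₁b : τ₁ ≤ b) (hbτ₂ : b ≤ τ₂) (hb₁ : b < T₁)
    (hU₁ : ∀ t ∈ Icc τ₁ b, |U₁ t| ≤ B) (hU₂ : ∀ t ∈ Icc b τ₂, |U₂ t| ≤ B) :
    V₁ b - V₂ b ≤ (6 * B ^ 2 + τ₂) * (τ₂ - τ₁) := by
  have hSb : S < b := hτ₁.1.trans_le hτ₁b
  have hleft := (h₁.sol.mono (Icc_subset_Ioo hτ₁.1 hb₁)).snd_sub_le (hS.trans hτ₁.1.le) hτ₁b hU₁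
  have hright := (h₂.sol.mono (Icc_subset_Ioo hSb hτ₂.2)).snd_sub_le (hS.trans hSb.le) hbτ₂ hU₂
  have hcoeff : (6 * B ^ 2 + b) * (b - τ₁) ≤ (6 * B ^ 2 + τ₂) * (b - τ₁) :=
    mul_le_mul_of_nonneg_right (by linarith) (sub_nonneg.2 hτ₁b)
  linarith

lemma BlowUp.snd_nonneg_of_crossing_of_le (hS : 0 ≤ S) (h₁ : BlowUp U₁ V₁ S T₁)
    (h₂ : BlowUp U₂ V₂ S T₂) (hτ₁ : τ₁ ∈ Ioo S T₁) (hτ₂ : τ₂ ∈ Ioo S T₂) (hV₁ : V₁ τ₁ = 0)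
    (hV₂ : V₂ τ₂ = 0) (ha : S < a) (haτ₂ : a < τ₂) (haτ₁ : (τ₂ - a) / 2 ≤ τ₁ - a) (hB : 0 ≤ B)
    (hB₁ : -B ≤ U₁ τ₁) (hB₂ : -B ≤ U₂ τ₂) (hUB : ∀ t ∈ Icc a τ₂, U₂ t ≤ B)
    (hclose : (6 * B * (τ₂ - a) ^ 2 + 1) * ((6 * B ^ 2 + τ₂) * (τ₂ - τ₁)) ≤ ((τ₂ - a) / 2) ^ 2)
    (hb₁ : b ∈ Ioo S T₁) (hb₂ : b < T₂) (heq : U₁ b = U₂ b) (hlt : ∀ t ∈ Ioo S b, U₁ t < U₂ t) :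
    0 ≤ V₂ b := by
  by_contra! hVb
  have hVabs := h₁.abs_snd_lt_of_crossing hS h₂ hb₁.1 hb₁.2 hb₂ hlt heq
  have hbτ₂ : b < τ₂ :=
    ((h₂.strictMonoOn_snd hS).lt_iff_lt ⟨hb₁.1, hb₂⟩ hτ₂).1 (hV₂ ▸ hVb)
  have hτ₁b : τ₁ < b :=
    ((h₁.strictMonoOn_snd hS).lt_iff_lt hτ₁ hb₁).1 (hV₁ ▸ (abs_nonneg _).trans_lt hVabs)
  have haτ₁' : a ≤ τ₁ := by linarith
  have hge₁ : ∀ t ∈ Ioo S T₁, -B ≤ U₁ t := fun t ht => hB₁.trans (h₁.min_le hτ₁ hV₁ ht)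
  have hle₁ : ∀ t ∈ Ioc S b, U₁ t ≤ U₂ t := fun t ht => by
    rcases ht.2.lt_or_eq with htb | rfl
    exacts [(hlt t ⟨ht.1, htb⟩).le, heq.le]
  have hV : V₁ b - V₂ b ≤ (6 * B ^ 2 + τ₂) * (τ₂ - τ₁) :=
    h₁.snd_crossing_sub_le hS h₂ hτ₁ hτ₂ hV₁ hV₂ hτ₁b.le hbτ₂.le hb₁.2
      (fun t ht => abs_le.2 ⟨hge₁ t (Icc_subset_Ioo hτ₁.1 hb₁.2 ht),
        (hle₁ t ⟨hτ₁.1.trans_le ht.1, ht.2⟩).trans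
          (hUB t ⟨haτ₁'.trans ht.1, ht.2.trans hbτ₂.le⟩)⟩)
      fun t ht => abs_le.2 ⟨hB₂.trans (h₂.min_le hτ₂ hV₂ (Icc_subset_Ioo hb₁.1 hτ₂.2 ht)),
        hUB t ⟨(haτ₁'.trans hτ₁b.le).trans ht.1, ht.2⟩⟩
  refine hVb.not_ge (h₁.snd_nonneg_of_crossing hS h₂ ha (haτ₁'.trans hτ₁b.le) hb₁.2 hb₂ hB
    (fun t ht => hge₁ t (Icc_subset_Ioo ha hb₁.2 ht)) hlt heq ?_)
  have hVpos : 0 ≤ V₁ b - V₂ b := by linarith [abs_nonneg (V₂ b)]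
  calc (6 * B * (b - a) ^ 2 + 1) * (V₁ b - V₂ b)
      ≤ (6 * B * (τ₂ - a) ^ 2 + 1) * ((6 * B ^ 2 + τ₂) * (τ₂ - τ₁)) := by
        have : 0 ≤ b - a := by linarith
        gcongr
    _ ≤ ((τ₂ - a) / 2) ^ 2 := hclose
    _ ≤ (b - a) ^ 2 := pow_le_pow_left₀ (by linarith) (by linarith) 2

theorem BlowUp.exists_snd_nonneg_of_crossing (h : BlowUp U V S T) (hS : 0 ≤ S)
    (hτ : τ ∈ Ioo S T) (hV : V τ = 0) : ∃ ε > 0, ∀ {U₁ V₁ : ℝ → ℝ} {T₁ τ₁ b : ℝ},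
      BlowUp U₁ V₁ S T₁ → τ₁ ∈ Ioo S T₁ → V₁ τ₁ = 0 → |τ₁ - τ| < ε → U τ - 1 ≤ U₁ τ₁ →
      b ∈ Ioo S T₁ → b < T → U₁ b = U b → (∀ t ∈ Ioo S b, U₁ t < U t) → 0 ≤ V b := by
  obtain ⟨a, haS, haτ⟩ := exists_between hτ.1
  have : 0 < τ - a := sub_pos.2 haτ
  have hτ₀ : 0 < τ := hS.trans_lt hτ.1
  set B := max (|U τ| + 1) |U a|
  have hB : 0 ≤ B := (abs_nonneg _).trans (le_max_right _ _)
  have hτB : |U τ| + 1 ≤ B := le_max_left _ _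
  have hBτ : -B ≤ U τ - 1 := by linarith [neg_abs_le (U τ)]
  have hUB : ∀ t ∈ Icc a τ, U t ≤ B := fun t ht =>
    ((h.sol.convexOn_fst fun _ _ => abs_nonneg _).le_max_of_mem_Icc ⟨haS, haτ.trans hτ.2⟩ hτ
      ht).trans (max_le ((le_abs_self _).trans (le_max_right _ _))
      (by linarith [le_abs_self (U τ)]))
  have hCK : 0 < (6 * B * (τ - a) ^ 2 + 1) * (6 * B ^ 2 + τ) := by positivity
  refine ⟨min ((τ - a) / 2) (((τ - a) / 2) ^ 2 /
    ((6 * B * (τ - a) ^ 2 + 1) * (6 * B ^ 2 + τ))), by positivity,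
    fun h₁ hτ₁ hV₁ hclose hmin hb hbT heq hlt => ?_⟩
  obtain ⟨hclose_a, hclose_B⟩ := lt_min_iff.1 ((neg_le_abs _).trans_lt hclose)
  rw [lt_div_iff₀ hCK] at hclose_B
  exact h₁.snd_nonneg_of_crossing_of_le hS h hτ₁ hτ hV₁ hV haS haτ (by linarith) hB
    (hBτ.trans hmin) (hBτ.trans (sub_le_self _ zero_le_one)) hUB (by linarith) hb hbT heq hlt

end Crossing

section Consecutive

variable {g U V U₁ V₁ U₂ V₂ U₃ V₃ : ℝ → ℝ} {S S₁ S₂ T T₁ T₂ T₃ b τ τ₁ τ₂ : ℝ}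

theorem BlowUp.exists_eventually_snd_sub_mem_Icc (h₁ : BlowUp U₁ V₁ S T₁)
    (h₂ : BlowUp U₂ V₂ S T₂) (hlt : ∀ᶠ t in 𝓝[>] S, U₁ t < U₂ t) :
    ∃ M, ∀ᶠ t in 𝓝[>] S, V₂ t - V₁ t ∈ Icc 0 M := by
  obtain ⟨c, hc, hU⟩ := h₁.exists_snd_neg_one_le_fst
  have hev : ∀ᶠ t in 𝓝[>] S, t ∈ Ioo S c ∧ t ∈ Ioo S T₂ ∧ U₁ t < U₂ t := by
    filter_upwards [Ioo_mem_nhdsGT hc.1, Ioo_mem_nhdsGT h₂.lt, hlt] with t h1 h2 h3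
    exact ⟨h1, h2, h3⟩
  obtain ⟨x, hx, hsub⟩ := mem_nhdsGT_iff_exists_Ioc_subset.1 hev
  have hmono : MonotoneOn (fun t => V₂ t - V₁ t) (Ioc S x) := by
    refine monotoneOn_of_hasDerivAt_nonneg (fun t ht => ?_)
      (f' := fun t => 6 * U₂ t ^ 2 + |t| - (6 * U₁ t ^ 2 + |t|)) fun t ht => ?_
    · obtain ⟨htc, ht₂, -⟩ := hsub ht
      exact (h₂.sol t ht₂).2.sub (h₁.sol t ⟨ht.1, htc.2.trans hc.2⟩).2
    · obtain ⟨htc, -, hlt⟩ := hsub ht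
      have := (hU t (Ioo_subset_Ioc_self htc)).2
      nlinarith
  have hnonneg : ∀ t ∈ Ioc S x, 0 ≤ V₂ t - V₁ t := by
    intro t ht
    obtain ⟨htc, ht₂, hlt⟩ := hsub ht
    obtain ⟨ξ, hξ, hVξ⟩ := h₁.exists_snd_lt_snd h₂ ht.1 (htc.2.trans hc.2) ht₂.2 hlt
    exact (sub_pos.2 hVξ).le.trans (hmono ⟨hξ.1, hξ.2.le.trans ht.2⟩ ht hξ.2.le)
  refine ⟨V₂ x - V₁ x, ?_⟩
  filter_upwards [Ioc_mem_nhdsGT hx] with t ht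
  exact ⟨hnonneg t ht, hmono ht ⟨hx, le_rfl⟩ ht.2⟩

theorem BlowUp.exists_eventually_snd_sub_mem_Icc_right (h₁ : BlowUp U₁ V₁ S₁ T)
    (h₂ : BlowUp U₂ V₂ S₂ T) (hlt : ∀ᶠ t in 𝓝[<] T, U₁ t < U₂ t) :
    ∃ M, ∀ᶠ t in 𝓝[<] T, V₂ t - V₁ t ∈ Icc (-M) 0 := by
  obtain ⟨M, hM⟩ := h₁.reflect.exists_eventually_snd_sub_mem_Icc h₂.reflect
    (tendsto_neg_nhdsGT_neg.eventually hlt)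
  refine ⟨M, ?_⟩
  filter_upwards [tendsto_neg_nhdsLT.eventually hM] with t ht
  rw [neg_neg] at ht
  constructor <;> linarith [ht.1, ht.2]

theorem BlowUp.eq_of_min_eq (hS : 0 ≤ S) (h₁ : BlowUp U₁ V₁ S T₁) (h₂ : BlowUp U₂ V₂ S T₂)
    (hτ₁ : τ₁ ∈ Ioo S T₁) (hτ₂ : τ₂ ∈ Ioo S T₂) (hV₁ : V₁ τ₁ = 0) (hV₂ : V₂ τ₂ = 0)
    (hmin : U₁ τ₁ = U₂ τ₂) : τ₁ = τ₂ := by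
  rcases h₁.trichotomy h₂ with hlt | hlt | ⟨rfl, heq⟩
  · exact absurd hmin (min_lt_min hS h₁ h₂ hτ₁ hτ₂ hV₁ hV₂ hlt).ne
  · exact absurd hmin (min_lt_min hS h₂ h₁ hτ₂ hτ₁ hV₂ hV₁ hlt).ne'
  · exact (h₁.strictMonoOn_snd hS).injOn hτ₁ hτ₂ (by rw [hV₁, (heq τ₂ hτ₂).2, hV₂])

theorem BlowUp.eventually_lt_of_min_lt (hS : 0 ≤ S) (h₁ : BlowUp U₁ V₁ S T₁)
    (h₂ : BlowUp U₂ V₂ S T₂) (hτ₁ : τ₁ ∈ Ioo S T₁) (hτ₂ : τ₂ ∈ Ioo S T₂) (hV₁ : V₁ τ₁ = 0)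
    (hV₂ : V₂ τ₂ = 0) (hmin : U₁ τ₁ < U₂ τ₂) : ∀ᶠ t in 𝓝[>] S, U₁ t < U₂ t := by
  rcases h₁.trichotomy h₂ with hlt | hlt | ⟨rfl, heq⟩
  · exact hlt
  · exact absurd (min_lt_min hS h₂ h₁ hτ₂ hτ₁ hV₂ hV₁ hlt) hmin.not_gt
  · obtain rfl := (h₁.strictMonoOn_snd hS).injOn hτ₁ hτ₂ (by rw [hV₁, (heq τ₂ hτ₂).2, hV₂])
    exact absurd (heq τ₁ hτ₁).1 hmin.ne

theorem SolvesSystem.strictMonoOn_wronskian_sub {s : Set ℝ} [s.OrdConnected]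
    (h₁ : SolvesSystem g U₁ V₁ s) (h₂ : SolvesSystem g U₂ V₂ s) (h₃ : SolvesSystem g U₃ V₃ s)
    (h₁₂ : ∀ t ∈ interior s, U₁ t < U₂ t) (h₂₃ : ∀ t ∈ interior s, U₂ t < U₃ t) :
    StrictMonoOn (wronskian (U₂ - U₁) (V₂ - V₁) (U₃ - U₂) (V₃ - V₂)) s := by
  refine strictMonoOn_of_hasDerivAt_pos
    (f' := fun t => 6 * (U₂ t - U₁ t) * (U₃ t - U₂ t) * (U₃ t - U₁ t)) (fun t ht => ?_)
    fun t ht => ?_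
  · refine (hasDerivAt_wronskian (φ' := V₂ - V₁) (D' := V₃ - V₂)
      (φ'' := fun t => 6 * U₂ t ^ 2 + g t - (6 * U₁ t ^ 2 + g t))
      (D'' := fun t => 6 * U₃ t ^ 2 + g t - (6 * U₂ t ^ 2 + g t))
      ((h₂ t ht).1.sub (h₁ t ht).1) ((h₂ t ht).2.sub (h₁ t ht).2)
      ((h₃ t ht).1.sub (h₂ t ht).1) ((h₃ t ht).2.sub (h₂ t ht).2)).congr_deriv ?_
    simp only [Pi.sub_apply]
    ring
  · have := sub_pos.2 (h₁₂ t ht)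
    have := sub_pos.2 (h₂₃ t ht)
    have := sub_pos.2 ((h₁₂ t ht).trans (h₂₃ t ht))
    positivity

theorem BlowUp.strictMonoOn_wronskian_sub (h₁ : BlowUp U₁ V₁ S T₁) (h₂ : BlowUp U₂ V₂ S T₂)
    (h₃ : BlowUp U₃ V₃ S T₃) (hb₁ : b < T₁) (hb₂ : b < T₂) (hb₃ : b < T₃)
    (h₁₂ : ∀ t ∈ Ioo S b, U₁ t < U₂ t) (h₂₃ : ∀ t ∈ Ioo S b, U₂ t < U₃ t) :
    StrictMonoOn (wronskian (U₂ - U₁) (V₂ - V₁) (U₃ - U₂) (V₃ - V₂)) (Ioc S b) :=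
  (h₁.sol.mono fun _ ht => ⟨ht.1, ht.2.trans_lt hb₁⟩).strictMonoOn_wronskian_sub
    (h₂.sol.mono fun _ ht => ⟨ht.1, ht.2.trans_lt hb₂⟩)
    (h₃.sol.mono fun _ ht => ⟨ht.1, ht.2.trans_lt hb₃⟩)
    (by rwa [interior_Ioc]) (by rwa [interior_Ioc])

theorem BlowUp.wronskian_sub_pos (h₁ : BlowUp U₁ V₁ S T₁) (h₂ : BlowUp U₂ V₂ S T₂)
    (h₃ : BlowUp U₃ V₃ S T₃) (hb : S < b) (hb₁ : b < T₁) (hb₂ : b < T₂) (hb₃ : b < T₃)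
    (h₁₂ : ∀ t ∈ Ioo S b, U₁ t < U₂ t) (h₂₃ : ∀ t ∈ Ioo S b, U₂ t < U₃ t) :
    0 < wronskian (U₂ - U₁) (V₂ - V₁) (U₃ - U₂) (V₃ - V₂) b := by
  have hmono := h₁.strictMonoOn_wronskian_sub h₂ h₃ hb₁ hb₂ hb₃ h₁₂ h₂₃
  have hnear : ∀ᶠ t in 𝓝[>] S, t ∈ Ioo S b := Ioo_mem_nhdsGT hb
  obtain ⟨M, hM⟩ := h₁.exists_eventually_snd_sub_mem_Icc h₂ (hnear.mono h₁₂)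
  obtain ⟨_, hN⟩ := h₂.exists_eventually_snd_sub_mem_Icc h₃ (hnear.mono h₂₃)
  have hlim : Tendsto (fun t => -(M * (U₃ t - U₂ t))) (𝓝[>] S) (𝓝 0) := by
    simpa only [mul_zero, neg_zero] using ((h₂.tendsto_diff_left h₃).const_mul M).neg
  obtain ⟨x, hSx, hxb⟩ := exists_between hb
  refine lt_of_le_of_lt (le_of_tendsto hlim ?_) (hmono ⟨hSx, hxb.le⟩ ⟨hb, le_rfl⟩ hxb)
  filter_upwards [hM, hN, Ioo_mem_nhdsGT hSx] with t htM htN htx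
  have htb : t ∈ Ioo S b := ⟨htx.1, htx.2.trans hxb⟩
  calc -(M * (U₃ t - U₂ t))
      ≤ (U₂ t - U₁ t) * (V₃ t - V₂ t) - (V₂ t - V₁ t) * (U₃ t - U₂ t) := by
        linarith [mul_nonneg (sub_pos.2 (h₁₂ t htb)).le htN.1,
          mul_le_mul_of_nonneg_right htM.2 (sub_pos.2 (h₂₃ t htb)).le]
    _ ≤ wronskian (U₂ - U₁) (V₂ - V₁) (U₃ - U₂) (V₃ - V₂) x :=
        (hmono ⟨htb.1, htb.2.le⟩ ⟨hSx, hxb.le⟩ htx.2).le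

theorem BlowUp.lt_of_forall_snd_nonneg_of_crossing (hS : 0 ≤ S) (h₁ : BlowUp U₁ V₁ S T₁)
    (h₂ : BlowUp U₂ V₂ S T₂) (hT : T₂ ≤ T₁) (hlt : ∀ᶠ t in 𝓝[>] S, U₁ t < U₂ t)
    (hcross : ∀ b ∈ Ioo S T₂, U₁ b = U₂ b → (∀ t ∈ Ioo S b, U₁ t < U₂ t) → 0 ≤ V₂ b) :
    ∀ t ∈ Ioo S T₂, U₁ t < U₂ t := by
  refine (exists_first_crossing (h₁.sol.continuousOn_fst.mono (Ioo_subset_Ioo_right hT))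
    h₂.sol.continuousOn_fst hlt).resolve_right ?_
  rintro ⟨b, hb, heq, hltb⟩
  have hb₁ : b ∈ Ioo S T₁ := ⟨hb.1, hb.2.trans_le hT⟩
  have hV := abs_lt.1 (abs_snd_lt_of_crossing hS h₁ h₂ hb.1 hb₁.2 hb.2 hltb heq)
  exact absurd (right_lt_of_crossing hS h₁ h₂ hb₁ hb heq (hcross b hb heq hltb) hV.2) hT.not_gt

theorem BlowUp.lt_of_forall_lt (h₁ : BlowUp U₁ V₁ S T₁) (h₂ : BlowUp U₂ V₂ S T₂)
    (h₃ : BlowUp U₃ V₃ S T₃) (hT₁ : T₂ ≤ T₁) (hT₃ : T₂ ≤ T₃)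
    (h₁₂ : ∀ t ∈ Ioo S T₂, U₁ t < U₂ t) (hlt : ∀ᶠ t in 𝓝[>] S, U₂ t < U₃ t) :
    ∀ t ∈ Ioo S T₂, U₂ t < U₃ t := by
  refine (exists_first_crossing h₂.sol.continuousOn_fst
    (h₃.sol.continuousOn_fst.mono (Ioo_subset_Ioo_right hT₃)) hlt).resolve_right ?_
  rintro ⟨b, hb, heq, h₂₃⟩
  have hW := h₁.wronskian_sub_pos h₂ h₃ hb.1 (hb.2.trans_le hT₁) hb.2 (hb.2.trans_le hT₃)
    (fun t ht => h₁₂ t ⟨ht.1, ht.2.trans hb.2⟩) h₂₃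
  have hVb : V₃ b - V₂ b ≤ 0 := nonpos_of_hasDerivAt_of_pos_left hb.1
    ((h₃.sol b ⟨hb.1, hb.2.trans_le hT₃⟩).1.sub (h₂.sol b hb).1)
    (fun t ht => sub_pos.2 (h₂₃ t ht)) (sub_eq_zero.2 heq.symm)
  simp only [wronskian, Pi.sub_apply, heq, sub_self, mul_zero, sub_zero] at hW
  have := h₁₂ b hb
  nlinarith

theorem BlowUp.exists_eventually_neg_le_snd_sub (h₁ : BlowUp U₁ V₁ S T₁) (h₂ : BlowUp U₂ V₂ S T₂)
    (hT : T₂ ≤ T₁) (h₁₂ : ∀ t ∈ Ioo S T₂, U₁ t < U₂ t) :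
    ∃ M, ∀ᶠ t in 𝓝[<] T₂, -M ≤ V₂ t - V₁ t := by
  have hnear : ∀ᶠ t in 𝓝[<] T₂, t ∈ Ioo S T₂ := Ioo_mem_nhdsLT h₂.lt
  rcases hT.eq_or_lt with rfl | hT
  · obtain ⟨M, hM⟩ := h₁.exists_eventually_snd_sub_mem_Icc_right h₂ (hnear.mono h₁₂)
    exact ⟨M, hM.mono fun t ht => ht.1⟩
  · obtain ⟨τ, hτ, hVτ⟩ := h₂.exists_snd_eq_zero
    refine ⟨V₁ T₂, ?_⟩
    filter_upwards [Ioo_mem_nhdsLT hτ.2] with t ht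
    have ht₂ : t ∈ Ioo S T₂ := ⟨hτ.1.trans ht.1, ht.2⟩
    have := h₂.monotoneOn_snd hτ ht₂ ht.1.le
    have := h₁.monotoneOn_snd ⟨ht₂.1, ht₂.2.trans hT⟩ ⟨h₂.lt, hT⟩ ht.2.le
    linarith

-- With `T₃ = T₂` the Wronskian of the differences would be positive and increasing on `(S, T₂)`,
-- yet bounded above by a function that tends to `0` at `T₂`.
theorem BlowUp.right_lt_of_forall_lt (h₁ : BlowUp U₁ V₁ S T₁) (h₂ : BlowUp U₂ V₂ S T₂)
    (h₃ : BlowUp U₃ V₃ S T₃) (hT₁ : T₂ ≤ T₁) (h₁₂ : ∀ t ∈ Ioo S T₂, U₁ t < U₂ t)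
    (h₂₃ : ∀ t ∈ Ioo S (min T₂ T₃), U₂ t < U₃ t) : T₃ < T₂ := by
  obtain ⟨c, hSc, hc⟩ := exists_between (lt_min h₂.lt h₃.lt)
  obtain ⟨hc₂, hc₃⟩ := lt_min_iff.1 hc
  refine (h₂.right_le_of_le h₃ ⟨hSc, hc₂⟩ ⟨hSc, hc₃⟩ fun t ht =>
    (h₂₃ t ⟨hSc.trans ht.1, ht.2⟩).le).lt_of_ne ?_
  rintro rfl
  rw [min_self] at h₂₃
  have hmono : ∀ b < T₃, StrictMonoOn (wronskian (U₂ - U₁) (V₂ - V₁) (U₃ - U₂) (V₃ - V₂))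
      (Ioc S b) := fun b hb =>
    h₁.strictMonoOn_wronskian_sub h₂ h₃ (hb.trans_le hT₁) hb hb
      (fun t ht => h₁₂ t ⟨ht.1, ht.2.trans hb⟩) fun t ht => h₂₃ t ⟨ht.1, ht.2.trans hb⟩
  have hpos : 0 < wronskian (U₂ - U₁) (V₂ - V₁) (U₃ - U₂) (V₃ - V₂) c :=
    h₁.wronskian_sub_pos h₂ h₃ hSc (hc₂.trans_le hT₁) hc₂ hc₃
      (fun t ht => h₁₂ t ⟨ht.1, ht.2.trans hc₂⟩) fun t ht => h₂₃ t ⟨ht.1, ht.2.trans hc₂⟩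
  have hnear : ∀ᶠ t in 𝓝[<] T₃, t ∈ Ioo S T₃ := Ioo_mem_nhdsLT h₂.lt
  obtain ⟨M, hM⟩ := h₁.exists_eventually_neg_le_snd_sub h₂ hT₁ h₁₂
  obtain ⟨_, hN⟩ := h₂.exists_eventually_snd_sub_mem_Icc_right h₃ (hnear.mono h₂₃)
  have hlim : Tendsto (fun t => M * (U₃ t - U₂ t)) (𝓝[<] T₃) (𝓝 0) := by
    simpa only [mul_zero] using (h₂.tendsto_diff_right h₃).const_mul M
  refine hpos.not_ge (ge_of_tendsto hlim ?_)
  filter_upwards [hM, hN, Ioo_mem_nhdsLT hc₂] with t htM htN htc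
  have ht : t ∈ Ioo S T₃ := ⟨hSc.trans htc.1, htc.2⟩
  calc wronskian (U₂ - U₁) (V₂ - V₁) (U₃ - U₂) (V₃ - V₂) c
      ≤ (U₂ t - U₁ t) * (V₃ t - V₂ t) - (V₂ t - V₁ t) * (U₃ t - U₂ t) :=
        (hmono t ht.2 ⟨hSc, htc.1.le⟩ ⟨ht.1, le_rfl⟩ htc.1).le
    _ ≤ M * (U₃ t - U₂ t) := by
        linarith [mul_nonneg (sub_pos.2 (h₁₂ t ht)).le (neg_nonneg.2 htN.2),
          mul_le_mul_of_nonneg_right htM (sub_pos.2 (h₂₃ t ht)).le]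

theorem BlowUp.exists_min_right_lt (hS : 0 ≤ S) (h : BlowUp U V S T) (hτ : τ ∈ Ioo S T)
    (hV : V τ = 0) : ∃ ε > 0, ∀ {U₁ V₁ U₂ V₂ : ℝ → ℝ} {T₁ T₂ τ₁ τ₂ : ℝ},
      BlowUp U₁ V₁ S T₁ → BlowUp U₂ V₂ S T₂ → τ₁ ∈ Ioo S T₁ → τ₂ ∈ Ioo S T₂ → V₁ τ₁ = 0 →
      V₂ τ₂ = 0 → |τ₁ - τ| < ε → U τ - 1 ≤ U₁ τ₁ → U₁ τ₁ < U τ → U τ < U₂ τ₂ →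
      min T₁ T₂ < T := by
  obtain ⟨ε, hε, hcross⟩ := h.exists_snd_nonneg_of_crossing hS hτ hV
  refine ⟨ε, hε, fun {U₁ V₁ U₂ V₂ T₁ T₂ τ₁ τ₂} h₁ h₂ hτ₁ hτ₂ hV₁ hV₂ hclose hge hlt₁ hlt₂ => ?_⟩
  by_contra! hT
  obtain ⟨hT₁, hT₂⟩ := le_min_iff.1 hT
  have hbelow : ∀ t ∈ Ioo S T, U₁ t < U t :=
    lt_of_forall_snd_nonneg_of_crossing hS h₁ h hT₁
      (eventually_lt_of_min_lt hS h₁ h hτ₁ hτ hV₁ hV hlt₁) fun b hb heq hlt =>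
        hcross h₁ hτ₁ hV₁ hclose hge ⟨hb.1, hb.2.trans_le hT₁⟩ hb.2 heq hlt
  have habove : ∀ t ∈ Ioo S T, U t < U₂ t := h₁.lt_of_forall_lt h h₂ hT₁ hT₂ hbelow
    (eventually_lt_of_min_lt hS h h₂ hτ hτ₂ hV hV₂ hlt₂)
  exact (h₁.right_lt_of_forall_lt h h₂ hT₁ hbelow (by rwa [min_eq_left hT₂])).not_ge hT₂

end Consecutive

section Levels

variable {f : ℝ → ℝ} {a c l y : ℝ}

theorem exists_forall_lt_iff (hf : Continuous f) (hlow : ∀ σ ≤ a, f σ < c)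
    (hhigh : ∃ᶠ σ in atTop, c < f σ) (hinj : ∀ σ₁ σ₂, f σ₁ = c → f σ₂ = c → σ₁ = σ₂) :
    ∃ τ, ∀ σ, (f σ < c ↔ σ < τ) ∧ (c < f σ ↔ τ < σ) := by
  obtain ⟨b, hab, hb⟩ := frequently_atTop'.1 hhigh a
  obtain ⟨τ, -, hτ⟩ := intermediate_value_Icc hab.le hf.continuousOn ⟨(hlow a le_rfl).le, hb.le⟩
  have hlt : ∀ σ < τ, f σ < c := by
    intro σ hσ
    by_contra! hle
    have haσ : a ≤ σ := by
      by_contra! h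
      exact (hlow σ h.le).not_ge hle
    obtain ⟨x, hx, hfx⟩ := intermediate_value_Icc haσ hf.continuousOn ⟨(hlow a le_rfl).le, hle⟩
    exact (hx.2.trans_lt hσ).ne (hinj x τ hfx hτ)
  have hgt : ∀ σ > τ, c < f σ := by
    intro σ hσ
    by_contra! hle
    obtain ⟨b, hσb, hb⟩ := frequently_atTop'.1 hhigh σ
    obtain ⟨x, hx, hfx⟩ := intermediate_value_Icc hσb.le hf.continuousOn ⟨hle, hb.le⟩
    exact (hσ.trans_le hx.1).ne' (hinj x τ hfx hτ)
  refine ⟨τ, fun σ => ?_⟩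
  rcases lt_trichotomy σ τ with hσ | rfl | hσ
  · exact ⟨iff_of_true (hlt σ hσ) hσ, iff_of_false (hlt σ hσ).not_gt hσ.not_gt⟩
  · simp only [hτ, lt_irrefl, and_self]
  · exact ⟨iff_of_false (hgt σ hσ).not_gt hσ.not_gt, iff_of_true (hgt σ hσ) hσ⟩

theorem min_lt_of_forall_exists_min_lt (hf : Continuous f)
    (hmin : ∀ m, ∃ ε > 0, ∀ a ∈ Ioo (m - ε) m, ∀ b > m, min (f a) (f b) < f m) {a x b : ℝ}
    (hax : a < x) (hxb : x < b) : min (f a) (f b) < f x := by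
  by_contra! hle
  obtain ⟨z, hz, hzmin⟩ : ∃ z ∈ Ioo a b, IsMinOn f (Icc a b) z := by
    obtain ⟨y, hy, hymin⟩ := isCompact_Icc.exists_isMinOn
      (nonempty_Icc.2 (hax.trans hxb).le) hf.continuousOn
    by_cases hyab : y ∈ Ioo a b
    · exact ⟨y, hyab, hymin⟩
    · have hfxy : f x ≤ f y := by
        rcases eq_endpoints_or_mem_Ioo_of_mem_Icc hy with rfl | rfl | hy
        · exact hle.trans (min_le_left _ _)
        · exact hle.trans (min_le_right _ _)
        · exact absurd hy hyab
      exact ⟨x, ⟨hax, hxb⟩, fun w hw => hfxy.trans (hymin hw)⟩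
  obtain ⟨ε, hε, hlt⟩ := hmin z
  obtain ⟨p, hp, hpz⟩ := exists_between (max_lt hz.1 (sub_lt_self z hε))
  obtain ⟨hap, hεp⟩ := max_lt_iff.1 hp
  exact (hlt p ⟨hεp, hpz⟩ b hz.2).not_ge
    (le_min (hzmin ⟨hap.le, hpz.le.trans hz.2.le⟩) (hzmin (right_mem_Icc.2 (hax.trans hxb).le)))

theorem encard_max_level (hq : ∀ {a x b}, a < x → x < b → min (f a) (f b) < f x) {m₀ : ℝ}
    (hmax : ∀ m, f m ≤ f m₀) : {m | f m = f m₀}.encard = 1 := by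
  rw [encard_eq_one]
  refine ⟨m₀, eq_singleton_iff_unique_mem.2 ⟨rfl, fun m (hm : f m = f m₀) => ?_⟩⟩
  by_contra hne
  rcases lt_or_gt_of_ne hne with hlt | hlt
  · obtain ⟨x, hmx, hx⟩ := exists_between hlt
    exact (hmax x).not_gt (by simpa only [hm, min_self] using hq hmx hx)
  · obtain ⟨x, hx, hxm⟩ := exists_between hlt
    exact (hmax x).not_gt (by simpa only [hm, min_self] using hq hx hxm)

theorem encard_level (hf : Continuous f) (hlim : Tendsto f (cocompact ℝ) (𝓝 l))
    (hq : ∀ {a x b}, a < x → x < b → min (f a) (f b) < f x) {m₀ : ℝ} (hly : l < y)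
    (hy : y < f m₀) : {m | f m = y}.encard = 2 := by
  rw [cocompact_eq_atBot_atTop, tendsto_sup] at hlim
  obtain ⟨p, hpm, hp⟩ :=
    ((eventually_lt_atBot m₀).and (hlim.1.eventually_lt_const hly)).exists
  obtain ⟨q, hmq, hq'⟩ :=
    ((eventually_gt_atTop m₀).and (hlim.2.eventually_lt_const hly)).exists
  obtain ⟨a, ha, hfa⟩ := intermediate_value_Ioo hpm.le hf.continuousOn ⟨hp, hy⟩
  obtain ⟨b, hb, hfb⟩ := intermediate_value_Ioo' hmq.le hf.continuousOn ⟨hq', hy⟩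
  have hab : a < b := ha.2.trans hb.1
  have hthree : ∀ {u v w}, u < v → v < w → f u = y → f v = y → f w = y → False :=
    fun huv hvw hu hv hw => (hq huv hvw).ne (by rw [hu, hv, hw, min_self])
  rw [encard_eq_two]
  refine ⟨a, b, hab.ne, Subset.antisymm (fun m (hm : f m = y) => ?_) ?_⟩
  · by_contra hne
    simp only [mem_insert_iff, mem_singleton_iff, not_or] at hne
    rcases lt_or_gt_of_ne hne.1 with hma | ham
    · exact hthree hma hab hm hfa hfb
    · rcases lt_or_gt_of_ne hne.2 with hmb | hbm
      · exact hthree ham hmb hfa hm hfb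
      · exact hthree hab hbm hfa hfb hm
  · rintro m (rfl | rfl) <;> assumption

end Levels

section RightTime

variable {S : ℝ} {τ : ℝ → ℝ}

/-- `τ m` is the point at which the blow-up solution with left end point `S` and minimum value `m`
attains its minimum, expressed through the position of `S` relative to the left end points of the
solutions attaining the value `m` as a minimum elsewhere. -/
structure IsMinPoint (S : ℝ) (τ : ℝ → ℝ) : Prop where
  continuous : Continuous τ
  leftTime_lt_iff : ∀ m σ, leftTime (σ, m) < S ↔ σ < τ m
  lt_leftTime_iff : ∀ m σ, S < leftTime (σ, m) ↔ τ m < σ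

theorem exists_isMinPoint (hS : 0 ≤ S) : ∃ τ, IsMinPoint S τ := by
  have hex : ∀ m, ∃ τ, ∀ σ, (leftTime (σ, m) < S ↔ σ < τ) ∧ (S < leftTime (σ, m) ↔ τ < σ) := by
    refine fun m => exists_forall_lt_iff (f := fun σ => leftTime (σ, m)) (a := S)
      (continuous_leftTime.comp (by fun_prop)) (fun σ hσ => (fst_mem_Ioo (σ, m)).1.trans_le hσ)
      (frequently_atTop'.2 fun b => ?_) fun σ₁ σ₂ hσ₁ hσ₂ => ?_
    · obtain ⟨σ, hσ, hlt⟩ := exists_lt_leftTime (max b S) m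
      exact ⟨σ, (le_max_left _ _).trans_lt hσ, (le_max_right _ _).trans_lt hlt⟩
    · have h₁ := blowUp_min (σ₁, m)
      have h₂ := blowUp_min (σ₂, m)
      have hm₁ := fst_mem_Ioo (σ₁, m)
      have hm₂ := fst_mem_Ioo (σ₂, m)
      rw [hσ₁] at h₁ hm₁
      rw [hσ₂] at h₂ hm₂
      exact BlowUp.eq_of_min_eq hS h₁ h₂ hm₁ hm₂ (minV_fst _) (minV_fst _)
        ((minU_fst _).trans (minU_fst (σ₂, m)).symm)
  choose τ hτ using hex
  have hcont : ∀ σ, Continuous fun m => leftTime (σ, m) := fun σ =>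
    continuous_leftTime.comp (by fun_prop)
  refine ⟨τ, OrderTopology.continuous_iff.2 fun σ => ⟨?_, ?_⟩, fun m σ => (hτ m σ).1,
    fun m σ => (hτ m σ).2⟩
  · simpa only [hτ, preimage, mem_Ioi] using isOpen_lt (hcont σ) (continuous_const (y := S))
  · simpa only [hτ, preimage, mem_Iio] using isOpen_lt (continuous_const (y := S)) (hcont σ)

lemma IsMinPoint.leftTime_eq_iff (hτ : IsMinPoint S τ) {m σ : ℝ} :
    leftTime (σ, m) = S ↔ σ = τ m := by
  rw [eq_iff_le_not_lt, eq_iff_le_not_lt, ← not_lt, hτ.lt_leftTime_iff, hτ.leftTime_lt_iff, not_lt]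

lemma IsMinPoint.leftTime_eq (hτ : IsMinPoint S τ) (m : ℝ) : leftTime (τ m, m) = S :=
  hτ.leftTime_eq_iff.2 rfl

lemma IsMinPoint.blowUp (hτ : IsMinPoint S τ) (m : ℝ) :
    BlowUp (minU (τ m, m)) (minV (τ m, m)) S (rightTime (τ m, m)) :=
  hτ.leftTime_eq m ▸ blowUp_min (τ m, m)

lemma IsMinPoint.mem_Ioo (hτ : IsMinPoint S τ) (m : ℝ) : τ m ∈ Ioo S (rightTime (τ m, m)) :=
  hτ.leftTime_eq m ▸ fst_mem_Ioo (τ m, m)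

theorem IsMinPoint.continuous_right (hτ : IsMinPoint S τ) :
    Continuous fun m => rightTime (τ m, m) :=
  have := hτ.continuous
  continuous_rightTime.comp (by fun_prop)

theorem IsMinPoint.tendsto_right_cocompact (hτ : IsMinPoint S τ) :
    Tendsto (fun m => rightTime (τ m, m)) (cocompact ℝ) (𝓝 S) := by
  have hsqrt : Tendsto (fun m : ℝ => √|m|) (cocompact ℝ) atTop :=
    Real.tendsto_sqrt_atTop.comp tendsto_norm_cocompact_atTop
  have hbound : Tendsto (fun m : ℝ => S + 12 / √|m|) (cocompact ℝ) (𝓝 S) := by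
    simpa only [add_zero] using (hsqrt.const_div_atTop 12).const_add S
  refine tendsto_of_tendsto_of_tendsto_of_le_of_le' tendsto_const_nhds hbound
    (Eventually.of_forall fun m => (hτ.blowUp m).lt.le) ?_
  filter_upwards [hsqrt.eventually_gt_atTop 0] with m hm
  have hsq : |m| = √|m| ^ 2 := (Real.sq_sqrt (abs_nonneg m)).symm
  have hright := rightTime_le (τ := τ m) hm hsq
  have hleft := le_leftTime (τ := τ m) hm hsq
  rw [hτ.leftTime_eq] at hleft
  linarith [show 12 / √|m| = 6 / √|m| + 6 / √|m| by ring]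

theorem IsMinPoint.min_right_lt (hS : 0 ≤ S) (hτ : IsMinPoint S τ) {a x b : ℝ} (ha : a < x)
    (hb : x < b) : min (rightTime (τ a, a)) (rightTime (τ b, b)) < rightTime (τ x, x) := by
  refine min_lt_of_forall_exists_min_lt hτ.continuous_right (fun m => ?_) ha hb
  obtain ⟨ε, hε, hlt⟩ := (hτ.blowUp m).exists_min_right_lt hS (hτ.mem_Ioo m) (minV_fst _)
  obtain ⟨δ, hδ, hclose⟩ := Metric.continuousAt_iff.1 (hτ.continuous.continuousAt (x := m)) ε hε
  refine ⟨min δ 1, by positivity, fun a ha b hb => ?_⟩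
  have : m - min δ 1 < a := ha.1
  have := min_le_left δ 1
  have := min_le_right δ 1
  refine hlt (hτ.blowUp a) (hτ.blowUp b) (hτ.mem_Ioo a) (hτ.mem_Ioo b) (minV_fst _) (minV_fst _)
    ?_ ?_ ?_ ?_
  · exact hclose (by rw [Real.dist_eq, abs_lt]; constructor <;> linarith [ha.2])
  all_goals simp only [minU_fst (_, _)]; linarith [ha.2]

theorem IsMinPoint.exists_encard_rightTime (hS : 0 ≤ S) (hτ : IsMinPoint S τ) :
    ∃ m₀, (∀ m, rightTime (τ m, m) ≤ rightTime (τ m₀, m₀)) ∧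
      {m | rightTime (τ m, m) = rightTime (τ m₀, m₀)}.encard = 1 ∧
      ∀ y, S < y → y < rightTime (τ m₀, m₀) → {m | rightTime (τ m, m) = y}.encard = 2 := by
  obtain ⟨m₀, hmax⟩ := hτ.continuous_right.exists_forall_ge' 0
    (hτ.tendsto_right_cocompact.eventually_le_const (hτ.blowUp 0).lt)
  exact ⟨m₀, hmax, encard_max_level (hτ.min_right_lt hS) hmax, fun y hSy hy =>
    encard_level hτ.continuous_right hτ.tendsto_right_cocompact (hτ.min_right_lt hS)
      hSy hy⟩

end RightTime

section Touching

variable {F U V : ℝ → ℝ} {S M b : ℝ} {τ : ℝ → ℝ}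

theorem isOpen_setOf_forall_lt_minU (hF : Continuous F) (hM : ∀ t, F t ≤ M) :
    IsOpen {p : ℝ × ℝ | ∀ t ∈ Ioo (leftTime p) (rightTime p), F t < minU p t} := by
  refine isOpen_iff_mem_nhds.2 fun p₀ hp₀ => ?_
  have h := blowUp_min p₀
  have hmem := fst_mem_Ioo p₀
  obtain ⟨α, hUα, hα⟩ := ((h.left.eventually_gt_atTop (M + 1)).and
    (Ioo_mem_nhdsGT hmem.1)).exists
  obtain ⟨β, hUβ, hβ⟩ := ((h.right.eventually_gt_atTop (M + 1)).and
    (Ioo_mem_nhdsLT hmem.2)).exists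
  have hαβ : α ≤ β := (hα.2.trans hβ.1).le
  have hsub : Icc α β ⊆ Ioo (leftTime p₀) (rightTime p₀) := Icc_subset_Ioo hα.1 hβ.2
  obtain ⟨t₀, ht₀, hmin⟩ := isCompact_Icc.exists_isMinOn (nonempty_Icc.2 hαβ)
    ((h.sol.continuousOn_fst.mono hsub).sub hF.continuousOn)
  have hgap : 0 < minU p₀ t₀ - F t₀ := sub_pos.2 (hp₀ t₀ (hsub ht₀))
  filter_upwards [exists_nearby_min p₀ hα.1 hβ.2 ⟨hα.2, hβ.1⟩ (lt_min hgap one_pos)]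
    with p ⟨hpI, hleft, hright, hclose⟩ t ht
  have hU : ∀ x ∈ Icc α β, |minU p x - minU p₀ x| < min (minU p₀ t₀ - F t₀) 1 := fun x hx =>
    (le_max_left _ _).trans_lt (hclose x hx)
  rcases lt_or_ge t α with htα | hαt
  · have hle := (blowUp_min p).antitoneOn_fst (fst_mem_Ioo p) (minV_fst p)
      ⟨ht.1, (htα.trans hpI.1).le⟩ ⟨hleft, hpI.1.le⟩ htα.le
    linarith [hM t, (abs_lt.1 ((hU α ⟨le_rfl, hαβ⟩).trans_le (min_le_right _ _))).1]
  rcases lt_or_ge β t with hβt | htβ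
  · have hle := (blowUp_min p).monotoneOn_fst (fst_mem_Ioo p) (minV_fst p)
      ⟨hpI.2.le, hright⟩ ⟨(hpI.2.trans hβt).le, ht.2⟩ hβt.le
    linarith [hM t, (abs_lt.1 ((hU β ⟨hαβ, le_rfl⟩).trans_le (min_le_right _ _))).1]
  · have hle : minU p₀ t₀ - F t₀ ≤ minU p₀ t - F t := hmin ⟨hαt, htβ⟩
    linarith [(abs_lt.1 ((hU t ⟨hαt, htβ⟩).trans_le (min_le_left _ _))).1]

theorem isOpen_setOf_exists_minU_lt :
    IsOpen {p : ℝ × ℝ | ∃ t ∈ Ioo (leftTime p) (rightTime p), minU p t < F t} := by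
  refine isOpen_iff_mem_nhds.2 fun p₀ ⟨t, ht, hlt⟩ => ?_
  have hmem := fst_mem_Ioo p₀
  obtain ⟨α, hα, hα'⟩ := exists_between (lt_min ht.1 hmem.1)
  obtain ⟨β, hβ', hβ⟩ := exists_between (max_lt ht.2 hmem.2)
  obtain ⟨hαt, hαp⟩ := lt_min_iff.1 hα'
  obtain ⟨htβ, hpβ⟩ := max_lt_iff.1 hβ'
  filter_upwards [exists_nearby_min p₀ hα hβ ⟨hαp, hpβ⟩ (sub_pos.2 hlt)]
    with p ⟨_, hleft, hright, hclose⟩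
  have hU : |minU p t - minU p₀ t| < F t - minU p₀ t :=
    (le_max_left _ _).trans_lt (hclose t ⟨hαt.le, htβ.le⟩)
  exact ⟨t, ⟨hleft.trans hαt, htβ.trans hright⟩, by linarith [(abs_lt.1 hU).2]⟩

theorem exists_touching (hF : Continuous F) (hM : ∀ t, |F t| ≤ M) (hτ : Continuous τ) :
    ∃ m, ∃ t ∈ Ioo (leftTime (τ m, m)) (rightTime (τ m, m)), minU (τ m, m) t = F t ∧
      ∀ x ∈ Ioo (leftTime (τ m, m)) (rightTime (τ m, m)), F x ≤ minU (τ m, m) x := by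
  by_contra! hne
  have hc : Continuous fun m => (τ m, m) := hτ.prodMk continuous_id
  have habove := (isOpen_setOf_forall_lt_minU hF fun t => (le_abs_self _).trans (hM t)).preimage hc
  have hbelow := (isOpen_setOf_exists_minU_lt (F := F)).preimage hc
  have hcover : ∀ m, (∀ t ∈ Ioo (leftTime (τ m, m)) (rightTime (τ m, m)), F t < minU (τ m, m) t) ∨
      ∃ t ∈ Ioo (leftTime (τ m, m)) (rightTime (τ m, m)), minU (τ m, m) t < F t := by
    refine fun m => or_iff_not_imp_right.2 fun hm t ht => ?_
    have hle : ∀ x ∈ Ioo (leftTime (τ m, m)) (rightTime (τ m, m)), F x ≤ minU (τ m, m) x :=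
      fun x hx => not_lt.1 fun hlt => hm ⟨x, hx, hlt⟩
    refine (hle t ht).lt_of_ne' fun heq => ?_
    obtain ⟨x, hx, hlt⟩ := hne m t ht heq
    exact (hle x hx).not_gt hlt
  have hlarge : ∀ t ∈ Ioo (leftTime (τ (M + 1), M + 1)) (rightTime (τ (M + 1), M + 1)),
      F t < minU (τ (M + 1), M + 1) t := fun t ht => by
    have hmin := (blowUp_min _).min_le (fst_mem_Ioo (τ (M + 1), M + 1)) (minV_fst _) ht
    rw [minU_fst (_, _)] at hmin
    linarith [(abs_le.1 (hM t)).2]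
  have hsmall : minU (τ (-M - 1), -M - 1) (τ (-M - 1)) < F (τ (-M - 1)) := by
    rw [minU_fst (_, _)]
    linarith [(abs_le.1 (hM (τ (-M - 1)))).1]
  obtain ⟨m, -, hall, t, ht, hlt⟩ := isPreconnected_univ _ _ habove hbelow (fun m _ => hcover m)
    ⟨M + 1, trivial, hlarge⟩ ⟨-M - 1, trivial, τ (-M - 1), fst_mem_Ioo (_, -M - 1), hsmall⟩
  exact (hall t ht).not_gt hlt

theorem IsMinPoint.exists_le_rightTime (hτ : IsMinPoint S τ) (h : SolvesSystem abs U V (Icc S b)) :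
    ∃ m, b ≤ rightTime (τ m, m) := by
  by_contra! hlt
  have hSb : S ≤ b := ((hτ.blowUp 0).lt.trans (hlt 0)).le
  have hcont : ContinuousOn U (Icc S b) := h.continuousOn_fst
  obtain ⟨M, hM⟩ := isCompact_Icc.exists_bound_of_continuousOn hcont
  obtain ⟨m, t, ht, heq, hle⟩ := exists_touching (F := IccExtend hSb ((Icc S b).domRestrict U))
    (continuousOn_iff_continuous_domRestrict.1 hcont).Icc_extend'
    (fun t => hM _ (projIcc S b hSb t).2) hτ.continuous
  rw [hτ.leftTime_eq] at ht hle
  have hsub : Ioo S (rightTime (τ m, m)) ⊆ Icc S b := fun x hx =>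
    ⟨hx.1.le, (hx.2.trans (hlt m)).le⟩
  have hF : ∀ x ∈ Ioo S (rightTime (τ m, m)), IccExtend hSb ((Icc S b).domRestrict U) x = U x :=
    fun x hx => IccExtend_of_mem hSb _ (hsub hx)
  have hU : minU (τ m, m) t = U t := heq.trans (hF t ht)
  have hV : minV (τ m, m) t = V t := by
    have hmin : IsLocalMin (fun x => minU (τ m, m) x - U x) t := by
      filter_upwards [Ioo_mem_nhds ht.1 ht.2] with x hx
      linarith [hle x hx, hF x hx]
    exact sub_eq_zero.1 (hmin.hasDerivAt_eq_zero
      (((hτ.blowUp m).sol t ht).1.sub (h t (hsub ht)).1))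
  refine not_tendsto_atTop_of_continuousAt (l := 𝓝[>] S) nhdsWithin_le_nhds
    (h S ⟨le_rfl, hSb⟩).1.continuousAt ((hτ.blowUp m).left.congr' ?_)
  filter_upwards [Ioo_mem_nhdsGT (hτ.blowUp m).lt] with x hx
  exact ((hτ.blowUp m).sol.eqOn (h.mono hsub) ht hU hV hx).1

theorem IsMinPoint.exists_solvesSystem_Icc (hτ : IsMinPoint S τ) {m : ℝ}
    (hb : b < rightTime (τ m, m)) : ∃ U V, SolvesSystem abs U V (Icc S b) := by
  have hcont : Continuous fun σ : ℝ => rightTime (σ, m) := continuous_rightTime.comp (by fun_prop)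
  have hright : ∀ᶠ σ in 𝓝[<] τ m, b < rightTime (σ, m) :=
    (hcont.continuousAt.eventually_const_lt hb).filter_mono nhdsWithin_le_nhds
  obtain ⟨σ, hbσ, hσ⟩ := (hright.and self_mem_nhdsWithin).exists
  exact ⟨_, _, (blowUp_min (σ, m)).sol.mono
    (Icc_subset_Ioo ((hτ.leftTime_lt_iff m σ).2 hσ) hbσ)⟩

end Touching

section IntervalOfExistence

variable {U V y : ℝ → ℝ} {s J K : Set ℝ} {b c x₀ x₁ : ℝ}

lemma isSolutionOn_iff : IsSolutionOn y J ↔ SolvesSystem (fun x => -x) y (deriv y) J := by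
  refine forall₂_congr fun x _ => ?_
  rw [sub_eq_add_neg]
  exact and_congr_left fun _ => ⟨fun h => h.hasDerivAt, fun h => h.differentiableAt⟩

lemma SolvesSystem.isSolutionOn (hJ : IsOpen J) (h : SolvesSystem (fun x => -x) U V J) :
    IsSolutionOn U J :=
  isSolutionOn_iff.2 (h.congr hJ (eqOn_refl U J) fun x hx => (h x hx).1.deriv)

lemma solvesSystem_neg_iff_abs (hs : s ⊆ Iic 0) :
    SolvesSystem (fun x => -x) U V s ↔ SolvesSystem abs U V s :=
  forall₂_congr fun _ hx => by rw [abs_of_nonpos (hs hx)]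

lemma blowUp_deriv_iff (hx₀ : x₀ ≤ 0) (hx : x₁ < x₀) : BlowUp y (deriv y) x₁ x₀ ↔
    IsSolutionOn y (Ioo x₁ x₀) ∧ Tendsto y (𝓝[>] x₁) atTop ∧ Tendsto y (𝓝[<] x₀) atTop := by
  rw [isSolutionOn_iff, solvesSystem_neg_iff_abs fun x hx => hx.2.le.trans hx₀]
  exact ⟨fun h => ⟨h.sol, h.left, h.right⟩, fun h => ⟨hx, h.1, h.2.1, h.2.2⟩⟩

theorem hasIntervalOfExistence_iff (hc : c ∈ J) : HasIntervalOfExistence y J ↔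
    IsSolutionOn y J ∧ J = ⋃₀ solutionIntervals (fun x => -x) c (y c, deriv y c) := by
  obtain ⟨hJo, hJ, -, U, V, h, hp⟩ :=
    sUnion_mem_solutionIntervals continuous_neg c (y c, deriv y c)
  obtain ⟨hU, hV⟩ := Prod.mk_inj.1 hp
  constructor
  · intro hy
    have hsol := isSolutionOn_iff.1 hy.isSolutionOn
    have hJ' : J.OrdConnected := hy.isConnected.isPreconnected.ordConnected
    have hsub := subset_sUnion_of_mem (show J ∈ solutionIntervals (fun x => -x) c (y c, deriv y c)
      from ⟨hy.isOpen, hJ', hc, y, deriv y, hsol, rfl⟩)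
    exact ⟨hy.isSolutionOn, (hy.maximal U _ hJo ⟨⟨c, hsub hc⟩, hJ.isPreconnected⟩ hsub
      (h.isSolutionOn hJo) fun x hx => ((h.mono hsub).eqOn hsol hc hU hV hx).1).symm⟩
  · rintro ⟨hy, hJeq⟩
    refine ⟨hJeq ▸ hJo, ⟨⟨c, hc⟩, hJeq ▸ hJ.isPreconnected⟩, hy, fun z K hK hK' hsub hz he => ?_⟩
    refine Subset.antisymm ?_ hsub
    have hderiv : deriv z c = deriv y c :=
      (he.eventuallyEq_of_mem ((hJeq ▸ hJo : IsOpen J).mem_nhds hc)).deriv_eq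
    rw [hJeq]
    exact subset_sUnion_of_mem ⟨hK, hK'.isPreconnected.ordConnected, hsub hc, z, deriv z,
      isSolutionOn_iff.1 hz, Prod.ext (he hc) hderiv⟩

lemma HasIntervalOfExistence.subset_of_mem (h : HasIntervalOfExistence y J) (hc : c ∈ J)
    (hK : K ∈ solutionIntervals (fun x => -x) c (y c, deriv y c)) : K ⊆ J :=
  ((hasIntervalOfExistence_iff hc).1 h).2 ▸ subset_sUnion_of_mem hK

lemma BlowUp.hasIntervalOfExistence (hx₀ : x₀ ≤ 0) (h : BlowUp y V x₁ x₀) :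
    HasIntervalOfExistence y (Ioo x₁ x₀) where
  isOpen := isOpen_Ioo
  isConnected := isConnected_Ioo h.lt
  isSolutionOn := ((solvesSystem_neg_iff_abs fun _ hx => hx.2.le.trans hx₀).2 h.sol).isSolutionOn
    isOpen_Ioo
  maximal z K _ hK hsub hz he := by
    obtain ⟨c, hc⟩ := exists_between h.lt
    have hK' : K.OrdConnected := hK.isPreconnected.ordConnected
    have hcont : ∀ x ∈ K, ContinuousAt z x := fun x hx => (hz x hx).1.continuousAt
    have hx₁K : x₁ ∉ K := fun hx => by
      refine not_tendsto_atTop_of_continuousAt (l := 𝓝[>] x₁) nhdsWithin_le_nhds (hcont _ hx)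
        (h.left.congr' ?_)
      filter_upwards [Ioo_mem_nhdsGT h.lt] with t ht using (he ht).symm
    have hx₀K : x₀ ∉ K := fun hx => by
      refine not_tendsto_atTop_of_continuousAt (l := 𝓝[<] x₀) nhdsWithin_le_nhds (hcont _ hx)
        (h.right.congr' ?_)
      filter_upwards [Ioo_mem_nhdsLT h.lt] with t ht using (he ht).symm
    refine Subset.antisymm (fun p hp => ⟨?_, ?_⟩) hsub
    · exact not_le.1 fun hle => hx₁K (hK'.out hp (hsub hc) ⟨hle, hc.1.le⟩)
    · exact not_le.1 fun hle => hx₀K (hK'.out (hsub hc) hp ⟨hc.2.le, hle⟩)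

lemma HasIntervalOfExistence.blowUp (hx₀ : x₀ ≤ 0) (hx : x₁ < x₀)
    (h : HasIntervalOfExistence y (Ioo x₁ x₀)) : BlowUp y (deriv y) x₁ x₀ := by
  have hsol := isSolutionOn_iff.1 h.isSolutionOn
  obtain ⟨c, hc⟩ := exists_between hx
  refine (blowUp_deriv_iff hx₀ hx).2 ⟨h.isSolutionOn, ?_, ?_⟩
  · rcases hsol.reflect_Ioo.tendsto_atTop_or_exists_extension (by fun_prop)
      (fun t ht => by linarith [ht.1]) (neg_mem_Ioo_neg hc) with hlim | ⟨η, hη, hext⟩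
    · simpa [Function.comp_def] using! hlim.comp (tendsto_neg_nhdsGT (a := x₁))
    · have hmem := neg_mem_solutionIntervals hext
      simp only [neg_neg] at hmem
      exact absurd (h.subset_of_mem hc hmem (show x₁ ∈ -Ioo (-x₀) (-x₁ + η) by simp [hx, hη])).1
        (lt_irrefl x₁)
  · rcases hsol.tendsto_atTop_or_exists_extension (by fun_prop)
      (fun t ht => by linarith [ht.2]) hc with hlim | ⟨η, hη, hext⟩
    · exact hlim
    · exact absurd (h.subset_of_mem hc hext ⟨hx, lt_add_of_pos_right x₀ hη⟩).2 (lt_irrefl x₀)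

theorem le_X_iff {a : EReal} : a ≤ X x₀ ↔ ∀ b ≤ x₀, ∀ U V,
    SolvesSystem (fun x => -x) U V (Icc b x₀) → a ≤ b := by
  constructor
  · intro ha b hb U V h
    obtain ⟨δ, hδ, hnear⟩ := h.exists_nearby continuous_neg ⟨hb, le_rfl⟩ one_pos
    obtain ⟨U', V', η, hη, h', -⟩ := hnear x₀ ⟨hb, le_rfl⟩ (by simpa) (U x₀, V x₀) (by simpa)
    have hmem := h'.Ioo_mem_solutionIntervals
      ⟨(sub_lt_self b hη).trans_le hb, lt_add_of_pos_right x₀ hη⟩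
    obtain ⟨hJo, -, hxJ, y, W, hy, hp⟩ :=
      sUnion_mem_solutionIntervals continuous_neg x₀ (U' x₀, V' x₀)
    have hJ : HasIntervalOfExistence y _ := (hasIntervalOfExistence_iff hxJ).2
      ⟨hy.isSolutionOn hJo, by rw [(hy x₀ hxJ).1.deriv, hp]⟩
    calc a ≤ leftEnd _ := ha.trans (sInf_le ⟨_, _, y, _, hJ, hxJ, rfl, rfl, rfl⟩)
      _ ≤ b := sInf_le (mem_image_of_mem _ (subset_sUnion_of_mem hmem
        ⟨sub_lt_self b hη, hb.trans_lt (lt_add_of_pos_right x₀ hη)⟩))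
  · refine fun ha => le_sInf ?_
    rintro _ ⟨-, -, y, J, hy, hxJ, -, -, rfl⟩
    refine le_sInf ?_
    rintro _ ⟨b, hbJ, rfl⟩
    have hJ : J.OrdConnected := hy.isConnected.isPreconnected.ordConnected
    rcases le_total b x₀ with hb | hb
    · exact ha b hb y (deriv y) ((isSolutionOn_iff.1 hy.isSolutionOn).mono (hJ.out hbJ hxJ))
    · exact (ha x₀ le_rfl y (deriv y) ((isSolutionOn_iff.1 hy.isSolutionOn).mono
        (hJ.out hxJ hxJ))).trans (EReal.coe_le_coe_iff.2 hb)

end IntervalOfExistence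

section Counting

variable {U V : ℝ → ℝ} {S T b m m' x₀ x₁ : ℝ} {τ : ℝ → ℝ}

lemma exists_solvesSystem_neg_Icc_iff (hx₀ : x₀ ≤ 0) :
    (∃ U V, SolvesSystem (fun x => -x) U V (Icc b x₀)) ↔
      ∃ U V, SolvesSystem abs U V (Icc (-x₀) (-b)) := by
  simp only [solvesSystem_neg_iff_abs fun x (hx : x ∈ Icc b x₀) => hx.2.trans hx₀]
  refine ⟨fun ⟨U, V, h⟩ => ⟨_, _, h.reflect_abs_Icc⟩, fun ⟨U, V, h⟩ => ?_⟩
  have h' := h.reflect_abs_Icc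
  simp only [neg_neg] at h'
  exact ⟨_, _, h'⟩

theorem X_eq (hx₀ : x₀ ≤ 0) (hτ : IsMinPoint (-x₀) τ)
    (hm : ∀ m', rightTime (τ m', m') ≤ rightTime (τ m, m)) :
    X x₀ = ((-rightTime (τ m, m) : ℝ) : EReal) := by
  apply le_antisymm
  · refine le_of_forall_gt_imp_ge_of_dense fun a ha => ?_
    obtain ⟨r, hr, hra⟩ := EReal.lt_iff_exists_real_btwn.1 ha
    obtain ⟨b, hb, hbr⟩ := exists_between (lt_min (EReal.coe_lt_coe_iff.1 hr)
      (neg_lt.1 (hτ.blowUp m).lt))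
    obtain ⟨U, V, h⟩ := (exists_solvesSystem_neg_Icc_iff hx₀).2
      (hτ.exists_solvesSystem_Icc (neg_lt.1 hb))
    have hX : X x₀ ≤ b := le_X_iff.1 le_rfl b (hbr.le.trans (min_le_right _ _)) U V h
    exact hX.trans ((EReal.coe_le_coe_iff.2 (hbr.le.trans (min_le_left _ _))).trans hra.le)
  · refine le_X_iff.2 fun b _ U V h => EReal.coe_le_coe_iff.2 (neg_le.1 ?_)
    obtain ⟨U', V', h'⟩ := (exists_solvesSystem_neg_Icc_iff hx₀).1 ⟨U, V, h⟩
    obtain ⟨m', hm'⟩ := hτ.exists_le_rightTime h'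
    exact hm'.trans (hm m')

lemma IsMinPoint.exists_eqOn (hτ : IsMinPoint S τ) (h : BlowUp U V S T) :
    ∃ m, rightTime (τ m, m) = T ∧ EqOn (minU (τ m, m)) U (Ioo S T) := by
  obtain ⟨σ, hσ, hV⟩ := h.exists_snd_eq_zero
  have hσ' := fst_mem_Ioo (σ, U σ)
  have hU₀ := minU_fst (σ, U σ)
  have hV₀ := (minV_fst (σ, U σ)).trans hV.symm
  have hleft := (blowUp_min (σ, U σ)).left_unique h hσ' hσ hU₀ hV₀
  have hright := (blowUp_min (σ, U σ)).right_unique h hσ' hσ hU₀ hV₀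
  have hsol := (blowUp_min (σ, U σ)).sol
  rw [hleft, hright] at hsol
  refine ⟨U σ, ?_, fun t ht => ?_⟩ <;> rw [← hτ.leftTime_eq_iff.1 hleft]
  · exact hright
  · exact (hsol.eqOn h.sol hσ hU₀ hV₀ ht).1

lemma IsMinPoint.eq_of_eqOn (hτ : IsMinPoint S τ) (hm : rightTime (τ m, m) = T)
    (hm' : rightTime (τ m', m') = T) (heq : EqOn (minU (τ m, m)) (minU (τ m', m')) (Ioo S T)) :
    m = m' := by
  have hle : ∀ {m m'}, rightTime (τ m, m) = T → rightTime (τ m', m') = T →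
      EqOn (minU (τ m, m)) (minU (τ m', m')) (Ioo S T) → m ≤ m' := fun {m m'} hm hm' heq => by
    have hmem : τ m' ∈ Ioo S T := hm' ▸ hτ.mem_Ioo m'
    have hmin := (hτ.blowUp m).min_le (hτ.mem_Ioo m) (minV_fst _) (hm ▸ hmem)
    rwa [heq hmem, minU_fst (_, _), minU_fst (_, _)] at hmin
  exact (hle hm hm' heq).antisymm (hle hm' hm heq.symm)

theorem encard_solutionsWithInterval (hx₀ : x₀ ≤ 0) (hx : x₁ < x₀) (hτ : IsMinPoint (-x₀) τ) :
    (solutionsWithInterval x₁ x₀).encard = {m | rightTime (τ m, m) = -x₁}.encard := by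
  have himage : solutionsWithInterval x₁ x₀ =
      (fun m => (Ioo x₁ x₀).domRestrict fun x => minU (τ m, m) (-x)) ''
        {m | rightTime (τ m, m) = -x₁} := by
    ext f
    constructor
    · rintro ⟨y, hy, rfl⟩
      obtain ⟨m, hm, heq⟩ := hτ.exists_eqOn (HasIntervalOfExistence.blowUp hx₀ hx hy).reflect
      exact ⟨m, hm, funext fun x => by simpa using heq (neg_mem_Ioo_neg x.2)⟩
    · rintro ⟨m, hm, rfl⟩
      have h := (hτ.blowUp m).reflect
      rw [show rightTime (τ m, m) = -x₁ from hm, neg_neg, neg_neg] at h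
      exact ⟨_, h.hasIntervalOfExistence hx₀, rfl⟩
  rw [himage, InjOn.encard_image]
  intro m hm m' hm' heq
  refine hτ.eq_of_eqOn hm hm' fun t ht => ?_
  simpa using congrFun heq ⟨-t, by simpa using! neg_mem_Ioo_neg ht⟩

end Counting

end PainleveOne

theorem theorem7p1 (x₀ : ℝ) (hx₀ : x₀ ≤ 0) :
    (⊥ < PainleveOne.X x₀ ∧ PainleveOne.X x₀ < (x₀ : EReal)) ∧
    ∀ x₁ : ℝ, x₁ < x₀ →
      ((x₁ : EReal) < PainleveOne.X x₀ →
        PainleveOne.solutionsWithInterval x₁ x₀ = ∅) ∧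
      ((x₁ : EReal) = PainleveOne.X x₀ →
        (PainleveOne.solutionsWithInterval x₁ x₀).encard = 1) ∧
      (PainleveOne.X x₀ < (x₁ : EReal) →
        (PainleveOne.solutionsWithInterval x₁ x₀).encard = 2) ∧
      (∀ y : ℝ → ℝ, PainleveOne.HasIntervalOfExistence y (Ioo x₁ x₀) ↔
        PainleveOne.IsSolutionOn y (Ioo x₁ x₀) ∧
          Tendsto y (𝓝[>] x₁) atTop ∧ Tendsto y (𝓝[<] x₀) atTop) := by
  have hS : 0 ≤ -x₀ := neg_nonneg.2 hx₀
  obtain ⟨τ, hτ⟩ := PainleveOne.exists_isMinPoint hS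
  obtain ⟨m₀, hmax, hone, htwo⟩ := hτ.exists_encard_rightTime hS
  rw [PainleveOne.X_eq hx₀ hτ hmax]
  refine ⟨⟨EReal.bot_lt_coe _, EReal.coe_lt_coe_iff.2 (neg_lt.1 (hτ.blowUp m₀).lt)⟩,
    fun x₁ hx₁ => ?_⟩
  have hcard := PainleveOne.encard_solutionsWithInterval hx₀ hx₁ hτ
  simp only [EReal.coe_lt_coe_iff, EReal.coe_eq_coe_iff]
  refine ⟨fun h => ?_, fun h => ?_, fun h => ?_, fun y => ?_⟩
  · rw [← encard_eq_zero, hcard, encard_eq_zero, eq_empty_iff_forall_notMem]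
    exact fun m hm => ((hmax m).trans_lt (lt_neg.1 h)).ne hm
  · rw [hcard, h, neg_neg, hone]
  · rw [hcard, htwo _ (neg_lt_neg hx₁) (neg_lt.1 h)]
  · rw [← PainleveOne.blowUp_deriv_iff hx₀ hx₁]
    exact ⟨fun h => h.blowUp hx₀ hx₁, fun h => h.hasIntervalOfExistence hx₀⟩
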